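/- **Setting.** For each $n$ let $X=X_n$ be a deterministic $n\times p_n$ matrix with, for all large $n$, no zero column, $\beta=\beta_n\in\mathbb R^{p_n}$, and let the response satisfy $Y\sim N(X\beta,\sigma^2 I_n)$ with $\sigma>0$ fixed and known. A model is a subset $k\subset\{1,\dots,p_n\}$; $|k|$ is its size, $X_k$ the matrix of the corresponding columns, $r_k=\operatorname{rank}X_k$, $P_k$ the orthogonal projection onto the column space of $X_k$. The true model is $t=t_n$, with $|t|$ fixed (not depending on $n$). The Bayesian working model is $Y\mid\beta\sim N(X\beta,\sigma^2I)$, $\beta_i\mid Z_i=0\sim N(0,\sigma^2\tau_{0n}^2)$, $\beta_i\mid Z_i=1\sim N(0,\sigma^2\tau_{1n}^2)$, all independent, $Z_i$ i.i.d. Bernoulli$(q_n)$, with $\tau_{0n},\tau_{1n}>0$ and $0<q_n<1$; $\mathrm{PR}(k,t)=P(Z=k\mid Y,\sigma^2)/P(Z=t\mid Y,\sigma^2)$ is the ratio of posterior probabilities. Write $a_n\preceq b_n$ for $a_n=O(b_n)$, $a_n\prec b_n$ for $a_n=o(b_n)$, and $a_n\sim b_n$ if $a_n/b_n$ converges to a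 positive constant. Let $\lambda_M^n$ be the largest eigenvalue of $X'X/n$, $m_n=p_n\wedge\frac{n}{(2+\nu)\log p_n}$, and $\lambda_m^n$ the infimum, over nonempty $k$ with $|k|\le m_n$, of the smallest nonzero eigenvalue of $X_k'X_k/n$. Let $$\Delta_n=\inf\{\|(I-P_k)X_t\beta_t\|_2^2:\ |k|\le K|t|,\ k\not\supset t\},\qquad \gamma_n=5\sigma^2|t|(1+\delta)\log(\sqrt n\vee p_n).$$ **Assumptions.** $0<\nu<\delta$, $K>1+8/\delta$, $\kappa<(K-1)\delta/2$ are fixed, and as $n\to\infty$: $p_n\to\infty$; $\log p_n=o(n)$; $n\tau_{0n}^2=o(1)$; $n\tau_{1n}^2\sim n\vee p_n^{2+3\delta}$; $q_n\sim p_n^{-1}$; $\|X_{t^c}\beta_{t^c}\|_2=O(1)$; $\Delta_n>\gamma_n$ for all large $n$; $\lambda_M^n\prec (n\tau_{0n}^2)^{-1}\wedge n\tau_{1n}^2$; $\lambda_m^n\succeq \frac{n\vee p_n^{2+2\delta}}{n\tau_{1n}^2}\vee p_n^{-\kappa}$; the eigenvalues of $X_t'X_t/n$ are $O(1)$; and $\|\beta_t\|_2^2=O(\tau_{1n}^2)$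 (the last holds automatically if $\beta_t$ is bounded). **Conclusion.** Let $M_1=\{k\ne t: r_k>m_n\}$, $M_2=\{k\supsetneq t: r_k\le m_n\}$, $M_3=\{k\not\supset t: K|t|<r_k\le m_n\}$, $M_4=\{k\not\supset t: r_k\le K|t|\}$, and $v_n=p_n^{-\delta/2}\wedge \frac{p_n^{1+\delta/2}}{\sqrt n}$. There are constants $c',w'>0$ and $w''\in(0,1)$, depending only on $\delta,\nu,\kappa,K,\sigma$ and $|t|$, and a constant $C>0$ (the constant implied by $\preceq$, which may depend on the sequence of problems) such that for all sufficiently large $n$: 1. $\sum_{k\in M_1}\mathrm{PR}(k,t)\le C e^{-w'n}$ with probability at least $1-2e^{-c'n}$; 2. $\sum_{k\in M_2}\mathrm{PR}(k,t)\le C v_n$ with probability greater than $1-e^{-c'\log p_n}$; 3. if $(K-1)|t|\ge1$ or $t=\emptyset$, then $\sum_{k\in M_3}\mathrm{PR}(k,t)\le C v_n^{(K-1)|t|/2+1}$ with probability greater than $1-e^{-c'K|t|\log p_n}$; 4. $\sum_{k\in M_4}\mathrm{PR}(k,t)\le C\exp\{-w'(\Delta_n-w''\gamma_n)\}$ with probability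 greater than $1-e^{-c'\Delta_n}$. (If $t=\emptyset$ then $\Delta_n=\infty$, $M_3$ and $M_4$ are empty, and 3 and 4 are void.) -/

import Mathlib

open MeasureTheory ProbabilityTheory Filter Asymptotics
open scoped Topology ENNReal Matrix

namespace SpikeSlab

noncomputable section

/-! A model is a set `k : Finset (Fin p)` of covariates. -/

/-- The design matrix `X_k` of the model `k`: the columns of `X` indexed by `k`. -/
def subDesign {n p : ℕ} (X : Matrix (Fin n) (Fin p) ℝ) (k : Finset (Fin p)) :
    Matrix (Fin n) k ℝ :=
  X.submatrix id (fun j => (j : Fin p))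

/-- The Gram matrix `X_k' X_k / n`. -/
def gram {n p : ℕ} (X : Matrix (Fin n) (Fin p) ℝ) (k : Finset (Fin p)) : Matrix k k ℝ :=
  (n : ℝ)⁻¹ • ((subDesign X k)ᵀ * subDesign X k)

/-- The dimension `r_k = rank X_k` of the model `k`. -/
def modelRank {n p : ℕ} (X : Matrix (Fin n) (Fin p) ℝ) (k : Finset (Fin p)) : ℕ :=
  (subDesign X k).rank

/-- The set of (real) eigenvalues of a square matrix. -/
def eigenvalueSet {ι : Type} [Fintype ι] [DecidableEq ι] (A : Matrix ι ι ℝ) : Set ℝ :=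
  {x | Module.End.HasEigenvalue (Matrix.toLin' A) x}

/-- The largest eigenvalue. -/
def maxEig {ι : Type} [Fintype ι] [DecidableEq ι] (A : Matrix ι ι ℝ) : ℝ :=
  sSup (eigenvalueSet A)

/-- The minimum nonzero eigenvalue. -/
def minNonzeroEig {ι : Type} [Fintype ι] [DecidableEq ι] (A : Matrix ι ι ℝ) : ℝ :=
  sInf {x | x ∈ eigenvalueSet A ∧ x ≠ 0}

/-- `m_n(ν) = p ∧ n / ((2 + ν) log p)`. -/
def sizeBound (n p : ℕ) (ν : ℝ) : ℝ :=
  min (p : ℝ) ((n : ℝ) / ((2 + ν) * Real.log p))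

/-- `λ_M`, the largest eigenvalue of the Gram matrix `X'X / n`. -/
def lambdaMax {n p : ℕ} (X : Matrix (Fin n) (Fin p) ℝ) : ℝ :=
  maxEig ((n : ℝ)⁻¹ • (Xᵀ * X))

/-- `λ_m(ν)`, the infimum over the (nonempty) models `k` of size at most `m_n(ν)` of the
minimum nonzero eigenvalue of `X_k' X_k / n`. -/
def lambdaMin {n p : ℕ} (X : Matrix (Fin n) (Fin p) ℝ) (ν : ℝ) : ℝ :=
  sInf {x | ∃ k : Finset (Fin p), k.Nonempty ∧ (k.card : ℝ) ≤ sizeBound n p ν ∧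
    x = minNonzeroEig (gram X k)}

/-- The vector `X_k β_k`. -/
def partialMean {n p : ℕ} (X : Matrix (Fin n) (Fin p) ℝ) (β : Fin p → ℝ)
    (k : Finset (Fin p)) : EuclideanSpace ℝ (Fin n) :=
  WithLp.toLp 2 (X *ᵥ (fun j => if j ∈ k then β j else 0))

/-- The column space of `X_k`. -/
def colSpace {n p : ℕ} (X : Matrix (Fin n) (Fin p) ℝ) (k : Finset (Fin p)) :
    Submodule ℝ (EuclideanSpace ℝ (Fin n)) :=
  Submodule.span ℝ ((fun j => WithLp.toLp 2 (fun i => X i j)) '' (k : Set (Fin p)))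

/-- `Δ(K)`: the infimum of `‖(I - P_k) X_t β_t‖²` over the models `k` of size at most `K |t|`
which do not contain `t`, where `P_k` is the orthogonal projection onto the column space of
`X_k`. The infimum is `∞` if there is no such model (this happens only if `t` is empty). -/
def separation {n p : ℕ} (X : Matrix (Fin n) (Fin p) ℝ) (β : Fin p → ℝ)
    (t : Finset (Fin p)) (K : ℝ) : ℝ≥0∞ :=
  ⨅ (k : Finset (Fin p)) (_ : (k.card : ℝ) ≤ K * t.card ∧ ¬ t ⊆ k),
    ENNReal.ofReal
      (‖partialMean X β t - (colSpace X k).starProjection (partialMean X β t)‖ ^ 2)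

/-- `γ = 5 σ² |t| (1 + δ) log (√n ∨ p)`. -/
def gammaBound (n p T : ℕ) (σ δ : ℝ) : ℝ :=
  5 * σ ^ 2 * T * (1 + δ) * Real.log (max (Real.sqrt n) p)

/-! The Bayesian model, with known error variance `σ²`. -/

/-- The density of `y` under `N(X b, σ² I)`. -/
def likelihood {n p : ℕ} (X : Matrix (Fin n) (Fin p) ℝ) (σ : ℝ) (b : Fin p → ℝ)
    (y : Fin n → ℝ) : ℝ :=
  ∏ i, gaussianPDFReal ((X *ᵥ b) i) (σ ^ 2).toNNReal (y i)

/-- The prior of the coefficient vector given `Z = k`: independent coordinates,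
`N(0, σ² τ₁²)` for the covariates in `k` and `N(0, σ² τ₀²)` for the others. -/
def coefPrior {p : ℕ} (σ τ₀ τ₁ : ℝ) (k : Finset (Fin p)) : Measure (Fin p → ℝ) :=
  Measure.pi fun j => gaussianReal 0 (σ ^ 2 * (if j ∈ k then τ₁ else τ₀) ^ 2).toNNReal

/-- The prior probability of `Z = k`: independent Bernoulli(`q`) coordinates. -/
def modelPrior {p : ℕ} (q : ℝ) (k : Finset (Fin p)) : ℝ :=
  ∏ j : Fin p, if j ∈ k then q else 1 - q

/-- The marginal density of `y` given `Z = k`. -/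
def marginal {n p : ℕ} (X : Matrix (Fin n) (Fin p) ℝ) (σ τ₀ τ₁ : ℝ) (k : Finset (Fin p))
    (y : Fin n → ℝ) : ℝ :=
  ∫ b, likelihood X σ b y ∂(coefPrior σ τ₀ τ₁ k)

/-- The posterior probability `P(Z = k | Y = y, σ²)`, by Bayes' rule. -/
def posterior {n p : ℕ} (X : Matrix (Fin n) (Fin p) ℝ) (σ τ₀ τ₁ q : ℝ)
    (k : Finset (Fin p)) (y : Fin n → ℝ) : ℝ :=
  modelPrior q k * marginal X σ τ₀ τ₁ k y /
    ∑ l : Finset (Fin p), modelPrior q l * marginal X σ τ₀ τ₁ l y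

/-- The posterior ratio `PR(k, t)`. -/
def posteriorRatio {n p : ℕ} (X : Matrix (Fin n) (Fin p) ℝ) (σ τ₀ τ₁ q : ℝ)
    (k t : Finset (Fin p)) (y : Fin n → ℝ) : ℝ :=
  posterior X σ τ₀ τ₁ q k y / posterior X σ τ₀ τ₁ q t y

/-- The true law `N(X β, σ² I)` of the response `Y`. -/
def trueLaw {n p : ℕ} (X : Matrix (Fin n) (Fin p) ℝ) (β : Fin p → ℝ) (σ : ℝ) :
    Measure (Fin n → ℝ) :=
  Measure.pi fun i => gaussianReal ((X *ᵥ β) i) (σ ^ 2).toNNReal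

/-! The four classes of models other than `t`. -/

/-- Unrealistically large models. -/
def class1 {n p : ℕ} (X : Matrix (Fin n) (Fin p) ℝ) (t : Finset (Fin p)) (ν : ℝ) :
    Finset (Finset (Fin p)) :=
  {k | k ≠ t ∧ sizeBound n p ν < modelRank X k}

/-- Over-fitted models. -/
def class2 {n p : ℕ} (X : Matrix (Fin n) (Fin p) ℝ) (t : Finset (Fin p)) (ν : ℝ) :
    Finset (Finset (Fin p)) :=
  {k | k ≠ t ∧ t ⊆ k ∧ (modelRank X k : ℝ) ≤ sizeBound n p ν}

/-- Large models that miss an active covariate. -/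
def class3 {n p : ℕ} (X : Matrix (Fin n) (Fin p) ℝ) (t : Finset (Fin p)) (ν K : ℝ) :
    Finset (Finset (Fin p)) :=
  {k | ¬ t ⊆ k ∧ K * t.card < modelRank X k ∧ (modelRank X k : ℝ) ≤ sizeBound n p ν}

/-- Models of moderate dimension that miss an active covariate. -/
def class4 {n p : ℕ} (X : Matrix (Fin n) (Fin p) ℝ) (t : Finset (Fin p)) (K : ℝ) :
    Finset (Finset (Fin p)) :=
  {k | ¬ t ⊆ k ∧ (modelRank X k : ℝ) ≤ K * t.card}

/-! Sequences of regression problems. -/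

/-- A sequence of regression problems, with `n` observations and `p n` covariates at stage `n`,
together with the prior parameters. -/
structure RegressionSeq where
  /-- number of covariates -/
  p : ℕ → ℕ
  /-- design matrix -/
  X : ∀ n, Matrix (Fin n) (Fin (p n)) ℝ
  /-- true coefficients -/
  β : ∀ n, Fin (p n) → ℝ
  /-- true model -/
  t : ∀ n, Finset (Fin (p n))
  /-- spike scale -/
  τ₀ : ℕ → ℝ
  /-- slab scale -/
  τ₁ : ℕ → ℝ
  /-- prior inclusion probability -/
  q : ℕ → ℝ
  τ₀_pos : ∀ n, 0 < τ₀ n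
  τ₁_pos : ∀ n, 0 < τ₁ n
  q_pos : ∀ n, 0 < q n
  q_lt_one : ∀ n, q n < 1

/-- `a ∼ b`: the ratio converges to a positive constant. -/
def SameRate (a b : ℕ → ℝ) : Prop :=
  ∃ c : ℝ, 0 < c ∧ Tendsto (fun n => a n / b n) atTop (𝓝 c)

/-- The conditions on the sequence of regression problems. -/
structure Conditions (D : RegressionSeq) (δ ν κ K σ : ℝ) (T : ℕ) : Prop where
  /-- `p_n → ∞` -/
  dim_tendsto : Tendsto D.p atTop atTop
  /-- `log p_n = o(n)` -/
  dim_log : (fun n => Real.log (D.p n)) =o[atTop] (fun n : ℕ => (n : ℝ))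
  /-- `n τ₀² = o(1)` -/
  prior_spike : (fun n : ℕ => (n : ℝ) * D.τ₀ n ^ 2) =o[atTop] (fun _ => (1 : ℝ))
  /-- `n τ₁² ∼ n ∨ p_n^(2 + 3 δ)` -/
  prior_slab : SameRate (fun n : ℕ => (n : ℝ) * D.τ₁ n ^ 2)
    (fun n : ℕ => max (n : ℝ) ((D.p n : ℝ) ^ (2 + 3 * δ)))
  /-- `q_n ∼ 1 / p_n` -/
  prior_incl : SameRate D.q (fun n => (D.p n : ℝ)⁻¹)
  /-- the size of the true model is fixed -/
  true_card : ∀ᶠ n in atTop, (D.t n).card = T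
  /-- `‖X_{t^c} β_{t^c}‖ = O(1)` -/
  true_inactive : (fun n => ‖partialMean (D.X n) (D.β n) (D.t n)ᶜ‖) =O[atTop]
    (fun _ => (1 : ℝ))
  /-- `Δ_n(K) > γ_n` -/
  identifiable : ∀ᶠ n in atTop,
    ENNReal.ofReal (gammaBound n (D.p n) T σ δ) <
      separation (D.X n) (D.β n) (D.t n) K
  /-- `λ_M ≺ (n τ₀²)⁻¹ ∧ n τ₁²` -/
  eigen_max : (fun n => lambdaMax (D.X n)) =o[atTop]
    (fun n : ℕ => min ((n : ℝ) * D.τ₀ n ^ 2)⁻¹ ((n : ℝ) * D.τ₁ n ^ 2))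
  /-- `λ_m(ν) ⪰ (n ∨ p_n^(2 + 2 δ)) / (n τ₁²) ∨ p_n^(-κ)` -/
  eigen_min :
    (fun n : ℕ => max
      (max (n : ℝ) ((D.p n : ℝ) ^ (2 + 2 * δ)) / ((n : ℝ) * D.τ₁ n ^ 2))
      ((D.p n : ℝ) ^ (-κ))) =O[atTop] (fun n => lambdaMin (D.X n) ν)
  /-- no covariate is identically zero, so that every nonempty model has a minimum nonzero
  eigenvalue -/
  col_ne_zero : ∀ᶠ n in atTop, ∀ j, ∃ i, D.X n i j ≠ 0
  /-- the active covariates are scaled: the eigenvalues of `X_t' X_t / n` are bounded -/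
  active_gram : (fun n => maxEig (gram (D.X n) (D.t n))) =O[atTop] (fun _ => (1 : ℝ))
  /-- the slab is at least as diffuse as the active coefficients: `‖β_t‖² = O(τ₁²)` -/
  active_coef : (fun n => ∑ j ∈ D.t n, D.β n j ^ 2) =O[atTop] (fun n => D.τ₁ n ^ 2)

/-- `∑_{k ∈ M} PR(k, t)` at stage `n`, as a function of the response. -/
def ratioSum (D : RegressionSeq) (σ : ℝ) (n : ℕ) (M : Finset (Finset (Fin (D.p n))))
    (y : Fin n → ℝ) : ℝ :=
  ∑ k ∈ M, posteriorRatio (D.X n) σ (D.τ₀ n) (D.τ₁ n) (D.q n) k (D.t n) y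

/-- The probability, under the true law of the response at stage `n`, that
`∑_{k ∈ M} PR(k, t) ≤ B`. -/
def probRatioSumLE (D : RegressionSeq) (σ : ℝ) (n : ℕ)
    (M : Finset (Finset (Fin (D.p n)))) (B : ℝ) : ℝ :=
  (trueLaw (D.X n) (D.β n) σ).real {y | ratioSum D σ n M y ≤ B}

/-- `v_n = p_n^(-δ/2) ∧ p_n^(1 + δ/2) / √n`. -/
def vRate (n p : ℕ) (δ : ℝ) : ℝ :=
  min ((p : ℝ) ^ (-δ / 2)) ((p : ℝ) ^ (1 + δ / 2) / Real.sqrt n)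

end

end SpikeSlab

/-!
The posterior ratios are bounded deterministically, and the bounds are summed over the models of a
class by Markov's inequality for moments of order at most one.

*Deterministic part.* Integrating the likelihood over the spike amounts to replacing the response `y`
by its residual `shrink X τ₀ y` in a ridge regression on all the covariates. This is a contraction, and
since `n τ₀² λ_M` is small it almost preserves norms. What remains is a Gaussian integral over the
slab coefficients of the model `k`. If `b` is a basis of the column space of `k` which contains
`k ∩ t`, this integral is at most a constant times a determinant factor times
`exp (-RSS_b / (2 σ²))`, while the integral for `t` is bounded below by centring at the true
coefficients. The determinants of `b` and `t` are compared through that of `b ∩ t`: a superfluous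
covariate costs a factor `l ≲ 1 / (√n ∨ p ^ (1 + δ))`, and a missed active covariate gains at most a
factor `g` (`posteriorRatio_le`, `StageBound.sum_ratio_le`, `regular_of_bounds`). Identifiability of
`t` makes the active covariates, together with any further one, linearly independent
(`indep_of_separation_pos`), so that every proper superset of `t` has a larger rank.

*Probabilistic part.* The exponent is an `excess`: the squared norm of a projection of the noise plus a
linear functional of the noise minus the squared norm of the unexplained mean. Its exponential moments
follow from linearizing the square by an auxiliary Gaussian vector, which lets contractions through
(`lintegral_exp_proj_le`).

* If the rank of the models exceeds `n / ((2 + ν) log p)`, residual sums of squares are bounded below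
  by zero only. The squared norm of the noise is about `n σ²`, and the penalty
  `exp (-(1 + δ) n / (2 + ν))` beats `exp (n / 2)` because `ν < δ` (`StageBound.sum_ratio_large_le`).
* Over-fitted models and large models which miss an active covariate have more superfluous than missed
  covariates. Moments of order one half suffice, uniformly in the unexplained mean
  (`StageBound.prob_lt_sum_ratio_le`).
* Models of moderate dimension which miss an active covariate are grouped by their part inside `t` and
  the number `d` of superfluous covariates (`prob_lt_sum_fiber_le`). If `δ ≥ 2` or `d ≥ 2 |t| / δ`, a
  moment of order `1 / 4` or `1 / 2` suffices, because the separation exceeds `γ`. For `δ < 2` and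
  smaller `d` a union bound over the linear functionals is too expensive when the unexplained means
  are short. But then they have a long common part, namely the point of least norm of their convex
  hull: as `K > 1 + 8 / δ`, the union of four models of the group still has size at most `K |t|`, so
  averages of four unexplained means are long (`le_norm_sq_of_four_sums`). The linear functional given
  by the common part is the same for the whole group and is controlled once
  (`prob_lt_sum_exp_excess_le_of_center`).
-/

namespace SpikeSlab

/-! ### Gaussian product measures -/

/-- The exponential with values in `ℝ≥0∞`. -/
noncomputable def eexp (x : ℝ) : ℝ≥0∞ := ENNReal.ofReal (Real.exp x)

lemma eexp_add (x y : ℝ) : eexp (x + y) = eexp x * eexp y := by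
  rw [eexp, Real.exp_add, ENNReal.ofReal_mul (Real.exp_pos x).le]; rfl

lemma eexp_zero : eexp 0 = 1 := by simp [eexp]

lemma eexp_mono {x y : ℝ} (h : x ≤ y) : eexp x ≤ eexp y :=
  ENNReal.ofReal_le_ofReal (Real.exp_le_exp.2 h)

lemma eexp_ne_zero (x : ℝ) : eexp x ≠ 0 := by
  simp [eexp, Real.exp_pos]

lemma eexp_sum {ι : Type*} (s : Finset ι) (f : ι → ℝ) :
    eexp (∑ i ∈ s, f i) = ∏ i ∈ s, eexp (f i) := by
  rw [eexp, Real.exp_sum, ENNReal.ofReal_prod_of_nonneg fun i _ => (Real.exp_pos _).le]; rfl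

lemma measurable_eexp : Measurable eexp := by
  unfold eexp; fun_prop

lemma measurable_eexp_comp {α : Type*} [MeasurableSpace α] {f : α → ℝ} (hf : Measurable f) :
    Measurable fun x => eexp (f x) := measurable_eexp.comp hf

lemma lintegral_pi_prod {ι : Type*} [Fintype ι] {E : ι → Type*} [∀ i, MeasurableSpace (E i)]
    (μ : ∀ i, Measure (E i)) [∀ i, SigmaFinite (μ i)] (f : ∀ i, E i → ℝ≥0∞)
    (hf : ∀ i, Measurable (f i)) :
    ∫⁻ x, ∏ i, f i (x i) ∂Measure.pi μ = ∏ i, ∫⁻ x, f i x ∂μ i := by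
  classical
  have hm : Measurable fun x : ∀ i, E i => ∏ i, f i (x i) :=
    Finset.measurable_fun_prod _ fun i _ => (hf i).comp (measurable_pi_apply i)
  have key : ∀ s : Finset ι, ∀ x : ∀ i, E i,
      (∫⋯∫⁻_s, (fun x => ∏ i, f i (x i)) ∂μ) x
        = (∏ i ∈ s, ∫⁻ y, f i y ∂μ i) * ∏ i ∈ sᶜ, f i (x i) := by
    intro s
    induction s using Finset.induction with
    | empty => intro x; simp
    | insert j s hj ih =>
      intro x
      rw [lmarginal_insert _ hm hj]
      have h1 : sᶜ = insert j (insert j s)ᶜ := by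
        ext i; by_cases h : i = j <;> simp [h, hj]
      have h2 : ∀ y : E j, (∫⋯∫⁻_s, (fun x => ∏ i, f i (x i)) ∂μ) (Function.update x j y)
          = ((∏ i ∈ s, ∫⁻ y, f i y ∂μ i) * ∏ i ∈ (insert j s)ᶜ, f i (x i)) * f j y := by
        intro y
        rw [ih, h1, Finset.prod_insert (by simp)]
        have : ∏ i ∈ (insert j s)ᶜ, f i (Function.update x j y i)
            = ∏ i ∈ (insert j s)ᶜ, f i (x i) := by
          refine Finset.prod_congr rfl fun i hi => ?_
          have : i ≠ j := by rintro rfl; simp at hi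
          rw [Function.update_of_ne this]
        rw [this, Function.update_self]; ring
      simp_rw [h2]
      rw [lintegral_const_mul _ (hf j), Finset.prod_insert hj]; ring
  rcases isEmpty_or_nonempty (∀ i, E i) with he | ⟨⟨x0⟩⟩
  · obtain ⟨i, hi⟩ : ∃ i, IsEmpty (E i) := by
      by_contra! h
      exact he.false fun i => (h i).some
    rw [Finset.prod_eq_zero (Finset.mem_univ i) (by simp), lintegral_of_isEmpty]
  · rw [lintegral_eq_lmarginal_univ x0, key]; simp

lemma pi_withDensity {ι : Type*} [Fintype ι] {E : ι → Type*} [∀ i, MeasurableSpace (E i)]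
    (μ : ∀ i, Measure (E i)) [∀ i, SigmaFinite (μ i)] (f : ∀ i, E i → ℝ≥0∞)
    (hf : ∀ i, Measurable (f i)) [∀ i, SigmaFinite ((μ i).withDensity (f i))] :
    Measure.pi (fun i => (μ i).withDensity (f i))
      = (Measure.pi μ).withDensity fun x => ∏ i, f i (x i) := by
  refine (Measure.pi_eq fun s hs => ?_)
  rw [withDensity_apply _ (MeasurableSet.univ_pi hs), ← lintegral_indicator (MeasurableSet.univ_pi hs)]
  have : ((Set.univ.pi s).indicator fun x : ∀ i, E i => ∏ i, f i (x i))
      = fun x => ∏ i, (s i).indicator (f i) (x i) := by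
    funext x
    by_cases hx : x ∈ Set.univ.pi s
    · rw [Set.indicator_of_mem hx]
      exact Finset.prod_congr rfl fun i _ => (Set.indicator_of_mem (hx i trivial) _).symm
    · rw [Set.indicator_of_notMem hx]
      simp only [Set.mem_pi, Set.mem_univ, true_imp_iff, not_forall] at hx
      obtain ⟨i, hi⟩ := hx
      exact (Finset.prod_eq_zero (Finset.mem_univ i) (Set.indicator_of_notMem hi _)).symm
  rw [this, lintegral_pi_prod μ _ fun i => (hf i).indicator (hs i)]
  refine Finset.prod_congr rfl fun i _ => ?_
  rw [lintegral_indicator (hs i), withDensity_apply _ (hs i)]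

lemma gaussianPDF_eq_eexp (m : ℝ) {v : ℝ} (hv : 0 < v) (x : ℝ) :
    gaussianPDF m v.toNNReal x
      = ENNReal.ofReal (Real.sqrt (2 * Real.pi * v))⁻¹ * eexp (-(x - m) ^ 2 / (2 * v)) := by
  rw [gaussianPDF, gaussianPDFReal, ENNReal.ofReal_mul (by positivity), Real.coe_toNNReal _ hv.le]
  rfl

lemma lintegral_pi_gaussianReal {ι : Type*} [Fintype ι] {v : ℝ} (hv : 0 < v)
    {f : (ι → ℝ) → ℝ≥0∞} (hf : Measurable f) :
    ∫⁻ x, f x ∂Measure.pi (fun _ : ι => gaussianReal 0 v.toNNReal)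
      = ENNReal.ofReal (Real.sqrt (2 * Real.pi * v))⁻¹ ^ Fintype.card ι
        * ∫⁻ x, eexp (-(∑ i, x i ^ 2) / (2 * v)) * f x := by
  have hv' : v.toNNReal ≠ 0 := by simpa using hv
  have h0 : (Measure.pi fun _ : ι => gaussianReal 0 v.toNNReal)
      = (volume : Measure (ι → ℝ)).withDensity fun x => ∏ i, gaussianPDF 0 v.toNNReal (x i) := by
    simp_rw [gaussianReal_of_var_ne_zero 0 hv']
    have : SigmaFinite ((volume : Measure ℝ).withDensity (gaussianPDF 0 v.toNNReal)) := by
      rw [← gaussianReal_of_var_ne_zero 0 hv']; infer_instance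
    exact pi_withDensity (fun _ => volume) _ fun _ => measurable_gaussianPDF _ _
  have h1 : ∀ x : ι → ℝ, ∏ i, gaussianPDF 0 v.toNNReal (x i)
      = ENNReal.ofReal (Real.sqrt (2 * Real.pi * v))⁻¹ ^ Fintype.card ι
        * eexp (-(∑ i, x i ^ 2) / (2 * v)) := by
    intro x
    simp_rw [gaussianPDF_eq_eexp 0 hv]
    rw [Finset.prod_mul_distrib, Finset.prod_const, Finset.card_univ, ← eexp_sum]
    congr 2
    rw [neg_div, Finset.sum_div, ← Finset.sum_neg_distrib]
    exact Finset.sum_congr rfl fun i _ => by rw [sub_zero]; ring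
  have hm : Measurable fun x : ι → ℝ => eexp (-(∑ i, x i ^ 2) / (2 * v)) :=
    measurable_eexp_comp (by fun_prop)
  rw [h0, lintegral_withDensity_eq_lintegral_mul _ _ hf]
  · simp only [Pi.mul_apply, h1, mul_assoc]
    rw [lintegral_const_mul _ (hm.fun_mul hf)]
  · exact Finset.measurable_fun_prod _ fun i _ =>
      (measurable_gaussianPDF _ _).comp (measurable_pi_apply i)

lemma lintegral_exp_quadratic_gaussianReal (m : ℝ) {v θ : ℝ} (hv : 0 < v) (hθ : θ < 1) (k : ℝ) :
    ∫⁻ x, eexp (θ * (x - m) ^ 2 / (2 * v) + k * (x - m)) ∂gaussianReal m v.toNNReal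
      = ENNReal.ofReal (Real.sqrt (1 - θ))⁻¹ * eexp (v * k ^ 2 / (2 * (1 - θ))) := by
  have hv' : v.toNNReal ≠ 0 := by simpa using hv
  have h1 : 0 < 1 - θ := by linarith
  have hw : 0 < v / (1 - θ) := by positivity
  have hg : Measurable fun x : ℝ => eexp (θ * (x - m) ^ 2 / (2 * v) + k * (x - m)) :=
    measurable_eexp_comp (by fun_prop)
  rw [gaussianReal_of_var_ne_zero m hv',
    lintegral_withDensity_eq_lintegral_mul _ (measurable_gaussianPDF _ _) hg]
  have h2 : ∀ x, (gaussianPDF m v.toNNReal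
        * fun x => eexp (θ * (x - m) ^ 2 / (2 * v) + k * (x - m))) x
      = ENNReal.ofReal (Real.sqrt (1 - θ))⁻¹ * eexp (v * k ^ 2 / (2 * (1 - θ)))
        * gaussianPDF (m + k * v / (1 - θ)) (v / (1 - θ)).toNNReal x := by
    intro x
    rw [Pi.mul_apply, gaussianPDF_eq_eexp _ hv, gaussianPDF_eq_eexp _ hw]
    have e1 : (Real.sqrt (2 * Real.pi * v))⁻¹
        = (Real.sqrt (1 - θ))⁻¹ * (Real.sqrt (2 * Real.pi * (v / (1 - θ))))⁻¹ := by
      rw [← mul_inv, ← Real.sqrt_mul h1.le]; congr 2; field_simp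
    rw [e1, ENNReal.ofReal_mul (by positivity)]
    have e2 : eexp (-(x - m) ^ 2 / (2 * v)) * eexp (θ * (x - m) ^ 2 / (2 * v) + k * (x - m))
        = eexp (v * k ^ 2 / (2 * (1 - θ)))
          * eexp (-(x - (m + k * v / (1 - θ))) ^ 2 / (2 * (v / (1 - θ)))) := by
      rw [← eexp_add, ← eexp_add]; congr 1; field_simp; ring
    rw [mul_assoc, e2]; ring
  simp_rw [h2]
  rw [lintegral_const_mul _ (measurable_gaussianPDF _ _),
    lintegral_gaussianPDF_eq_one _ (by simpa using hw), mul_one]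

lemma lintegral_exp_quadratic_pi {ι : Type*} [Fintype ι] (m : ι → ℝ) {v θ : ℝ} (hv : 0 < v)
    (hθ : θ < 1) (k : ι → ℝ) :
    ∫⁻ x, eexp (∑ i, (θ * (x i - m i) ^ 2 / (2 * v) + k i * (x i - m i)))
        ∂Measure.pi (fun i => gaussianReal (m i) v.toNNReal)
      = ENNReal.ofReal (Real.sqrt (1 - θ))⁻¹ ^ Fintype.card ι
        * eexp (v * (∑ i, k i ^ 2) / (2 * (1 - θ))) := by
  simp_rw [eexp_sum]
  rw [lintegral_pi_prod (fun i => gaussianReal (m i) v.toNNReal)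
    (fun i x => eexp (θ * (x - m i) ^ 2 / (2 * v) + k i * (x - m i)))
    fun i => measurable_eexp_comp (by fun_prop)]
  simp_rw [lintegral_exp_quadratic_gaussianReal _ hv hθ]
  rw [Finset.prod_mul_distrib, Finset.prod_const, Finset.card_univ, ← eexp_sum, Finset.mul_sum,
    Finset.sum_div]

/-! ### Gaussian integrals over coordinate subspaces -/

/-- The inclusion of the coordinate subspace `ℝ^s` into `ℝ^ι`, by zero outside `s`. -/
def zeroExtend {ι : Type*} [DecidableEq ι] (s : Finset ι) : (s → ℝ) →ₗ[ℝ] (ι → ℝ) where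
  toFun z i := if h : i ∈ s then z ⟨i, h⟩ else 0
  map_add' x y := by ext i; by_cases h : i ∈ s <;> simp [h]
  map_smul' c x := by ext i; by_cases h : i ∈ s <;> simp [h]

lemma measurable_normSq {ι κ E : Type*} [NormedAddCommGroup E] [InnerProductSpace ℝ E]
    [Fintype κ] (A : (ι → ℝ) →ₗ[ℝ] E) (L : (κ → ℝ) →ₗ[ℝ] (ι → ℝ)) :
    Measurable fun z => ‖A (L z)‖ ^ 2 := by
  have : Continuous (A ∘ₗ L) := LinearMap.continuous_of_finiteDimensional _
  have h2 : Continuous fun z => ‖(A ∘ₗ L) z‖ ^ 2 := by fun_prop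
  exact h2.measurable

section

variable {ι : Type*} [DecidableEq ι]

lemma zeroExtend_apply_notMem (s : Finset ι) (z : s → ℝ) {i : ι} (hi : i ∉ s) :
    zeroExtend s z i = 0 := by simp [zeroExtend, hi]

lemma zeroExtend_apply_mem (s : Finset ι) (z : s → ℝ) {i : ι} (hi : i ∈ s) :
    zeroExtend s z i = z ⟨i, hi⟩ := by simp [zeroExtend, hi]

lemma zeroExtend_restrict (s : Finset ι) {c : ι → ℝ} (hc : ∀ i ∉ s, c i = 0) :
    zeroExtend s (fun i => c i) = c := by
  ext i
  by_cases h : i ∈ s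
  · rw [zeroExtend_apply_mem s _ h]
  · rw [zeroExtend_apply_notMem s _ h, hc i h]

lemma sum_zeroExtend_sq [Fintype ι] (s : Finset ι) (z : s → ℝ) :
    ∑ i, zeroExtend s z i ^ 2 = ∑ i, z i ^ 2 := by
  have h1 : ∑ i ∈ s, zeroExtend s z i ^ 2 = ∑ i, zeroExtend s z i ^ 2 :=
    Finset.sum_subset (Finset.subset_univ s) fun i _ hi => by
      rw [zeroExtend_apply_notMem s z hi]; simp
  rw [← h1, ← Finset.sum_coe_sort]
  exact Finset.sum_congr rfl fun i _ => by rw [zeroExtend_apply_mem s z i.2]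

variable {E : Type*} [NormedAddCommGroup E] [InnerProductSpace ℝ E]

/-- The image under `A` of the coordinate subspace `ℝ^s`. -/
def imageOn (A : (ι → ℝ) →ₗ[ℝ] E) (s : Finset ι) : Submodule ℝ E :=
  LinearMap.range (A ∘ₗ zeroExtend s)

instance (A : (ι → ℝ) →ₗ[ℝ] E) (s : Finset ι) : FiniteDimensional ℝ (imageOn A s) := by
  unfold imageOn; infer_instance

lemma apply_mem_imageOn (A : (ι → ℝ) →ₗ[ℝ] E) {s : Finset ι} {c : ι → ℝ}
    (hc : ∀ i ∉ s, c i = 0) : A c ∈ imageOn A s :=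
  ⟨fun i => c i, by rw [LinearMap.comp_apply, zeroExtend_restrict s hc]⟩

lemma exists_of_mem_imageOn {A : (ι → ℝ) →ₗ[ℝ] E} {s : Finset ι} {v : E} (hv : v ∈ imageOn A s) :
    ∃ c : ι → ℝ, (∀ i ∉ s, c i = 0) ∧ A c = v := by
  obtain ⟨z, hz⟩ := hv
  exact ⟨zeroExtend s z, fun i hi => zeroExtend_apply_notMem s z hi, hz⟩

lemma finrank_imageOn_le (A : (ι → ℝ) →ₗ[ℝ] E) (s : Finset ι) :
    Module.finrank ℝ (imageOn A s) ≤ s.card := by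
  unfold imageOn
  refine (LinearMap.finrank_range_le _).trans ?_
  simp

lemma norm_sub_sq_of_mem (K : Submodule ℝ E) [K.HasOrthogonalProjection] (v u : E) (hu : u ∈ K) :
    ‖v - u‖ ^ 2 = ‖v - K.starProjection v‖ ^ 2 + ‖K.starProjection v - u‖ ^ 2 := by
  have h1 : v - u = (v - K.starProjection v) + (K.starProjection v - u) := by abel
  have h2 : inner ℝ (v - K.starProjection v) (K.starProjection v - u) = 0 :=
    Submodule.starProjection_inner_eq_zero v _
      (K.sub_mem (K.starProjection_apply_mem v) hu)
  rw [h1, norm_add_sq_real, h2]; ring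

lemma norm_sub_starProjection_le (K : Submodule ℝ E) [K.HasOrthogonalProjection] (v u : E)
    (hu : u ∈ K) : ‖v - K.starProjection v‖ ^ 2 ≤ ‖v - u‖ ^ 2 := by
  rw [norm_sub_sq_of_mem K v u hu]
  nlinarith [sq_nonneg ‖K.starProjection v - u‖]

/-- The Gaussian integral `∫ exp (-‖A z‖²) dz` over the coordinate subspace `ℝ^s`, a multiple of
`det (A_s' A_s) ^ (-1/2)`. -/
noncomputable def gaussVol (A : (ι → ℝ) →ₗ[ℝ] E) (s : Finset ι) : ℝ≥0∞ :=
  ∫⁻ z : s → ℝ, eexp (-‖A (zeroExtend s z)‖ ^ 2)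

/-- Integrating a Gaussian over a subspace leaves the squared distance to that subspace. -/
lemma lintegral_exp_neg_normSq_sub (A : (ι → ℝ) →ₗ[ℝ] E) (s : Finset ι) (v : E) :
    ∫⁻ z : s → ℝ, eexp (-‖v - A (zeroExtend s z)‖ ^ 2)
      = gaussVol A s * eexp (-‖v - (imageOn A s).starProjection v‖ ^ 2) := by
  obtain ⟨z₀, hz₀⟩ := (imageOn A s).starProjection_apply_mem v
  have h1 : ∀ z : s → ℝ, eexp (-‖v - A (zeroExtend s z)‖ ^ 2)
      = eexp (-‖v - (imageOn A s).starProjection v‖ ^ 2)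
        * eexp (-‖A (zeroExtend s (z₀ - z))‖ ^ 2) := by
    intro z
    rw [← eexp_add, norm_sub_sq_of_mem (imageOn A s) v (A (zeroExtend s z)) ⟨z, rfl⟩, map_sub,
      map_sub, show (imageOn A s).starProjection v = A (zeroExtend s z₀) from hz₀.symm]
    congr 1; ring
  simp_rw [h1]
  have hm : Measurable fun z : s → ℝ => eexp (-‖A (zeroExtend s z)‖ ^ 2) :=
    measurable_eexp_comp (measurable_normSq A (zeroExtend s)).neg
  have hm' : Measurable fun z : s → ℝ => eexp (-‖A (zeroExtend s (z₀ - z))‖ ^ 2) :=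
    hm.comp (measurable_const.sub measurable_id)
  rw [lintegral_const_mul _ hm',
    lintegral_sub_left_eq_self (fun z : s → ℝ => eexp (-‖A (zeroExtend s z)‖ ^ 2)) z₀, gaussVol,
    mul_comm]

lemma lintegral_exp_neg_sq {D : ℝ} (hD : 0 < D) :
    ∫⁻ x : ℝ, eexp (-(x ^ 2 * D)) = ENNReal.ofReal (Real.sqrt (Real.pi / D)) := by
  have hv : 0 < 1 / (2 * D) := by positivity
  have h := lintegral_gaussianPDF_eq_one 0 (v := (1 / (2 * D)).toNNReal) (by simpa using hD)
  simp_rw [gaussianPDF_eq_eexp 0 hv] at h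
  rw [lintegral_const_mul _ (measurable_eexp_comp (by fun_prop))] at h
  have h2 : ∀ x : ℝ, -(x - 0) ^ 2 / (2 * (1 / (2 * D))) = -(x ^ 2 * D) := by
    intro x; field_simp; ring
  simp_rw [h2] at h
  have h3 : Real.sqrt (2 * Real.pi * (1 / (2 * D))) = Real.sqrt (Real.pi / D) := by
    congr 1; field_simp
  rw [h3] at h
  have hs : 0 < Real.sqrt (Real.pi / D) := Real.sqrt_pos.2 (by positivity)
  calc ∫⁻ x : ℝ, eexp (-(x ^ 2 * D))
      = ENNReal.ofReal (Real.sqrt (Real.pi / D)) * (ENNReal.ofReal (Real.sqrt (Real.pi / D))⁻¹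
          * ∫⁻ x : ℝ, eexp (-(x ^ 2 * D))) := by
        rw [← mul_assoc, ← ENNReal.ofReal_mul hs.le, mul_inv_cancel₀ hs.ne']; simp
    _ = _ := by rw [h, mul_one]

variable [Fintype ι]

/-- Gram–Schmidt recursion for Gaussian integrals. -/
lemma gaussVol_insert (A : (ι → ℝ) →ₗ[ℝ] E) {s : Finset ι} {j : ι} (hj : j ∉ s) :
    gaussVol A (insert j s) = gaussVol A s * ∫⁻ x : ℝ, eexp (-(x ^ 2 *
      ‖A (Pi.single j 1) - (imageOn A s).starProjection (A (Pi.single j 1))‖ ^ 2)) := by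
  have hupd : ∀ (s : Finset ι) (x : ι → ℝ) (z : s → ℝ), (∀ i ∈ s, x i = 0) →
      Function.updateFinset x s z = x + zeroExtend s z := by
    intro s x z hx
    ext i
    by_cases h : i ∈ s
    · simp [Function.updateFinset, h, zeroExtend_apply_mem, hx i h]
    · simp [Function.updateFinset, h, zeroExtend_apply_notMem]
  have hf : Measurable fun c : ι → ℝ => eexp (-‖A c‖ ^ 2) :=
    measurable_eexp_comp (measurable_normSq A LinearMap.id).neg
  have h0 : ∀ s : Finset ι, gaussVol A s
      = (∫⋯∫⁻_s, (fun c : ι → ℝ => eexp (-‖A c‖ ^ 2)) ∂fun _ => volume) 0 := by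
    intro s
    rw [gaussVol, lmarginal]
    refine lintegral_congr fun z => ?_
    rw [hupd s 0 z fun _ _ => rfl, zero_add]
  have h1 : ∀ x : ℝ, (∫⋯∫⁻_s, (fun c : ι → ℝ => eexp (-‖A c‖ ^ 2)) ∂fun _ => volume)
      (Function.update 0 j x) = gaussVol A s * eexp (-(x ^ 2 *
      ‖A (Pi.single j 1) - (imageOn A s).starProjection (A (Pi.single j 1))‖ ^ 2)) := by
    intro x
    have h2 : Function.update (0 : ι → ℝ) j x = x • Pi.single j (1 : ℝ) := by
      ext i; by_cases h : i = j
      · subst h; simp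
      · simp [h]
    have h3 : x ^ 2 * ‖A (Pi.single j 1) - (imageOn A s).starProjection (A (Pi.single j 1))‖ ^ 2
        = ‖-(x • A (Pi.single j 1)) - (imageOn A s).starProjection (-(x • A (Pi.single j 1)))‖ ^ 2 := by
      rw [map_neg, map_smul, ← sq_abs x, ← Real.norm_eq_abs, ← mul_pow, ← norm_smul, smul_sub,
        ← norm_neg]
      congr 2; abel
    rw [h3, ← lintegral_exp_neg_normSq_sub, lmarginal]
    refine lintegral_congr fun z => ?_
    rw [hupd s _ z, h2, map_add, map_smul, ← norm_neg]
    · congr 3; congr 1; abel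
    · intro i hi
      have : i ≠ j := by rintro rfl; exact hj hi
      simp [this]
  rw [h0 (insert j s), lmarginal_insert _ hf hj]
  simp_rw [h1]
  rw [lintegral_const_mul _ (measurable_eexp_comp (by fun_prop))]

lemma gaussVol_union_le (A : (ι → ℝ) →ₗ[ℝ] E) {a e : Finset ι} (hd : Disjoint a e) {Λ : ℝ}
    (hΛ : 0 < Λ) (h : ∀ c : ι → ℝ, (∀ i ∉ a ∪ e, c i = 0) → Λ * ∑ i, c i ^ 2 ≤ ‖A c‖ ^ 2) :
    gaussVol A (a ∪ e) ≤ gaussVol A a * ENNReal.ofReal (Real.sqrt (Real.pi / Λ)) ^ e.card := by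
  induction e using Finset.induction with
  | empty => simp
  | insert j e hj ih =>
    rw [Finset.disjoint_insert_right] at hd
    have hj' : j ∉ a ∪ e := by simp [hd.1, hj]
    have hsub : a ∪ e ⊆ a ∪ insert j e := Finset.union_subset_union_right (Finset.subset_insert _ _)
    have ih' := ih hd.2 fun c hc => h c fun i hi => hc i fun h' => hi (hsub h')
    rw [Finset.union_insert, gaussVol_insert A hj', Finset.card_insert_of_notMem hj,
      pow_succ (ENNReal.ofReal _), ← mul_assoc]
    refine mul_le_mul' ih' ?_
    rw [← lintegral_exp_neg_sq hΛ]
    refine lintegral_mono fun x => eexp_mono (neg_le_neg ?_)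
    refine mul_le_mul_of_nonneg_left ?_ (sq_nonneg x)
    obtain ⟨c, hc, hc'⟩ :=
      exists_of_mem_imageOn ((imageOn A (a ∪ e)).starProjection_apply_mem (A (Pi.single j 1)))
    rw [← hc', ← map_sub]
    set u : ι → ℝ := Pi.single j 1 - c with hu
    refine le_trans ?_ (h u ?_)
    · have h1 : u j = 1 := by simp [hu, hc j hj']
      have h2 : (1 : ℝ) ≤ ∑ i, u i ^ 2 := by
        calc (1 : ℝ) = u j ^ 2 := by rw [h1]; norm_num
          _ ≤ _ := Finset.single_le_sum (f := fun i => u i ^ 2)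
            (fun i _ => sq_nonneg _) (Finset.mem_univ j)
      nlinarith
    · intro i hi
      have h1 : i ≠ j := by rintro rfl; simp at hi
      have h2 : i ∉ a ∪ e := fun h' => hi (hsub h')
      simp [hu, h1, hc i h2]

lemma le_gaussVol_union (A : (ι → ℝ) →ₗ[ℝ] E) {a e : Finset ι} (hd : Disjoint a e) {M : ℝ}
    (hM : 0 < M) (h : ∀ j ∈ e, ‖A (Pi.single j 1)‖ ^ 2 ≤ M) :
    gaussVol A a * ENNReal.ofReal (Real.sqrt (Real.pi / M)) ^ e.card ≤ gaussVol A (a ∪ e) := by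
  induction e using Finset.induction with
  | empty => simp
  | insert j e hj ih =>
    rw [Finset.disjoint_insert_right] at hd
    have hj' : j ∉ a ∪ e := by simp [hd.1, hj]
    have ih' := ih hd.2 fun i hi => h i (Finset.mem_insert_of_mem hi)
    rw [Finset.union_insert, gaussVol_insert A hj', Finset.card_insert_of_notMem hj,
      pow_succ (ENNReal.ofReal _), ← mul_assoc]
    refine mul_le_mul' ih' ?_
    rw [← lintegral_exp_neg_sq hM]
    refine lintegral_mono fun x => eexp_mono (neg_le_neg ?_)
    refine mul_le_mul_of_nonneg_left ?_ (sq_nonneg x)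
    refine le_trans ?_ (h j (Finset.mem_insert_self j e))
    simpa using norm_sub_starProjection_le (imageOn A (a ∪ e)) (A (Pi.single j 1)) 0
      (Submodule.zero_mem _)

lemma lintegral_comp_smul_pi {κ : Type*} [Fintype κ] (f : (κ → ℝ) → ℝ≥0∞) (hf : Measurable f)
    {r : ℝ} (hr : 0 < r) :
    ∫⁻ z, f (r • z) = ENNReal.ofReal ((r ^ Fintype.card κ)⁻¹) * ∫⁻ z, f z := by
  have h := Measure.map_addHaar_smul (volume : Measure (κ → ℝ)) hr.ne'
  have h2 : ∫⁻ z, f z ∂(Measure.map (r • ·) (volume : Measure (κ → ℝ))) = ∫⁻ z, f (r • z) :=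
    lintegral_map hf (measurable_const_smul r)
  rw [← h2, h, lintegral_smul_measure, Module.finrank_fintype_fun_eq_card, abs_of_pos (by positivity)]
  rfl

end

/-! ### Absorbing the spike -/

section

variable {n p : ℕ}

/-- The linear map `c ↦ X c` into Euclidean space. -/
def designMap (X : Matrix (Fin n) (Fin p) ℝ) : (Fin p → ℝ) →ₗ[ℝ] EuclideanSpace ℝ (Fin n) :=
  (WithLp.linearEquiv 2 ℝ (Fin n → ℝ)).symm.toLinearMap ∘ₗ X.mulVecLin

lemma designMap_apply (X : Matrix (Fin n) (Fin p) ℝ) (c : Fin p → ℝ) :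
    designMap X c = WithLp.toLp 2 (X *ᵥ c) := rfl

/-- The Euclidean space `ℝⁿ × ℝᵖ` of responses augmented by `p` pseudo-observations. -/
abbrev Aug (n p : ℕ) : Type := WithLp 2 (EuclideanSpace ℝ (Fin n) × EuclideanSpace ℝ (Fin p))

/-- The map `b ↦ (X b, b / τ)`: ridge regression with penalty `‖b‖² / τ²` is least squares for
this augmented design. -/
noncomputable def augMap (X : Matrix (Fin n) (Fin p) ℝ) (τ : ℝ) : (Fin p → ℝ) →ₗ[ℝ] Aug n p :=
  (WithLp.linearEquiv 2 ℝ (EuclideanSpace ℝ (Fin n) × EuclideanSpace ℝ (Fin p))).symm.toLinearMap ∘ₗ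
    (designMap X).prod (τ⁻¹ • (WithLp.linearEquiv 2 ℝ (Fin p → ℝ)).symm.toLinearMap)

/-- The inclusion `y ↦ (y, 0)`. -/
def augInl (n p : ℕ) : EuclideanSpace ℝ (Fin n) →ₗ[ℝ] Aug n p :=
  (WithLp.linearEquiv 2 ℝ (EuclideanSpace ℝ (Fin n) × EuclideanSpace ℝ (Fin p))).symm.toLinearMap ∘ₗ
    LinearMap.inl ℝ _ _

/-- The residual of `y` in the ridge regression on all the covariates. The spike turns the
likelihood of `y` into a multiple of `exp (-‖shrink X τ y‖² / (2 σ²))`. -/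
noncomputable def shrink (X : Matrix (Fin n) (Fin p) ℝ) (τ : ℝ) :
    EuclideanSpace ℝ (Fin n) →ₗ[ℝ] Aug n p :=
  augInl n p - (LinearMap.range (augMap X τ)).starProjection.toLinearMap ∘ₗ augInl n p

lemma norm_augInl (y : EuclideanSpace ℝ (Fin n)) : ‖augInl n p y‖ ^ 2 = ‖y‖ ^ 2 := by
  rw [WithLp.prod_norm_sq_eq_of_L2]; simp [augInl]

lemma norm_augInl_sub (X : Matrix (Fin n) (Fin p) ℝ) (τ : ℝ) (y : EuclideanSpace ℝ (Fin n))
    (b : Fin p → ℝ) :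
    ‖augInl n p y - augMap X τ b‖ ^ 2 = ‖y - designMap X b‖ ^ 2 + (∑ i, b i ^ 2) / τ ^ 2 := by
  rw [WithLp.prod_norm_sq_eq_of_L2]
  congr 1
  have : (augInl n p y - augMap X τ b).snd = -(τ⁻¹ • WithLp.toLp 2 b) := by
    simp [augInl, augMap]
  rw [this, norm_neg, norm_smul, mul_pow, EuclideanSpace.norm_sq_eq]
  simp only [Real.norm_eq_abs, sq_abs, inv_pow]
  rw [div_eq_inv_mul]

lemma norm_shrink_le (X : Matrix (Fin n) (Fin p) ℝ) (τ : ℝ) (y : EuclideanSpace ℝ (Fin n)) :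
    ‖shrink X τ y‖ ≤ ‖y‖ := by
  have h := norm_sub_starProjection_le (LinearMap.range (augMap X τ)) (augInl n p y) 0
    (Submodule.zero_mem _)
  rw [sub_zero, norm_augInl] at h
  exact (sq_le_sq₀ (norm_nonneg _) (norm_nonneg _)).1 h

/-- Completing the square in the ridge regression. -/
lemma exists_ridge (X : Matrix (Fin n) (Fin p) ℝ) (τ : ℝ) (y : EuclideanSpace ℝ (Fin n)) :
    ∃ b₀ : Fin p → ℝ, ∀ b : Fin p → ℝ,
      ‖y - designMap X b‖ ^ 2 + (∑ i, b i ^ 2) / τ ^ 2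
        = ‖shrink X τ y‖ ^ 2 + ‖augMap X τ (b₀ - b)‖ ^ 2 := by
  obtain ⟨b₀, hb₀⟩ := (LinearMap.range (augMap X τ)).starProjection_apply_mem (augInl n p y)
  refine ⟨b₀, fun b => ?_⟩
  rw [← norm_augInl_sub, norm_sub_sq_of_mem (LinearMap.range (augMap X τ)) _ _ ⟨b, rfl⟩, map_sub,
    hb₀]
  rfl

lemma norm_sq_le_shrink (X : Matrix (Fin n) (Fin p) ℝ) {τ η : ℝ} (hη : 0 < η)
    (h : ∀ c, ‖designMap X c‖ ^ 2 ≤ η / τ ^ 2 * ∑ i, c i ^ 2) (y : EuclideanSpace ℝ (Fin n)) :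
    ‖y‖ ^ 2 ≤ (1 + η) * ‖shrink X τ y‖ ^ 2 := by
  obtain ⟨b, hb⟩ := exists_ridge X τ y
  have h1 := hb b
  simp only [sub_self, map_zero, norm_zero] at h1
  have h2 := h b
  have h3 : ‖y‖ ≤ ‖y - designMap X b‖ + ‖designMap X b‖ := by
    simpa using norm_add_le (y - designMap X b) (designMap X b)
  have h4 : ‖y‖ ^ 2 ≤ (‖y - designMap X b‖ + ‖designMap X b‖) ^ 2 := by gcongr
  have h5 : ‖designMap X b‖ ^ 2 ≤ η * ((∑ i, b i ^ 2) / τ ^ 2) := by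
    rw [mul_div_assoc']; rwa [div_mul_eq_mul_div] at h2
  set u := ‖y - designMap X b‖
  set w := ‖designMap X b‖
  set S := (∑ i, b i ^ 2) / τ ^ 2
  have h6 : ‖shrink X τ y‖ ^ 2 = u ^ 2 + S := by linarith
  rw [h6]
  -- `2 u w ≤ η u² + w² / η`, cleared of denominators
  have h7 : 0 ≤ (η * u - w) ^ 2 := sq_nonneg _
  have h8 : η * (u + w) ^ 2 ≤ η * ((1 + η) * (u ^ 2 + S)) := by nlinarith
  exact h4.trans (le_of_mul_le_mul_left h8 hη)

lemma ofReal_likelihood (X : Matrix (Fin n) (Fin p) ℝ) {σ : ℝ} (hσ : 0 < σ) (b : Fin p → ℝ)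
    (y : Fin n → ℝ) :
    ENNReal.ofReal (likelihood X σ b y)
      = ENNReal.ofReal (Real.sqrt (2 * Real.pi * σ ^ 2))⁻¹ ^ n
        * eexp (-‖WithLp.toLp 2 y - designMap X b‖ ^ 2 / (2 * σ ^ 2)) := by
  have hv : 0 < σ ^ 2 := by positivity
  rw [likelihood, ENNReal.ofReal_prod_of_nonneg fun i _ => gaussianPDFReal_nonneg _ _ _]
  have h : ∀ i, ENNReal.ofReal (gaussianPDFReal ((X *ᵥ b) i) (σ ^ 2).toNNReal (y i))
      = ENNReal.ofReal (Real.sqrt (2 * Real.pi * σ ^ 2))⁻¹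
        * eexp (-(y i - (X *ᵥ b) i) ^ 2 / (2 * σ ^ 2)) := fun i => gaussianPDF_eq_eexp _ hv _
  simp_rw [h]
  rw [Finset.prod_mul_distrib, Finset.prod_const, Finset.card_univ, Fintype.card_fin, ← eexp_sum]
  congr 2
  rw [designMap_apply, ← WithLp.toLp_sub, EuclideanSpace.norm_sq_eq, neg_div, Finset.sum_div,
    ← Finset.sum_neg_distrib]
  refine Finset.sum_congr rfl fun i _ => ?_
  simp [neg_div]

lemma measurable_normSq_sub_designMap (X : Matrix (Fin n) (Fin p) ℝ)
    (y : EuclideanSpace ℝ (Fin n)) : Measurable fun b => ‖y - designMap X b‖ ^ 2 := by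
  have : Continuous (designMap X) := LinearMap.continuous_of_finiteDimensional _
  have h2 : Continuous fun b => ‖y - designMap X b‖ ^ 2 := by fun_prop
  exact h2.measurable

lemma measurable_ofReal_likelihood (X : Matrix (Fin n) (Fin p) ℝ) {σ : ℝ} (hσ : 0 < σ)
    (y : Fin n → ℝ) : Measurable fun b => ENNReal.ofReal (likelihood X σ b y) := by
  simp_rw [ofReal_likelihood X hσ]
  exact (measurable_eexp_comp ((measurable_normSq_sub_designMap X _).neg.div_const _)).const_mul _

/-- Integrating the likelihood against the spike prior. -/
lemma exists_spike_integral (X : Matrix (Fin n) (Fin p) ℝ) {σ τ : ℝ} (hσ : 0 < σ) (hτ : 0 < τ) :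
    ∃ Z : ℝ≥0∞, Z ≠ 0 ∧ Z ≠ ∞ ∧ ∀ y : Fin n → ℝ,
      ∫⁻ b, ENNReal.ofReal (likelihood X σ b y)
          ∂Measure.pi (fun _ : Fin p => gaussianReal 0 (σ ^ 2 * τ ^ 2).toNNReal)
        = Z * eexp (-‖shrink X τ (WithLp.toLp 2 y)‖ ^ 2 / (2 * σ ^ 2)) := by
  have hv : 0 < σ ^ 2 * τ ^ 2 := by positivity
  set c₁ : ℝ≥0∞ := ENNReal.ofReal (Real.sqrt (2 * Real.pi * σ ^ 2))⁻¹ ^ n with hc₁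
  set c₂ : ℝ≥0∞ := ENNReal.ofReal (Real.sqrt (2 * Real.pi * (σ ^ 2 * τ ^ 2)))⁻¹ ^ p
  set I : ℝ≥0∞ := ∫⁻ b : Fin p → ℝ, eexp (-‖augMap X τ b‖ ^ 2 / (2 * σ ^ 2))
  have hm : Measurable fun b : Fin p → ℝ => eexp (-‖augMap X τ b‖ ^ 2 / (2 * σ ^ 2)) :=
    measurable_eexp_comp ((measurable_normSq (augMap X τ) LinearMap.id).neg.div_const _)
  have key : ∀ y : Fin n → ℝ, ∫⁻ b, ENNReal.ofReal (likelihood X σ b y)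
          ∂Measure.pi (fun _ : Fin p => gaussianReal 0 (σ ^ 2 * τ ^ 2).toNNReal)
        = (c₂ * (c₁ * I)) * eexp (-‖shrink X τ (WithLp.toLp 2 y)‖ ^ 2 / (2 * σ ^ 2)) := by
    intro y
    rw [lintegral_pi_gaussianReal hv (measurable_ofReal_likelihood X hσ y), Fintype.card_fin,
      mul_assoc c₂]
    congr 1
    obtain ⟨b₀, hb₀⟩ := exists_ridge X τ (WithLp.toLp 2 y)
    have h1 : ∀ b : Fin p → ℝ, eexp (-(∑ i, b i ^ 2) / (2 * (σ ^ 2 * τ ^ 2)))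
          * ENNReal.ofReal (likelihood X σ b y)
        = (c₁ * eexp (-‖shrink X τ (WithLp.toLp 2 y)‖ ^ 2 / (2 * σ ^ 2)))
          * eexp (-‖augMap X τ (b₀ - b)‖ ^ 2 / (2 * σ ^ 2)) := by
      intro b
      rw [ofReal_likelihood X hσ, ← hc₁, mul_left_comm, ← eexp_add, mul_assoc c₁, ← eexp_add]
      congr 2
      have := hb₀ b
      field_simp at this ⊢
      linarith
    simp_rw [h1]
    have hm' : Measurable fun b : Fin p → ℝ =>
        eexp (-‖augMap X τ (b₀ - b)‖ ^ 2 / (2 * σ ^ 2)) :=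
      hm.comp (measurable_const.sub measurable_id)
    rw [lintegral_const_mul _ hm', lintegral_sub_left_eq_self
      (fun b : Fin p → ℝ => eexp (-‖augMap X τ b‖ ^ 2 / (2 * σ ^ 2))) b₀]
    ring
  have h0 := key 0
  simp only [WithLp.toLp_zero, map_zero, norm_zero, ne_eq, OfNat.ofNat_ne_zero, not_false_eq_true,
    zero_pow, neg_zero, zero_div, eexp_zero, mul_one] at h0
  refine ⟨c₂ * (c₁ * I), ?_, ?_, key⟩
  · rw [← h0]
    intro h
    rw [lintegral_eq_zero_iff (measurable_ofReal_likelihood X hσ 0)] at h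
    obtain ⟨b, hb⟩ := h.exists
    have hpos : 0 < Real.sqrt (2 * Real.pi * σ ^ 2) := Real.sqrt_pos.2 (by positivity)
    replace hb : ENNReal.ofReal (likelihood X σ b 0) = 0 := hb
    rw [ofReal_likelihood X hσ, mul_eq_zero] at hb
    rcases hb with hb | hb
    · refine absurd hb (pow_ne_zero _ ?_)
      simpa using hpos
    · exact eexp_ne_zero _ hb
  · rw [← h0]
    refine ne_of_lt (lt_of_le_of_lt (lintegral_mono (g := fun _ => c₁) fun b => ?_) ?_)
    · rw [ofReal_likelihood X hσ]
      calc _ ≤ c₁ * eexp 0 := by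
            gcongr
            refine eexp_mono (div_nonpos_of_nonpos_of_nonneg ?_ (by positivity))
            simp
        _ = c₁ := by rw [eexp_zero, mul_one]
    · simp [hc₁]

/-- The prior of the coefficients given the model `k` is the law of `b + 1_k c`, where `b` has the
spike law and `c` has variance the excess of the slab over the spike. -/
lemma coefPrior_eq_map {σ τ₀ τ₁ s : ℝ} (hs : 0 ≤ s) (h : τ₁ ^ 2 = τ₀ ^ 2 + s)
    (k : Finset (Fin p)) :
    coefPrior σ τ₀ τ₁ k
      = ((Measure.pi fun _ : Fin p => gaussianReal 0 (σ ^ 2 * τ₀ ^ 2).toNNReal).prod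
          (Measure.pi fun _ : Fin p => gaussianReal 0 (σ ^ 2 * s).toNNReal)).map
        fun x j => x.1 j + if j ∈ k then x.2 j else 0 := by
  have hmp := measurePreserving_arrowProdEquivProdArrow ℝ ℝ (Fin p)
    (fun _ => gaussianReal 0 (σ ^ 2 * τ₀ ^ 2).toNNReal)
    (fun _ => gaussianReal 0 (σ ^ 2 * s).toNNReal)
  have hf : ∀ j : Fin p, Measurable fun x : ℝ × ℝ => x.1 + if j ∈ k then x.2 else 0 := by
    intro j; split_ifs <;> fun_prop
  rw [← hmp.map_eq, Measure.map_map _ hmp.measurable]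
  · have h1 : ((fun (x : (Fin p → ℝ) × (Fin p → ℝ)) j => x.1 j + if j ∈ k then x.2 j else 0) ∘
        (MeasurableEquiv.arrowProdEquivProdArrow ℝ ℝ (Fin p)))
        = fun x j => (fun x : ℝ × ℝ => x.1 + if j ∈ k then x.2 else 0) (x j) := rfl
    rw [h1]
    have h2 : ∀ j : Fin p, ((gaussianReal 0 (σ ^ 2 * τ₀ ^ 2).toNNReal).prod
        (gaussianReal 0 (σ ^ 2 * s).toNNReal)).map (fun x : ℝ × ℝ => x.1 + if j ∈ k then x.2 else 0)
        = gaussianReal 0 (σ ^ 2 * (if j ∈ k then τ₁ else τ₀) ^ 2).toNNReal := by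
      intro j
      by_cases hj : j ∈ k
      · simp only [hj, if_true]
        have := gaussianReal_conv_gaussianReal (m₁ := 0) (m₂ := 0)
          (v₁ := (σ ^ 2 * τ₀ ^ 2).toNNReal) (v₂ := (σ ^ 2 * s).toNNReal)
        rw [Measure.conv] at this
        rw [this, h, mul_add, Real.toNNReal_add (by positivity) (by positivity), add_zero]
      · simp only [hj, if_false, add_zero]
        simp
    have : ∀ j : Fin p, SigmaFinite (((gaussianReal 0 (σ ^ 2 * τ₀ ^ 2).toNNReal).prod
        (gaussianReal 0 (σ ^ 2 * s).toNNReal)).map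
          (fun x : ℝ × ℝ => x.1 + if j ∈ k then x.2 else 0)) := by
      intro j; rw [h2]; infer_instance
    rw [Measure.pi_map_pi fun j => (hf j).aemeasurable]
    simp_rw [h2]
    rfl
  · refine measurable_pi_lambda _ fun j => ?_
    split_ifs <;> fun_prop

end

/-! ### Bounds on the marginal likelihoods and the posterior ratio -/

lemma measurable_eexp_normSq_sub {ι E : Type*} [Fintype ι] [NormedAddCommGroup E]
    [InnerProductSpace ℝ E] (A : (ι → ℝ) →ₗ[ℝ] E) (v : E) :
    Measurable fun c => eexp (-‖v - A c‖ ^ 2) := by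
  have : Continuous A := LinearMap.continuous_of_finiteDimensional _
  have h2 : Continuous fun b => -‖v - A b‖ ^ 2 := by fun_prop
  exact measurable_eexp_comp h2.measurable

section

variable {ι : Type*} [DecidableEq ι]

/-- The vector `c` with the coordinates outside `k` set to zero. -/
def restrictTo (k : Finset ι) (c : ι → ℝ) : ι → ℝ := fun j => if j ∈ k then c j else 0

lemma restrictTo_updateFinset {k b : Finset ι} (hb : b ⊆ k) (x : ι → ℝ) (z : b → ℝ) :
    restrictTo k (Function.updateFinset x b z) = restrictTo (k \ b) x + zeroExtend b z := by
  ext i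
  by_cases h : i ∈ b
  · simp [restrictTo, Function.updateFinset, h, hb h, zeroExtend_apply_mem b z h]
  · by_cases h2 : i ∈ k <;>
      simp [restrictTo, Function.updateFinset, h, h2, zeroExtend_apply_notMem b z h]

lemma measurable_restrictTo (k : Finset ι) : Measurable (restrictTo k) := by
  refine measurable_pi_lambda _ fun j => ?_
  unfold restrictTo
  split_ifs <;> fun_prop

variable [Fintype ι]

lemma lintegral_pi_le_of_lmarginal_le {μ : ι → Measure ℝ} [∀ i, IsProbabilityMeasure (μ i)]
    {f : (ι → ℝ) → ℝ≥0∞} (hf : Measurable f) (b : Finset ι) {L : ℝ≥0∞}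
    (h : ∀ x, (∫⋯∫⁻_b, f ∂μ) x ≤ L) : ∫⁻ x, f x ∂Measure.pi μ ≤ L := by
  rw [lintegral_eq_lmarginal_univ (0 : ι → ℝ), ← Finset.union_compl b,
    lmarginal_union' μ f hf disjoint_compl_right]
  refine (lintegral_mono (g := fun _ => L) fun z => h _).trans ?_
  simp

lemma le_lintegral_pi_of_le_lmarginal {μ : ι → Measure ℝ} [∀ i, IsProbabilityMeasure (μ i)]
    {f : (ι → ℝ) → ℝ≥0∞} (hf : Measurable f) (b : Finset ι) {L : ℝ≥0∞}
    (h : ∀ x, L ≤ (∫⋯∫⁻_b, f ∂μ) x) : L ≤ ∫⁻ x, f x ∂Measure.pi μ := by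
  rw [lintegral_eq_lmarginal_univ (0 : ι → ℝ), ← Finset.union_compl b,
    lmarginal_union' μ f hf disjoint_compl_right]
  refine le_trans ?_ (lintegral_mono (f := fun _ => L) fun z => h _)
  simp

variable {E : Type*} [NormedAddCommGroup E] [InnerProductSpace ℝ E]

/-- Upper bound for an integral over a Gaussian slab: on the coordinates in `b` the slab density is
replaced by its maximum. -/
lemma lintegral_slab_le (A : (ι → ℝ) →ₗ[ℝ] E) (v : E) {w : ℝ} (hw : 0 < w) {k b : Finset ι}
    (hb : b ⊆ k) {G : ℝ} (hG : ∀ c : ι → ℝ, (∀ i ∉ k \ b, c i = 0) →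
      G ≤ ‖(v - A c) - (imageOn A b).starProjection (v - A c)‖ ^ 2) :
    ∫⁻ c, eexp (-‖v - A (restrictTo k c)‖ ^ 2)
        ∂Measure.pi (fun _ : ι => gaussianReal 0 w.toNNReal)
      ≤ ENNReal.ofReal (Real.sqrt (2 * Real.pi * w))⁻¹ ^ b.card
        * (gaussVol A b * eexp (-G)) := by
  have hm : Measurable fun c => eexp (-‖v - A (restrictTo k c)‖ ^ 2) :=
    (measurable_eexp_normSq_sub A v).comp (measurable_restrictTo k)
  refine lintegral_pi_le_of_lmarginal_le hm b fun x => ?_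
  set c := restrictTo (k \ b) x with hc
  have h1 : ∀ z : b → ℝ, eexp (-‖v - A (restrictTo k (Function.updateFinset x b z))‖ ^ 2)
      = eexp (-‖(v - A c) - A (zeroExtend b z)‖ ^ 2) := by
    intro z
    rw [restrictTo_updateFinset hb, map_add, sub_sub]
  rw [lmarginal]
  simp_rw [h1]
  have hm2 : Measurable fun z : b → ℝ => eexp (-‖(v - A c) - A (zeroExtend b z)‖ ^ 2) :=
    (measurable_eexp_normSq_sub A (v - A c)).comp
      (LinearMap.continuous_of_finiteDimensional (zeroExtend b)).measurable
  rw [lintegral_pi_gaussianReal hw hm2, Fintype.card_coe]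
  gcongr
  calc _ ≤ ∫⁻ z : b → ℝ, eexp (-‖(v - A c) - A (zeroExtend b z)‖ ^ 2) := by
        refine lintegral_mono fun z => ?_
        calc _ ≤ eexp 0 * eexp (-‖(v - A c) - A (zeroExtend b z)‖ ^ 2) := by
              gcongr
              refine eexp_mono (div_nonpos_of_nonpos_of_nonneg (neg_nonpos.2 ?_) (by positivity))
              exact Finset.sum_nonneg fun i _ => sq_nonneg _
          _ = _ := by rw [eexp_zero, one_mul]
    _ ≤ _ := by
        rw [lintegral_exp_neg_normSq_sub]
        gcongr
        refine eexp_mono (neg_le_neg (hG c fun i hi => ?_))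
        simp [hc, restrictTo, hi]

/-- Lower bound for an integral over a Gaussian slab: the integrand is centred at `β` and averaged
over the reflection `z ↦ -z`. -/
lemma le_lintegral_slab (A : (ι → ℝ) →ₗ[ℝ] E) (v : E) {w : ℝ} (hw : 0 < w) {t : Finset ι}
    {β : ι → ℝ} (hβ : ∀ i ∉ t, β i = 0)
    (h : ∀ c : ι → ℝ, (∀ i ∉ t, c i = 0) → (∑ i, c i ^ 2) / (2 * w) ≤ ‖A c‖ ^ 2) :
    ENNReal.ofReal (Real.sqrt (2 * Real.pi * w))⁻¹ ^ t.card
        * (eexp (-((∑ i, β i ^ 2) / (2 * w) + ‖v - A β‖ ^ 2))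
          * (ENNReal.ofReal ((Real.sqrt 2 ^ t.card)⁻¹) * gaussVol A t))
      ≤ ∫⁻ c, eexp (-‖v - A (restrictTo t c)‖ ^ 2)
        ∂Measure.pi (fun _ : ι => gaussianReal 0 w.toNNReal) := by
  have hm : Measurable fun c => eexp (-‖v - A (restrictTo t c)‖ ^ 2) :=
    (measurable_eexp_normSq_sub A v).comp (measurable_restrictTo t)
  refine le_lintegral_pi_of_le_lmarginal hm t fun x => ?_
  have h1 : ∀ z : t → ℝ, eexp (-‖v - A (restrictTo t (Function.updateFinset x t z))‖ ^ 2)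
      = eexp (-‖v - A (zeroExtend t z)‖ ^ 2) := by
    intro z
    rw [restrictTo_updateFinset subset_rfl, Finset.sdiff_self]
    have : restrictTo (∅ : Finset ι) x = 0 := by ext i; simp [restrictTo]
    rw [this, zero_add]
  rw [lmarginal]
  simp_rw [h1]
  have hzc : Continuous (zeroExtend t) := LinearMap.continuous_of_finiteDimensional _
  have hAc : Continuous A := LinearMap.continuous_of_finiteDimensional _
  have hm2 : Measurable fun z : t → ℝ => eexp (-‖v - A (zeroExtend t z)‖ ^ 2) :=
    (measurable_eexp_normSq_sub A v).comp hzc.measurable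
  rw [lintegral_pi_gaussianReal hw hm2, Fintype.card_coe]
  gcongr
  set f : (t → ℝ) → ℝ≥0∞ := fun z =>
    eexp (-(∑ i, z i ^ 2) / (2 * w)) * eexp (-‖v - A (zeroExtend t z)‖ ^ 2) with hf
  have hfm : Measurable f := by
    refine Measurable.mul (measurable_eexp_comp ?_) hm2
    fun_prop
  set b₀ : t → ℝ := fun i => β i with hb₀
  have hβ' : zeroExtend t b₀ = β := zeroExtend_restrict t hβ
  set Q : ℝ := (∑ i, β i ^ 2) / (2 * w) + ‖v - A β‖ ^ 2 with hQ
  set g : (t → ℝ) → ℝ≥0∞ := fun z => eexp (-((∑ i, z i ^ 2) / (2 * w) + ‖A (zeroExtend t z)‖ ^ 2))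
    with hg
  have hgm : Measurable g := by
    refine measurable_eexp_comp (Measurable.neg (Measurable.add ?_ ?_))
    · fun_prop
    · exact measurable_normSq A (zeroExtend t)
  have e1 : ∫⁻ z, f (b₀ + z) = ∫⁻ z, f z := lintegral_add_left_eq_self f b₀
  have e2 : ∫⁻ z, f (b₀ - z) = ∫⁻ z, f z := lintegral_sub_left_eq_self f b₀
  -- convexity of `exp`; the cross terms cancel by the parallelogram law
  have hpt : ∀ z, 2 * (eexp (-Q) * g z) ≤ f (b₀ + z) + f (b₀ - z) := by
    intro z
    simp only [hf, hg, ← eexp_add]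
    set a₁ := -(∑ i, (b₀ + z) i ^ 2) / (2 * w) + -‖v - A (zeroExtend t (b₀ + z))‖ ^ 2
    set a₂ := -(∑ i, (b₀ - z) i ^ 2) / (2 * w) + -‖v - A (zeroExtend t (b₀ - z))‖ ^ 2
    have hsum : -Q + -((∑ i, z i ^ 2) / (2 * w) + ‖A (zeroExtend t z)‖ ^ 2) = (a₁ + a₂) / 2 := by
      have p1 : ‖v - A (zeroExtend t (b₀ + z))‖ ^ 2 + ‖v - A (zeroExtend t (b₀ - z))‖ ^ 2
          = 2 * (‖v - A β‖ ^ 2 + ‖A (zeroExtend t z)‖ ^ 2) := by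
        have := parallelogram_law_with_norm ℝ (v - A β) (A (zeroExtend t z))
        rw [map_add, map_sub, hβ', map_add, map_sub, ← sub_sub, ← sub_add]
        nlinarith [this]
      have p2 : (∑ i, (b₀ + z) i ^ 2) + (∑ i, (b₀ - z) i ^ 2)
          = 2 * ((∑ i, β i ^ 2) + ∑ i, z i ^ 2) := by
        rw [← hβ', sum_zeroExtend_sq, ← Finset.sum_add_distrib, ← Finset.sum_add_distrib,
          Finset.mul_sum]
        exact Finset.sum_congr rfl fun i _ => by simp only [Pi.add_apply, Pi.sub_apply]; ring
      simp only [hQ, a₁, a₂]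
      field_simp
      linear_combination 2 * w * p1 + p2
    rw [hsum]
    have hr : 2 * Real.exp ((a₁ + a₂) / 2) ≤ Real.exp a₁ + Real.exp a₂ := by
      have q1 : Real.exp a₁ = Real.exp (a₁ / 2) ^ 2 := by rw [sq, ← Real.exp_add]; ring_nf
      have q2 : Real.exp a₂ = Real.exp (a₂ / 2) ^ 2 := by rw [sq, ← Real.exp_add]; ring_nf
      have q3 : Real.exp ((a₁ + a₂) / 2) = Real.exp (a₁ / 2) * Real.exp (a₂ / 2) := by
        rw [← Real.exp_add]; ring_nf
      rw [q1, q2, q3]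
      nlinarith [sq_nonneg (Real.exp (a₁ / 2) - Real.exp (a₂ / 2))]
    have := ENNReal.ofReal_le_ofReal hr
    rwa [ENNReal.ofReal_add (Real.exp_pos _).le (Real.exp_pos _).le,
      ENNReal.ofReal_mul (by norm_num), ENNReal.ofReal_ofNat] at this
  have h2 : 2 * (eexp (-Q) * ∫⁻ z, g z) ≤ 2 * ∫⁻ z, f z := by
    calc 2 * (eexp (-Q) * ∫⁻ z, g z) = ∫⁻ z, 2 * (eexp (-Q) * g z) := by
          rw [lintegral_const_mul _ (hgm.const_mul _), lintegral_const_mul _ hgm]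
      _ ≤ ∫⁻ z, (f (b₀ + z) + f (b₀ - z)) := lintegral_mono hpt
      _ = (∫⁻ z, f (b₀ + z)) + ∫⁻ z, f (b₀ - z) :=
          lintegral_add_left (f := fun z => f (b₀ + z))
            (hfm.comp (measurable_const.add measurable_id)) _
      _ = 2 * ∫⁻ z, f z := by rw [e1, e2, two_mul]
  have h3 : eexp (-Q) * ∫⁻ z, g z ≤ ∫⁻ z, f z :=
    (ENNReal.mul_le_mul_iff_right (by norm_num) (by norm_num)).1 h2
  refine le_trans ?_ h3
  gcongr
  have hsm : Measurable fun z : t → ℝ => eexp (-‖A (zeroExtend t z)‖ ^ 2) :=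
    measurable_eexp_comp (measurable_normSq A (zeroExtend t)).neg
  -- the slab exponent is at most `‖A z‖²`, so `‖A (√2 z)‖²` dominates both exponents
  have h4 := lintegral_comp_smul_pi _ hsm (r := Real.sqrt 2) (by positivity)
  rw [Fintype.card_coe] at h4
  rw [gaussVol, ← h4]
  refine lintegral_mono fun z => eexp_mono (neg_le_neg ?_)
  have h5 := h (zeroExtend t z) fun i hi => zeroExtend_apply_notMem t z hi
  rw [sum_zeroExtend_sq] at h5
  rw [map_smul, map_smul, norm_smul, mul_pow, Real.norm_eq_abs, sq_abs, Real.sq_sqrt (by norm_num)]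
  linarith

end

section

variable {n p : ℕ}

/-- The design, shrunk and scaled so that the likelihood after integrating out the spike is a
multiple of `exp (-‖v - A c‖²)`. -/
noncomputable def scaledDesign (X : Matrix (Fin n) (Fin p) ℝ) (σ τ : ℝ) :
    (Fin p → ℝ) →ₗ[ℝ] Aug n p :=
  (Real.sqrt 2 * σ)⁻¹ • (shrink X τ ∘ₗ designMap X)

lemma normSq_smul_inv (σ : ℝ) {E : Type*} [NormedAddCommGroup E]
    [InnerProductSpace ℝ E] (x : E) :
    ‖(Real.sqrt 2 * σ)⁻¹ • x‖ ^ 2 = ‖x‖ ^ 2 / (2 * σ ^ 2) := by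
  rw [norm_smul, mul_pow, Real.norm_eq_abs, sq_abs, inv_pow, mul_pow,
    Real.sq_sqrt (by norm_num : (0:ℝ) ≤ 2)]
  rw [div_eq_inv_mul]

lemma exists_ofReal_marginal_eq (X : Matrix (Fin n) (Fin p) ℝ) {σ τ₀ τ₁ s : ℝ} (hσ : 0 < σ)
    (hτ : 0 < τ₀) (hs : 0 ≤ s) (h : τ₁ ^ 2 = τ₀ ^ 2 + s) :
    ∃ Z : ℝ≥0∞, Z ≠ 0 ∧ Z ≠ ∞ ∧ ∀ (k : Finset (Fin p)) (y : Fin n → ℝ),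
      ENNReal.ofReal (marginal X σ τ₀ τ₁ k y)
        = Z * ∫⁻ c, eexp (-‖(Real.sqrt 2 * σ)⁻¹ • shrink X τ₀ (WithLp.toLp 2 y)
            - scaledDesign X σ τ₀ (restrictTo k c)‖ ^ 2)
          ∂Measure.pi (fun _ : Fin p => gaussianReal 0 (σ ^ 2 * s).toNNReal) := by
  obtain ⟨Z, hZ0, hZt, hZ⟩ := exists_spike_integral X hσ hτ
  refine ⟨Z, hZ0, hZt, fun k y => ?_⟩
  set v := (Real.sqrt 2 * σ)⁻¹ • shrink X τ₀ (WithLp.toLp 2 y)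
  have hshift : ∀ b c : Fin p → ℝ, ENNReal.ofReal (likelihood X σ (b + c) y)
      = ENNReal.ofReal (likelihood X σ b (y - X *ᵥ c)) := by
    intro b c
    rw [ofReal_likelihood X hσ, ofReal_likelihood X hσ, map_add, WithLp.toLp_sub,
      ← designMap_apply X c, sub_sub, add_comm (designMap X b)]
  have hm := measurable_ofReal_likelihood X hσ y
  have hm2 : Measurable fun c : Fin p → ℝ => eexp (-‖v - scaledDesign X σ τ₀ (restrictTo k c)‖ ^ 2) :=
    (measurable_eexp_normSq_sub _ v).comp (measurable_restrictTo k)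
  have hadd : (fun (x : (Fin p → ℝ) × (Fin p → ℝ)) j => x.1 j + if j ∈ k then x.2 j else 0)
      = fun x => x.1 + restrictTo k x.2 := rfl
  have hmap : Measurable fun x : (Fin p → ℝ) × (Fin p → ℝ) => x.1 + restrictTo k x.2 :=
    measurable_fst.add ((measurable_restrictTo k).comp measurable_snd)
  have key : ∫⁻ b, ENNReal.ofReal (likelihood X σ b y) ∂coefPrior σ τ₀ τ₁ k
      = Z * ∫⁻ c, eexp (-‖v - scaledDesign X σ τ₀ (restrictTo k c)‖ ^ 2)
          ∂Measure.pi (fun _ : Fin p => gaussianReal 0 (σ ^ 2 * s).toNNReal) := by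
    have hm3 : Measurable fun x : (Fin p → ℝ) × (Fin p → ℝ) =>
        ENNReal.ofReal (likelihood X σ (x.1 + restrictTo k x.2) y) := hm.comp hmap
    rw [coefPrior_eq_map hs h k, hadd, lintegral_map hm hmap, lintegral_prod_symm _ hm3.aemeasurable,
      ← lintegral_const_mul _ hm2]
    refine lintegral_congr fun c => ?_
    change ∫⁻ b, ENNReal.ofReal (likelihood X σ (b + restrictTo k c) y) ∂_ = _
    simp_rw [hshift]
    rw [hZ]
    congr 2
    rw [WithLp.toLp_sub, ← designMap_apply, map_sub, neg_div, ← normSq_smul_inv σ, smul_sub]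
    rfl
  rw [← key, marginal, integral_eq_lintegral_of_nonneg_ae, ENNReal.ofReal_toReal]
  · rw [key]
    refine ENNReal.mul_ne_top hZt (ne_of_lt (lt_of_le_of_lt
      (lintegral_mono (g := fun _ => 1) fun c => ?_) (by simp)))
    rw [← eexp_zero]
    exact eexp_mono (neg_nonpos.2 (sq_nonneg _))
  · refine Eventually.of_forall fun b => ?_
    exact Finset.prod_nonneg fun i _ => gaussianPDFReal_nonneg _ _ _
  · have hm3 : Measurable fun b => likelihood X σ b y := by
      have : (fun b => likelihood X σ b y)
          = fun b => (ENNReal.ofReal (likelihood X σ b y)).toReal := by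
        funext b
        exact (ENNReal.toReal_ofReal
          (Finset.prod_nonneg fun i _ => gaussianPDFReal_nonneg _ _ _)).symm
      rw [this]; exact hm.ennreal_toReal
    exact hm3.aestronglyMeasurable

lemma modelPrior_eq {q : ℝ} (hq : q < 1) (k : Finset (Fin p)) :
    modelPrior q k = (1 - q) ^ p * (q / (1 - q)) ^ k.card := by
  have h1 : (1 - q) ≠ 0 := by linarith
  have h2 : ∀ j : Fin p, (if j ∈ k then q else 1 - q)
      = (1 - q) * (if j ∈ k then q / (1 - q) else 1) := by
    intro j; split_ifs
    · field_simp
    · ring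
  rw [modelPrior]
  simp_rw [h2]
  rw [Finset.prod_mul_distrib, Finset.prod_const, Finset.card_univ, Fintype.card_fin,
    Finset.prod_ite_mem, Finset.univ_inter, Finset.prod_const]

lemma imageOn_smul {ι : Type*} [DecidableEq ι] {E : Type*} [NormedAddCommGroup E]
    [InnerProductSpace ℝ E] (A : (ι → ℝ) →ₗ[ℝ] E) (s : Finset ι) {r : ℝ} (hr : r ≠ 0) :
    imageOn (r • A) s = imageOn A s := by
  rw [imageOn, LinearMap.smul_comp, LinearMap.range_smul _ _ hr]; rfl

lemma starProjection_congr {E : Type*} [NormedAddCommGroup E] [InnerProductSpace ℝ E]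
    {K L : Submodule ℝ E} [K.HasOrthogonalProjection] [L.HasOrthogonalProjection] (h : K = L) :
    K.starProjection = L.starProjection := by
  subst h; rfl

/-- The design seen through `shrink`. -/
noncomputable def shrunkDesign (X : Matrix (Fin n) (Fin p) ℝ) (τ : ℝ) :
    (Fin p → ℝ) →ₗ[ℝ] Aug n p := shrink X τ ∘ₗ designMap X

/-- Deterministic bound on the posterior ratio in terms of a set `b` of linearly independent
covariates of `k` which contains `k ∩ t`. Each covariate of `b` outside `t` costs a factor
`((1 + η) / (s Λ)) ^ (1/2)`, and each active covariate missed by `b` a factor `(s M) ^ (1/2)`. -/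
theorem posteriorRatio_le (X : Matrix (Fin n) (Fin p) ℝ) {σ τ₀ τ₁ s q η Λ M : ℝ} (hσ : 0 < σ)
    (hτ : 0 < τ₀) (hs : 0 < s) (h : τ₁ ^ 2 = τ₀ ^ 2 + s) (hq0 : 0 < q) (hq1 : q < 1)
    (hη : 0 < η) (hΛ : 0 < Λ) (hM : 0 < M) {k t b : Finset (Fin p)} (hb : b ⊆ k)
    (β : Fin p → ℝ) (y : Fin n → ℝ)
    (hshr : ∀ x, ‖x‖ ^ 2 ≤ (1 + η) * ‖shrink X τ₀ x‖ ^ 2)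
    (hΛb : ∀ c : Fin p → ℝ, (∀ i ∉ b, c i = 0) → Λ * ∑ i, c i ^ 2 ≤ ‖designMap X c‖ ^ 2)
    (hΛt : ∀ c : Fin p → ℝ, (∀ i ∉ t, c i = 0) → Λ * ∑ i, c i ^ 2 ≤ ‖designMap X c‖ ^ 2)
    (hsΛ : 1 + η ≤ s * Λ) (hMt : ∀ j ∈ t, ‖designMap X (Pi.single j 1)‖ ^ 2 ≤ M)
    {G : ℝ} (hG : ∀ c : Fin p → ℝ, (∀ i ∉ k \ b, c i = 0) →
      G ≤ ‖shrink X τ₀ (WithLp.toLp 2 y - designMap X c)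
        - (imageOn (shrunkDesign X τ₀) b).starProjection
          (shrink X τ₀ (WithLp.toLp 2 y - designMap X c))‖ ^ 2) :
    posteriorRatio X σ τ₀ τ₁ q k t y
      ≤ (q / (1 - q)) ^ k.card / (q / (1 - q)) ^ t.card
        * (Real.sqrt 2 ^ t.card * Real.exp ((∑ j ∈ t, β j ^ 2) / (2 * (σ ^ 2 * s)))
          * Real.sqrt (s * M) ^ (t \ b).card * Real.sqrt ((1 + η) / (s * Λ)) ^ (b \ t).card
          * Real.exp ((‖shrink X τ₀ (WithLp.toLp 2 y - partialMean X β t)‖ ^ 2 - G)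
              / (2 * σ ^ 2))) := by
  obtain ⟨Z, hZ0, hZt, hZ⟩ := exists_ofReal_marginal_eq X hσ hτ hs.le h
  set w : ℝ := σ ^ 2 * s with hw
  have hw0 : 0 < w := by positivity
  set A := scaledDesign X σ τ₀ with hA
  set v := (Real.sqrt 2 * σ)⁻¹ • shrink X τ₀ (WithLp.toLp 2 y) with hv
  have hr0 : (Real.sqrt 2 * σ)⁻¹ ≠ 0 := by positivity
  have hAeq : ∀ c, A c = (Real.sqrt 2 * σ)⁻¹ • shrink X τ₀ (designMap X c) := fun c => rfl
  have hAim : ∀ b, imageOn A b = imageOn (shrunkDesign X τ₀) b := fun b => imageOn_smul _ b hr0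
  have hAnorm : ∀ c, ‖A c‖ ^ 2 = ‖shrink X τ₀ (designMap X c)‖ ^ 2 / (2 * σ ^ 2) := fun c => by
    rw [hAeq, normSq_smul_inv]
  have hvA : ∀ c, v - A c
      = (Real.sqrt 2 * σ)⁻¹ • shrink X τ₀ (WithLp.toLp 2 y - designMap X c) := fun c => by
    rw [hAeq, hv, ← smul_sub, ← map_sub]
  have hσ2 : 0 < 2 * σ ^ 2 := by positivity
  set ΛA : ℝ := Λ / ((1 + η) * (2 * σ ^ 2)) with hΛA
  have hΛA0 : 0 < ΛA := by positivity
  set MA : ℝ := M / (2 * σ ^ 2) with hMA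
  have hMA0 : 0 < MA := by positivity
  have hlow : ∀ c : Fin p → ℝ, Λ * ∑ i, c i ^ 2 ≤ ‖designMap X c‖ ^ 2 →
      ΛA * ∑ i, c i ^ 2 ≤ ‖A c‖ ^ 2 := by
    intro c hc
    rw [hAnorm, hΛA, le_div_iff₀ hσ2, div_mul_eq_mul_div, div_mul_eq_mul_div,
      div_le_iff₀ (by positivity)]
    nlinarith [hc.trans (hshr (designMap X c))]
  set c : ℝ := (Real.sqrt (2 * Real.pi * w))⁻¹ with hc
  have hc0 : 0 < c := by positivity
  set x : ℝ := Real.sqrt (Real.pi / ΛA) with hx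
  set z : ℝ := Real.sqrt (Real.pi / MA) with hz
  have hx0 : 0 < x := by positivity
  have hz0 : 0 < z := by positivity
  set Q : ℝ := (∑ i, (restrictTo t β) i ^ 2) / (2 * w) + ‖v - A (restrictTo t β)‖ ^ 2 with hQ
  set g := gaussVol A (b ∩ t)
  have hkup : ENNReal.ofReal (marginal X σ τ₀ τ₁ k y)
      ≤ Z * (ENNReal.ofReal c ^ b.card * ((g * ENNReal.ofReal x ^ (b \ t).card)
        * eexp (-(G / (2 * σ ^ 2))))) := by
    rw [hZ]
    gcongr
    refine (lintegral_slab_le A v hw0 hb (G := G / (2 * σ ^ 2)) fun c' hc' => ?_).trans ?_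
    · rw [hvA, starProjection_congr (hAim b), map_smul, ← smul_sub, normSq_smul_inv]
      gcongr
      exact hG c' hc'
    · gcongr
      have hu : b ∩ t ∪ b \ t = b := by
        rw [Finset.union_comm]; exact Finset.sdiff_union_inter b t
      have := gaussVol_union_le A (a := b ∩ t) (e := b \ t)
        (Finset.disjoint_left.2 fun i hi hi' =>
          (Finset.mem_sdiff.1 hi').2 (Finset.mem_inter.1 hi).2) hΛA0
        (by rw [hu]; exact fun c' hc' => hlow c' (hΛb c' hc'))
      rwa [hu] at this
  have htlow : Z * (ENNReal.ofReal c ^ t.card * (eexp (-Q) * (ENNReal.ofReal ((Real.sqrt 2 ^ t.card)⁻¹)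
        * (g * ENNReal.ofReal z ^ (t \ b).card))))
      ≤ ENNReal.ofReal (marginal X σ τ₀ τ₁ t y) := by
    rw [hZ]
    gcongr
    refine le_trans ?_ (le_lintegral_slab A v hw0 (t := t) (β := restrictTo t β) ?_ ?_)
    · gcongr
      have hu : b ∩ t ∪ t \ b = t := by
        rw [Finset.inter_comm, Finset.union_comm]; exact Finset.sdiff_union_inter t b
      have := le_gaussVol_union A (a := b ∩ t) (e := t \ b)
        (Finset.disjoint_left.2 fun i hi hi' =>
          (Finset.mem_sdiff.1 hi').2 (Finset.mem_inter.1 hi).1) hMA0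
        (fun j hj => by
          rw [hAnorm, hMA]
          gcongr
          refine le_trans ?_ (hMt j (Finset.mem_sdiff.1 hj).1)
          gcongr
          exact norm_shrink_le X τ₀ _)
      rwa [hu] at this
    · intro i hi; simp [restrictTo, hi]
    · intro c' hc'
      refine le_trans ?_ (hlow c' (hΛt c' hc'))
      rw [hΛA, hw, div_mul_eq_mul_div, div_le_div_iff₀ (by positivity) (by positivity)]
      have hS : 0 ≤ ∑ i, c' i ^ 2 := Finset.sum_nonneg fun i _ => sq_nonneg _
      have : (1 + η) * ((∑ i, c' i ^ 2) * (2 * σ ^ 2)) ≤ s * Λ * ((∑ i, c' i ^ 2) * (2 * σ ^ 2)) := by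
        gcongr
      nlinarith
  set mk := marginal X σ τ₀ τ₁ k y
  set mt := marginal X σ τ₀ τ₁ t y
  have hnn : ∀ l, 0 ≤ marginal X σ τ₀ τ₁ l y := fun l =>
    integral_nonneg fun b => Finset.prod_nonneg fun i _ => gaussianPDFReal_nonneg _ _ _
  have hpos : ∀ l, 0 < marginal X σ τ₀ τ₁ l y := by
    intro l
    refine lt_of_le_of_ne (hnn l) fun h0 => ?_
    have h1 := hZ l y
    have hm : Measurable fun c => eexp (-‖v - A (restrictTo l c)‖ ^ 2) :=
      (measurable_eexp_normSq_sub A v).comp (measurable_restrictTo l)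
    rw [← h0, ENNReal.ofReal_zero, eq_comm, mul_eq_zero, or_iff_right hZ0,
      lintegral_eq_zero_iff hm] at h1
    obtain ⟨c', hc'⟩ := h1.exists
    exact eexp_ne_zero _ hc'
  -- the two bounds share the factor `Z * g`, which cancels
  have hmain : mk * (c ^ t.card * (Real.exp (-Q) * ((Real.sqrt 2 ^ t.card)⁻¹ * z ^ (t \ b).card)))
      ≤ mt * (c ^ b.card * (x ^ (b \ t).card * Real.exp (-(G / (2 * σ ^ 2))))) := by
    have hE : ENNReal.ofReal mk * (ENNReal.ofReal c ^ t.card * (eexp (-Q) *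
          (ENNReal.ofReal ((Real.sqrt 2 ^ t.card)⁻¹) * ENNReal.ofReal z ^ (t \ b).card)))
        ≤ ENNReal.ofReal mt * (ENNReal.ofReal c ^ b.card * (ENNReal.ofReal x ^ (b \ t).card
          * eexp (-(G / (2 * σ ^ 2))))) := by
      calc _ ≤ (Z * (ENNReal.ofReal c ^ b.card * ((g * ENNReal.ofReal x ^ (b \ t).card)
            * eexp (-(G / (2 * σ ^ 2)))))) * (ENNReal.ofReal c ^ t.card * (eexp (-Q) *
            (ENNReal.ofReal ((Real.sqrt 2 ^ t.card)⁻¹) * ENNReal.ofReal z ^ (t \ b).card))) := by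
            gcongr
        _ = (Z * (ENNReal.ofReal c ^ t.card * (eexp (-Q) * (ENNReal.ofReal ((Real.sqrt 2 ^ t.card)⁻¹)
            * (g * ENNReal.ofReal z ^ (t \ b).card))))) * (ENNReal.ofReal c ^ b.card *
            (ENNReal.ofReal x ^ (b \ t).card * eexp (-(G / (2 * σ ^ 2))))) := by ring
        _ ≤ _ := by gcongr
    simp only [eexp] at hE
    rw [← ENNReal.ofReal_pow hc0.le, ← ENNReal.ofReal_pow hc0.le, ← ENNReal.ofReal_pow hx0.le,
      ← ENNReal.ofReal_pow hz0.le, ← ENNReal.ofReal_mul (by positivity),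
      ← ENNReal.ofReal_mul (by positivity), ← ENNReal.ofReal_mul (by positivity),
      ← ENNReal.ofReal_mul (hnn k), ← ENNReal.ofReal_mul (by positivity),
      ← ENNReal.ofReal_mul (by positivity), ← ENNReal.ofReal_mul (hnn t)] at hE
    exact (ENNReal.ofReal_le_ofReal_iff (mul_nonneg (hnn t) (by positivity))).1 hE
  have hratio : mk / mt ≤ Real.sqrt 2 ^ t.card * Real.exp (Q - G / (2 * σ ^ 2))
      * (c * x) ^ (b \ t).card / (c * z) ^ (t \ b).card := by
    have hbc : b.card = (b ∩ t).card + (b \ t).card := (Finset.card_inter_add_card_sdiff b t).symm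
    have htc : t.card = (b ∩ t).card + (t \ b).card := by
      rw [Finset.inter_comm]; exact (Finset.card_inter_add_card_sdiff t b).symm
    rw [div_le_div_iff₀ (hpos t) (by positivity)]
    have e1 : Real.exp (Q - G / (2 * σ ^ 2)) = Real.exp (-(G / (2 * σ ^ 2))) * Real.exp Q := by
      rw [← Real.exp_add]; ring_nf
    have e2 : Real.exp (-Q) * Real.exp Q = 1 := by rw [← Real.exp_add]; simp
    have e3 : (Real.sqrt 2 ^ t.card)⁻¹ * Real.sqrt 2 ^ t.card = 1 :=
      inv_mul_cancel₀ (by positivity)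
    have e4 : c ^ (b ∩ t).card ≠ 0 := by positivity
    have h1 := mul_le_mul_of_nonneg_right hmain
      (show 0 ≤ Real.exp Q * Real.sqrt 2 ^ t.card by positivity)
    have l1 : mk * (c ^ t.card * (Real.exp (-Q) * ((Real.sqrt 2 ^ t.card)⁻¹ * z ^ (t \ b).card)))
        * (Real.exp Q * Real.sqrt 2 ^ t.card)
        = c ^ (b ∩ t).card * (mk * (c * z) ^ (t \ b).card) := by
      calc _ = mk * (c ^ t.card * z ^ (t \ b).card) * (Real.exp (-Q) * Real.exp Q)
            * ((Real.sqrt 2 ^ t.card)⁻¹ * Real.sqrt 2 ^ t.card) := by ring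
        _ = _ := by
          rw [e2, e3, mul_pow, show c ^ t.card = c ^ (b ∩ t).card * c ^ (t \ b).card by
            rw [← pow_add, ← htc]]
          ring
    have l2 : mt * (c ^ b.card * (x ^ (b \ t).card * Real.exp (-(G / (2 * σ ^ 2)))))
        * (Real.exp Q * Real.sqrt 2 ^ t.card)
        = c ^ (b ∩ t).card * (Real.sqrt 2 ^ t.card * Real.exp (Q - G / (2 * σ ^ 2))
          * (c * x) ^ (b \ t).card * mt) := by
      rw [e1, mul_pow, show c ^ b.card = c ^ (b ∩ t).card * c ^ (b \ t).card by
            rw [← pow_add, ← hbc]]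
      ring
    rw [l1, l2] at h1
    exact le_of_mul_le_mul_left h1 (by positivity)
  have hcx : c * x = Real.sqrt ((1 + η) / (s * Λ)) := by
    rw [hc, hx, ← Real.sqrt_inv, ← Real.sqrt_mul (by positivity)]
    congr 1
    rw [hΛA, hw]; field_simp
  have hcz : (c * z)⁻¹ = Real.sqrt (s * M) := by
    rw [hc, hz, ← Real.sqrt_inv, ← Real.sqrt_mul (by positivity), ← Real.sqrt_inv]
    congr 1
    rw [hMA, hw]; field_simp
  have hQ' : Q - G / (2 * σ ^ 2) = (∑ j ∈ t, β j ^ 2) / (2 * w)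
      + (‖shrink X τ₀ (WithLp.toLp 2 y - partialMean X β t)‖ ^ 2 - G) / (2 * σ ^ 2) := by
    have e1 : ∑ i, (restrictTo t β) i ^ 2 = ∑ j ∈ t, β j ^ 2 := by
      have : ∀ i, (restrictTo t β) i ^ 2 = if i ∈ t then β i ^ 2 else 0 := by
        intro i; unfold restrictTo; split_ifs <;> simp
      simp_rw [this]
      rw [Finset.sum_ite_mem, Finset.univ_inter]
    rw [hQ, e1, hvA, normSq_smul_inv]
    change _ + ‖shrink X τ₀ (WithLp.toLp 2 y - partialMean X β t)‖ ^ 2 / _ - _ = _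
    ring
  -- the normalizing constant of the posterior is not zero, so it cancels in the ratio
  have hsum : (∑ l : Finset (Fin p), modelPrior q l * marginal X σ τ₀ τ₁ l y) ≠ 0 := by
    refine (Finset.sum_pos (fun l _ => mul_pos ?_ (hpos l)) Finset.univ_nonempty).ne'
    exact Finset.prod_pos fun j _ => by split_ifs <;> linarith
  have hq' : 0 < q / (1 - q) := div_pos hq0 (by linarith)
  have hq1' : 0 < 1 - q := by linarith
  rw [posteriorRatio, posterior, posterior, div_div_div_cancel_right₀ hsum, modelPrior_eq hq1,
    modelPrior_eq hq1, mul_div_mul_comm, mul_div_mul_left _ _ (by positivity)]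
  refine mul_le_mul_of_nonneg_left (hratio.trans_eq ?_) (by positivity)
  rw [hQ', Real.exp_add, hcx, div_eq_mul_inv, ← inv_pow, hcz]
  ring

end

/-! ### Exponential moments of the noise -/

section

variable {n : ℕ}

lemma lintegral_exp_inner (m : Fin n → ℝ) {σ : ℝ} (hσ : 0 < σ) (u : EuclideanSpace ℝ (Fin n)) :
    ∫⁻ y, eexp (inner ℝ u (WithLp.toLp 2 (y - m)))
        ∂Measure.pi (fun i => gaussianReal (m i) (σ ^ 2).toNNReal)
      = eexp (σ ^ 2 * ‖u‖ ^ 2 / 2) := by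
  have h := lintegral_exp_quadratic_pi m (v := σ ^ 2) (θ := 0) (by positivity) (by norm_num) u
  have e : ∀ y : Fin n → ℝ, ∑ i, (0 * (y i - m i) ^ 2 / (2 * σ ^ 2) + u i * (y i - m i))
      = inner ℝ u (WithLp.toLp 2 (y - m)) := by
    intro y
    rw [PiLp.inner_apply]
    refine Finset.sum_congr rfl fun i _ => ?_
    simp [mul_comm]
  simp_rw [e] at h
  rw [h, EuclideanSpace.norm_sq_eq]
  simp

variable {E : Type*} [NormedAddCommGroup E] [InnerProductSpace ℝ E]

lemma continuous_map_sub (B : EuclideanSpace ℝ (Fin n) →ₗ[ℝ] E) (m : Fin n → ℝ) :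
    Continuous fun y : Fin n → ℝ => B (WithLp.toLp 2 (y - m)) := by
  have h1 : Continuous B := LinearMap.continuous_of_finiteDimensional _
  have h2 : Continuous fun y : Fin n → ℝ => WithLp.toLp 2 (y - m) :=
    (PiLp.continuous_toLp 2 _).comp (by fun_prop)
  exact h1.comp h2

variable [FiniteDimensional ℝ E]

lemma lintegral_exp_inner_le (m : Fin n → ℝ) {σ : ℝ} (hσ : 0 < σ)
    (B : EuclideanSpace ℝ (Fin n) →ₗ[ℝ] E) (hB : ∀ x, ‖B x‖ ≤ ‖x‖) (u : E) :
    ∫⁻ y, eexp (inner ℝ u (B (WithLp.toLp 2 (y - m))))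
        ∂Measure.pi (fun i => gaussianReal (m i) (σ ^ 2).toNNReal)
      ≤ eexp (σ ^ 2 * ‖u‖ ^ 2 / 2) := by
  have h1 : ∀ x, inner ℝ u (B x) = inner ℝ (LinearMap.adjoint B u) x := fun x =>
    (LinearMap.adjoint_inner_left B x u).symm
  simp_rw [h1]
  rw [lintegral_exp_inner m hσ]
  have h2 : ‖LinearMap.adjoint B u‖ ≤ ‖u‖ := by
    have h3 : ‖LinearMap.adjoint B u‖ ^ 2 ≤ ‖u‖ * ‖LinearMap.adjoint B u‖ := by
      rw [← real_inner_self_eq_norm_sq, ← h1]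
      exact (real_inner_le_norm _ _).trans (by gcongr; exact hB _)
    rcases (norm_nonneg (LinearMap.adjoint B u)).eq_or_lt with h0 | h0
    · rw [← h0]; exact norm_nonneg u
    · rw [sq] at h3
      exact le_of_mul_le_mul_right h3 h0
  exact eexp_mono (by gcongr)

/-- Exponential moment of a projected Gaussian noise, together with a linear term. The square is
linearized by an independent standard Gaussian vector on `K`, which reduces the claim to the linear
case; there a contraction `B` does no harm. -/
lemma lintegral_exp_proj_le (m : Fin n → ℝ) {σ θ : ℝ} (hσ : 0 < σ) (hθ0 : 0 ≤ θ) (hθ1 : θ < 1)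
    (B : EuclideanSpace ℝ (Fin n) →ₗ[ℝ] E) (hB : ∀ x, ‖B x‖ ≤ ‖x‖) (K : Submodule ℝ E) (h : E) :
    ∫⁻ y, eexp (θ / (2 * σ ^ 2) * (‖K.starProjection (B (WithLp.toLp 2 (y - m)))‖ ^ 2
          - 2 * inner ℝ h (B (WithLp.toLp 2 (y - m)))))
        ∂Measure.pi (fun i => gaussianReal (m i) (σ ^ 2).toNNReal)
      ≤ ENNReal.ofReal (Real.sqrt (1 - θ))⁻¹ ^ Module.finrank ℝ K
        * eexp (θ ^ 2 / (2 * σ ^ 2) * (‖h‖ ^ 2 + θ / (1 - θ) * ‖K.starProjection h‖ ^ 2)) := by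
  set d := Module.finrank ℝ K
  set e := stdOrthonormalBasis ℝ K
  have hnorm : ∀ x : E, ‖K.starProjection x‖ ^ 2 = ∑ i, inner ℝ (e i : E) x ^ 2 := by
    intro x
    have h1 := e.sum_sq_norm_inner_right (K.orthogonalProjectionOnto x)
    rw [Submodule.starProjection_apply]
    refine (h1.symm.trans ?_)
    refine Finset.sum_congr rfl fun i _ => ?_
    rw [Real.norm_eq_abs, sq_abs, Submodule.inner_orthogonalProjectionOnto_eq_of_mem_left]
  set P := Measure.pi (fun i => gaussianReal (m i) (σ ^ 2).toNNReal)
  set γ := Measure.pi (fun _ : Fin d => gaussianReal 0 (1 : ℝ).toNNReal)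
  set N : (Fin n → ℝ) → E := fun y => B (WithLp.toLp 2 (y - m)) with hN
  have hNc : Continuous N := continuous_map_sub B m
  set r := Real.sqrt θ / σ with hr
  have hr2 : r ^ 2 = θ / σ ^ 2 := by rw [hr, div_pow, Real.sq_sqrt hθ0]
  set u : (Fin d → ℝ) → E := fun g => r • (∑ i, g i • (e i : E)) - (θ / σ ^ 2) • h with hu
  have huc : Continuous u := by fun_prop
  -- `g` is the auxiliary standard Gaussian vector, in coordinates on `K`
  have hlin : ∀ y, eexp (θ / (2 * σ ^ 2) * (‖K.starProjection (N y)‖ ^ 2 - 2 * inner ℝ h (N y)))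
      = ∫⁻ g, eexp (inner ℝ (u g) (N y)) ∂γ := by
    intro y
    have h1 := lintegral_exp_quadratic_pi (fun _ : Fin d => (0 : ℝ)) (v := 1) (θ := 0) one_pos
      (by norm_num) (fun i => r * inner ℝ (e i : E) (N y))
    have h2 : ∀ g : Fin d → ℝ, inner ℝ (u g) (N y)
        = ∑ i, (0 * (g i - 0) ^ 2 / (2 * 1) + r * inner ℝ (e i : E) (N y) * (g i - 0))
          + -(θ / σ ^ 2 * inner ℝ h (N y)) := by
      intro g
      simp only [hu, inner_sub_left, inner_smul_left, sum_inner, Finset.mul_sum]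
      simp only [conj_trivial, zero_mul, zero_div, zero_add, sub_zero]
      rw [sub_eq_add_neg]
      congr 1
      exact Finset.sum_congr rfl fun i _ => by ring
    simp_rw [h2, eexp_add]
    rw [lintegral_mul_const _ (measurable_eexp_comp (by fun_prop)), h1, hnorm, sub_zero,
      Real.sqrt_one, inv_one, ENNReal.ofReal_one, one_pow, one_mul, ← eexp_add]
    congr 1
    simp_rw [mul_pow, ← Finset.mul_sum, hr2]
    field_simp
    ring
  have hexp : ∀ g, σ ^ 2 * ‖u g‖ ^ 2 / 2
      = ∑ i, (θ * (g i - 0) ^ 2 / (2 * 1) + -(θ * r) * inner ℝ (e i : E) h * (g i - 0))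
        + θ ^ 2 / (2 * σ ^ 2) * ‖h‖ ^ 2 := by
    intro g
    have h1 : ‖∑ i, g i • (e i : E)‖ ^ 2 = ∑ i, g i ^ 2 := by
      have h2 := e.orthonormal.comp_linearIsometry K.subtypeₗᵢ
      rw [← real_inner_self_eq_norm_sq]
      have h3 := h2.inner_sum g g Finset.univ
      refine h3.trans ?_
      exact Finset.sum_congr rfl fun i _ => by simp [sq]
    have h2 : inner ℝ (∑ i, g i • (e i : E)) h = ∑ i, g i * inner ℝ (e i : E) h := by
      simp only [sum_inner, inner_smul_left, conj_trivial]
    simp only [hu]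
    rw [norm_sub_sq_real, norm_smul, norm_smul, mul_pow, mul_pow, h1, Real.norm_eq_abs,
      Real.norm_eq_abs, sq_abs, sq_abs, inner_smul_left, inner_smul_right, h2, hr2]
    simp only [conj_trivial, Finset.sum_add_distrib, sub_zero]
    have h4 : ∑ i, θ * g i ^ 2 / (2 * 1) = θ / 2 * ∑ i, g i ^ 2 := by
      rw [Finset.mul_sum]; exact Finset.sum_congr rfl fun i _ => by ring
    have h5 : ∑ i, -(θ * r) * inner ℝ (e i : E) h * g i
        = -(θ * r) * ∑ i, g i * inner ℝ (e i : E) h := by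
      rw [Finset.mul_sum]; exact Finset.sum_congr rfl fun i _ => by ring
    rw [h4, h5]
    field_simp
    ring
  calc _ = ∫⁻ y, ∫⁻ g, eexp (inner ℝ (u g) (N y)) ∂γ ∂P := lintegral_congr hlin
    _ = ∫⁻ g, ∫⁻ y, eexp (inner ℝ (u g) (N y)) ∂P ∂γ := by
        refine lintegral_lintegral_swap (Measurable.aemeasurable ?_)
        exact measurable_eexp_comp (Continuous.measurable (by
          exact (huc.comp continuous_snd).inner (hNc.comp continuous_fst)))
    _ ≤ ∫⁻ g, eexp (σ ^ 2 * ‖u g‖ ^ 2 / 2) ∂γ :=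
        lintegral_mono fun g => lintegral_exp_inner_le m hσ B hB (u g)
    _ = _ := by
        simp_rw [hexp, eexp_add]
        rw [lintegral_mul_const _ (measurable_eexp_comp (by fun_prop)),
          lintegral_exp_quadratic_pi (fun _ : Fin d => (0 : ℝ)) one_pos hθ1, Fintype.card_fin,
          mul_assoc, ← eexp_add, hnorm]
        congr 2
        simp_rw [mul_pow, ← Finset.mul_sum, neg_sq, mul_pow, hr2]
        have : 1 - θ ≠ 0 := by linarith
        field_simp
        ring

/-- Exponential moment of the squared norm of the noise. -/
lemma lintegral_exp_norm_sq (m : Fin n → ℝ) {σ θ : ℝ} (hσ : 0 < σ) (hθ1 : θ < 1) :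
    ∫⁻ y, eexp (θ / (2 * σ ^ 2) * ‖(WithLp.toLp 2 (y - m) : EuclideanSpace ℝ (Fin n))‖ ^ 2)
        ∂Measure.pi (fun i => gaussianReal (m i) (σ ^ 2).toNNReal)
      = ENNReal.ofReal (Real.sqrt (1 - θ))⁻¹ ^ n := by
  have h := lintegral_exp_quadratic_pi m (v := σ ^ 2) (by positivity) hθ1 (fun _ => 0)
  have e : ∀ y : Fin n → ℝ, ∑ i, (θ * (y i - m i) ^ 2 / (2 * σ ^ 2) + 0 * (y i - m i))
      = θ / (2 * σ ^ 2) * ‖(WithLp.toLp 2 (y - m) : EuclideanSpace ℝ (Fin n))‖ ^ 2 := by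
    intro y
    rw [EuclideanSpace.norm_sq_eq, Finset.mul_sum]
    refine Finset.sum_congr rfl fun i _ => ?_
    simp
    ring
  simp_rw [e] at h
  rw [h]
  simp [eexp_zero]

end

/-! ### Tail bounds -/

lemma rpow_sum_le {ι : Type*} (S : Finset ι) (f : ι → ℝ≥0∞) {θ : ℝ} (h0 : 0 < θ) (h1 : θ ≤ 1) :
    (∑ i ∈ S, f i) ^ θ ≤ ∑ i ∈ S, f i ^ θ := by
  classical
  induction S using Finset.induction_on with
  | empty => simp [h0]
  | insert a S ha ih =>
    rw [Finset.sum_insert ha, Finset.sum_insert ha]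
    exact (ENNReal.rpow_add_le_add_rpow _ _ h0.le h1).trans (by gcongr)

/-- Markov's inequality for the moment of order `θ ≤ 1` of a sum of exponentials. -/
lemma measure_lt_sum_exp_le {Ω ι : Type*} [MeasurableSpace Ω] (P : Measure Ω) (S : Finset ι)
    {W : ι → ℝ} (hW : ∀ i ∈ S, 0 ≤ W i) {Y : ι → Ω → ℝ} (hY : ∀ i ∈ S, Measurable (Y i))
    {θ lam : ℝ} (h0 : 0 < θ) (h1 : θ ≤ 1) (hlam : 0 < lam) {R : ι → ℝ} (hR : ∀ i ∈ S, 0 ≤ R i)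
    (hint : ∀ i ∈ S, ∫⁻ ω, eexp (θ * Y i ω) ∂P ≤ ENNReal.ofReal (R i)) :
    P {ω | lam < ∑ i ∈ S, W i * Real.exp (Y i ω)}
      ≤ ENNReal.ofReal (lam ^ (-θ) * ∑ i ∈ S, W i ^ θ * R i) := by
  have hsub : {ω | lam < ∑ i ∈ S, W i * Real.exp (Y i ω)}
      ⊆ {ω | ENNReal.ofReal (lam ^ θ) ≤ ∑ i ∈ S, ENNReal.ofReal (W i ^ θ) * eexp (θ * Y i ω)} := by
    intro ω hω
    simp only [Set.mem_ofPred_eq] at hω ⊢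
    rw [← ENNReal.ofReal_rpow_of_nonneg hlam.le h0.le]
    calc ENNReal.ofReal lam ^ θ ≤ (∑ i ∈ S, ENNReal.ofReal (W i * Real.exp (Y i ω))) ^ θ := by
          rw [← ENNReal.ofReal_sum_of_nonneg fun i hi => mul_nonneg (hW i hi) (Real.exp_pos _).le]
          gcongr
      _ ≤ ∑ i ∈ S, ENNReal.ofReal (W i * Real.exp (Y i ω)) ^ θ := rpow_sum_le S _ h0 h1
      _ = _ := by
          refine Finset.sum_congr rfl fun i hi => ?_
          rw [ENNReal.ofReal_mul (hW i hi), ENNReal.mul_rpow_of_nonneg _ _ h0.le,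
            ENNReal.ofReal_rpow_of_nonneg (hW i hi) h0.le,
            ENNReal.ofReal_rpow_of_nonneg (Real.exp_pos _).le h0.le, ← Real.exp_mul, mul_comm θ]
          rfl
  have hpos : 0 < lam ^ θ := Real.rpow_pos_of_pos hlam _
  refine (measure_mono hsub).trans ?_
  refine (meas_ge_le_lintegral_div (Measurable.aemeasurable ?_) ?_ ENNReal.ofReal_ne_top).trans ?_
  · exact Finset.measurable_sum _ fun i hi =>
      (measurable_eexp_comp ((hY i hi).const_mul θ)).const_mul _
  · exact (ENNReal.ofReal_pos.2 hpos).ne'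
  rw [lintegral_finsetSum _ fun i hi =>
    (measurable_eexp_comp ((hY i hi).const_mul θ)).const_mul _]
  rw [ENNReal.div_le_iff (ENNReal.ofReal_pos.2 hpos).ne' ENNReal.ofReal_ne_top,
    ← ENNReal.ofReal_mul (mul_nonneg (Real.rpow_nonneg hlam.le _) (Finset.sum_nonneg fun i hi =>
      mul_nonneg (Real.rpow_nonneg (hW i hi) _) (hR i hi)))]
  rw [mul_right_comm, ← Real.rpow_add hlam, neg_add_cancel, Real.rpow_zero, one_mul,
    ENNReal.ofReal_sum_of_nonneg fun i hi =>
      mul_nonneg (Real.rpow_nonneg (hW i hi) _) (hR i hi)]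
  refine Finset.sum_le_sum fun i hi => ?_
  rw [lintegral_const_mul _ (measurable_eexp_comp ((hY i hi).const_mul θ)),
    ENNReal.ofReal_mul (Real.rpow_nonneg (hW i hi) _)]
  gcongr
  exact hint i hi

/-- A lower bound for the probability of a set which need not be measurable. -/
lemma one_sub_le_measureReal {Ω : Type*} [MeasurableSpace Ω] (P : Measure Ω)
    [IsProbabilityMeasure P] {A N : Set Ω} (h : ∀ ω, ω ∉ N → ω ∈ A) {r : ℝ} (hr : 0 ≤ r)
    (hN : P N ≤ ENNReal.ofReal r) : 1 - r ≤ P.real A := by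
  have h1 : (1 : ℝ≥0∞) ≤ P A + P N := by
    rw [← measure_univ (μ := P)]
    refine (measure_mono fun ω _ => ?_).trans (measure_union_le A N)
    by_cases hω : ω ∈ N
    · exact Or.inr hω
    · exact Or.inl (h ω hω)
  have h2 : (1 : ℝ≥0∞) ≤ P A + ENNReal.ofReal r := h1.trans (by gcongr)
  have h3 := ENNReal.toReal_mono (by finiteness) h2
  rw [ENNReal.toReal_add (measure_ne_top _ _) ENNReal.ofReal_ne_top, ENNReal.toReal_ofReal hr] at h3
  simp only [ENNReal.toReal_one] at h3
  rw [Measure.real]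
  linarith

/-! ### Eigenvalues of Gram matrices -/

section

variable {ι : Type} [Fintype ι] [DecidableEq ι]

lemma exists_eigenvector {A : Matrix ι ι ℝ} {x : ℝ} (hx : x ∈ eigenvalueSet A) :
    ∃ v : ι → ℝ, v ≠ 0 ∧ A *ᵥ v = x • v := by
  obtain ⟨v, hv⟩ := Module.End.HasEigenvalue.exists_hasEigenvector hx
  exact ⟨v, hv.2, by simpa using hv.apply_eq_smul⟩

lemma mem_eigenvalueSet {A : Matrix ι ι ℝ} {x : ℝ} {v : ι → ℝ} (hv : v ≠ 0)
    (h : A *ᵥ v = x • v) : x ∈ eigenvalueSet A :=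
  Module.End.hasEigenvalue_of_hasEigenvector
    ⟨Module.End.mem_eigenspace_iff.2 (by simpa using h), hv⟩

lemma dotProduct_self_pos {ι : Type} [Fintype ι] {v : ι → ℝ} (hv : v ≠ 0) : 0 < v ⬝ᵥ v :=
  lt_of_le_of_ne (Finset.sum_nonneg fun _ _ => mul_self_nonneg _)
    fun h => hv (dotProduct_self_eq_zero.1 h.symm)

lemma isHermitian_sub_smul_one {ι : Type} [DecidableEq ι] {A : Matrix ι ι ℝ} (hA : A.IsHermitian) (x : ℝ) :
    (A - x • (1 : Matrix ι ι ℝ)).IsHermitian := by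
  refine hA.sub ?_
  rw [Matrix.IsHermitian, Matrix.conjTranspose_smul, Matrix.conjTranspose_one]
  rfl

/-- A lower bound for the eigenvalues of a symmetric matrix bounds its quadratic form. -/
lemma le_quadratic_of_le_eigenvalues {A : Matrix ι ι ℝ} (hA : A.IsHermitian) {x : ℝ}
    (h : ∀ z ∈ eigenvalueSet A, x ≤ z) (v : ι → ℝ) : x * (v ⬝ᵥ v) ≤ v ⬝ᵥ A *ᵥ v := by
  have hA' := isHermitian_sub_smul_one hA x
  have hp : (A - x • (1 : Matrix ι ι ℝ)).PosSemidef := by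
    rw [hA'.posSemidef_iff_eigenvalues_nonneg]
    intro i
    have h1 := hA'.mulVec_eigenvectorBasis i
    have hne : (hA'.eigenvectorBasis i : EuclideanSpace ℝ ι).ofLp ≠ 0 := by
      intro h0
      have h2 := hA'.eigenvectorBasis.orthonormal.ne_zero i
      exact h2 (by ext j; simpa using congrFun h0 j)
    have h3 := h (hA'.eigenvalues i + x) (mem_eigenvalueSet hne (by
      rw [Matrix.sub_mulVec, Matrix.smul_mulVec, Matrix.one_mulVec] at h1
      rw [add_smul, ← h1]
      simp))
    simpa using h3
  have h1 := hp.dotProduct_mulVec_nonneg v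
  rw [Matrix.sub_mulVec, Matrix.smul_mulVec, Matrix.one_mulVec, dotProduct_sub, dotProduct_smul]
    at h1
  simpa using h1

lemma quadratic_le_maxEig {A : Matrix ι ι ℝ} (hA : A.IsHermitian) (v : ι → ℝ) :
    v ⬝ᵥ A *ᵥ v ≤ maxEig A * (v ⬝ᵥ v) := by
  have hbdd : BddAbove (eigenvalueSet A) :=
    (Module.End.finite_hasEigenvalue (Matrix.toLin' A)).bddAbove
  have h := le_quadratic_of_le_eigenvalues hA.neg (x := -maxEig A) (fun z hz => by
    obtain ⟨u, hu, hz⟩ := exists_eigenvector hz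
    have h1 : -z ∈ eigenvalueSet A := mem_eigenvalueSet hu (by
      rw [Matrix.neg_mulVec] at hz
      rw [neg_smul, ← hz, neg_neg])
    have := le_csSup hbdd h1
    unfold maxEig
    linarith) v
  rw [Matrix.neg_mulVec, dotProduct_neg] at h
  linarith

end

section

variable {n p : ℕ}

lemma norm_sq_designMap (X : Matrix (Fin n) (Fin p) ℝ) (c : Fin p → ℝ) :
    ‖designMap X c‖ ^ 2 = c ⬝ᵥ (Xᵀ * X) *ᵥ c := by
  rw [← Matrix.mulVec_mulVec, Matrix.dotProduct_mulVec, Matrix.vecMul_transpose, designMap_apply,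
    EuclideanSpace.norm_sq_eq]
  simp [dotProduct, sq]

lemma subDesign_mulVec (X : Matrix (Fin n) (Fin p) ℝ) (b : Finset (Fin p)) (z : b → ℝ) :
    subDesign X b *ᵥ z = X *ᵥ zeroExtend b z := by
  ext i
  simp only [subDesign, Matrix.mulVec, dotProduct, Matrix.submatrix_apply, id]
  rw [← Finset.sum_subset (Finset.subset_univ b) fun j _ hj => by
    rw [zeroExtend_apply_notMem b z hj, mul_zero]]
  rw [← Finset.sum_coe_sort b]
  exact Finset.sum_congr rfl fun j _ => by rw [zeroExtend_apply_mem b z j.2]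

lemma dotProduct_gram (X : Matrix (Fin n) (Fin p) ℝ) (b : Finset (Fin p)) (z : b → ℝ) :
    z ⬝ᵥ gram X b *ᵥ z = (n : ℝ)⁻¹ * ‖designMap X (zeroExtend b z)‖ ^ 2 := by
  rw [gram, Matrix.smul_mulVec, dotProduct_smul, smul_eq_mul, ← Matrix.mulVec_mulVec,
    Matrix.dotProduct_mulVec, Matrix.vecMul_transpose, subDesign_mulVec, designMap_apply,
    EuclideanSpace.norm_sq_eq]
  simp [dotProduct, sq]

lemma isHermitian_gram (X : Matrix (Fin n) (Fin p) ℝ) (b : Finset (Fin p)) :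
    (gram X b).IsHermitian := by
  rw [gram, Matrix.IsHermitian, Matrix.conjTranspose_smul, Matrix.conjTranspose_eq_transpose_of_trivial,
    Matrix.transpose_mul, Matrix.transpose_transpose]
  rfl

lemma gram_eigenvalue_nonneg (X : Matrix (Fin n) (Fin p) ℝ) (b : Finset (Fin p)) {x : ℝ}
    (hx : x ∈ eigenvalueSet (gram X b)) : 0 ≤ x := by
  obtain ⟨v, hv, h⟩ := exists_eigenvector hx
  have h1 := dotProduct_gram X b v
  rw [h, dotProduct_smul, smul_eq_mul] at h1
  have h2 : 0 ≤ x * (v ⬝ᵥ v) := by rw [h1]; positivity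
  exact nonneg_of_mul_nonneg_left h2 (dotProduct_self_pos hv)

/-- The covariates in `b` are linearly independent. -/
def Indep (X : Matrix (Fin n) (Fin p) ℝ) (b : Finset (Fin p)) : Prop :=
  ∀ c : Fin p → ℝ, (∀ i ∉ b, c i = 0) → designMap X c = 0 → c = 0

lemma Indep.mono {X : Matrix (Fin n) (Fin p) ℝ} {a b : Finset (Fin p)} (h : Indep X b)
    (hab : a ⊆ b) : Indep X a :=
  fun c hc => h c fun i hi => hc i fun hia => hi (hab hia)

lemma Indep.lambdaMin_mul_le {X : Matrix (Fin n) (Fin p) ℝ} {ν : ℝ} (hn : 0 < n)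
    {b : Finset (Fin p)} (hb : Indep X b) (hcard : (b.card : ℝ) ≤ sizeBound n p ν)
    (c : Fin p → ℝ) (hc : ∀ i ∉ b, c i = 0) :
    n * lambdaMin X ν * ∑ i, c i ^ 2 ≤ ‖designMap X c‖ ^ 2 := by
  have hn' : (0 : ℝ) < n := by exact_mod_cast hn
  rcases b.eq_empty_or_nonempty with rfl | hne
  · have : c = 0 := funext fun i => hc i (by simp)
    simp [this]
  have hbdd : BddBelow {x | ∃ k : Finset (Fin p), k.Nonempty ∧ (k.card : ℝ) ≤ sizeBound n p ν ∧
      x = minNonzeroEig (gram X k)} := by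
    refine ⟨0, ?_⟩
    rintro x ⟨k, -, -, rfl⟩
    exact Real.sInf_nonneg fun y hy => gram_eigenvalue_nonneg X k hy.1
  have h1 : lambdaMin X ν ≤ minNonzeroEig (gram X b) := csInf_le hbdd ⟨b, hne, hcard, rfl⟩
  have h2 := le_quadratic_of_le_eigenvalues (isHermitian_gram X b) (x := lambdaMin X ν)
    (fun z hz => h1.trans (csInf_le ⟨0, fun y hy => gram_eigenvalue_nonneg X b hy.1⟩ ⟨hz, by
      rintro rfl
      obtain ⟨v, hv, h⟩ := exists_eigenvector hz
      have h3 := dotProduct_gram X b v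
      rw [h, zero_smul, dotProduct_zero, eq_comm, mul_eq_zero] at h3
      have h4 : designMap X (zeroExtend b v) = 0 := by
        rcases h3 with h3 | h3
        · exact absurd h3 (inv_ne_zero hn'.ne')
        · exact norm_eq_zero.1 (pow_eq_zero_iff two_ne_zero |>.1 h3)
      have h5 := hb _ (fun i hi => zeroExtend_apply_notMem b v hi) h4
      refine hv (funext fun i => ?_)
      have := congrFun h5 i
      rwa [zeroExtend_apply_mem b v i.2] at this⟩)) (fun i => c i)
  rw [dotProduct_gram, zeroExtend_restrict b hc] at h2
  have h3 : (fun i : b => c i) ⬝ᵥ (fun i : b => c i) = ∑ i, c i ^ 2 := by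
    have := sum_zeroExtend_sq b (fun i => c i)
    rw [zeroExtend_restrict b hc] at this
    rw [this]
    simp [dotProduct, sq]
  rw [h3] at h2
  calc _ = n * (lambdaMin X ν * ∑ i, c i ^ 2) := by ring
    _ ≤ n * ((n : ℝ)⁻¹ * ‖designMap X c‖ ^ 2) := by gcongr
    _ = _ := by field_simp

lemma norm_sq_designMap_le_lambdaMax (X : Matrix (Fin n) (Fin p) ℝ) (hn : 0 < n) (c : Fin p → ℝ) :
    ‖designMap X c‖ ^ 2 ≤ n * lambdaMax X * ∑ i, c i ^ 2 := by
  have hn' : (0 : ℝ) < n := by exact_mod_cast hn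
  have hH : ((n : ℝ)⁻¹ • (Xᵀ * X)).IsHermitian := by
    rw [Matrix.IsHermitian, Matrix.conjTranspose_smul, Matrix.conjTranspose_eq_transpose_of_trivial,
      Matrix.transpose_mul, Matrix.transpose_transpose]
    rfl
  have h := quadratic_le_maxEig hH c
  rw [Matrix.smul_mulVec, dotProduct_smul, smul_eq_mul, ← norm_sq_designMap] at h
  have h3 : c ⬝ᵥ c = ∑ i, c i ^ 2 := by simp [dotProduct, sq]
  rw [h3] at h
  calc _ = n * ((n : ℝ)⁻¹ * ‖designMap X c‖ ^ 2) := by field_simp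
    _ ≤ n * (lambdaMax X * ∑ i, c i ^ 2) := by unfold lambdaMax; gcongr
    _ = _ := by ring

lemma norm_sq_column_le (X : Matrix (Fin n) (Fin p) ℝ) (hn : 0 < n) {t : Finset (Fin p)}
    {j : Fin p} (hj : j ∈ t) : ‖designMap X (Pi.single j 1)‖ ^ 2 ≤ n * maxEig (gram X t) := by
  have hn' : (0 : ℝ) < n := by exact_mod_cast hn
  have h := quadratic_le_maxEig (isHermitian_gram X t) (Pi.single ⟨j, hj⟩ 1)
  have h1 : zeroExtend t (Pi.single ⟨j, hj⟩ 1) = Pi.single j 1 := by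
    ext i
    by_cases hi : i ∈ t
    · rw [zeroExtend_apply_mem t _ hi]
      simp [Pi.single_apply]
    · rw [zeroExtend_apply_notMem t _ hi, Pi.single_eq_of_ne]
      rintro rfl; exact hi hj
  rw [dotProduct_gram, h1] at h
  simp only [dotProduct_single, Pi.single_eq_same, mul_one] at h
  calc _ = n * ((n : ℝ)⁻¹ * ‖designMap X (Pi.single j 1)‖ ^ 2) := by field_simp
    _ ≤ _ := by gcongr

/-! ### Bases of models -/

lemma imageOn_mono {ι E : Type*} [DecidableEq ι] [NormedAddCommGroup E] [InnerProductSpace ℝ E]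
    (A : (ι → ℝ) →ₗ[ℝ] E) {s u : Finset ι} (h : s ⊆ u) : imageOn A s ≤ imageOn A u := by
  intro v hv
  obtain ⟨c, hc, rfl⟩ := exists_of_mem_imageOn hv
  exact apply_mem_imageOn A fun i hi => hc i fun his => hi (h his)

lemma imageOn_le_of_single {ι E : Type*} [Fintype ι] [DecidableEq ι] [NormedAddCommGroup E]
    [InnerProductSpace ℝ E] (A : (ι → ℝ) →ₗ[ℝ] E) {s : Finset ι} {V : Submodule ℝ E}
    (h : ∀ j ∈ s, A (Pi.single j 1) ∈ V) : imageOn A s ≤ V := by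
  intro v hv
  obtain ⟨c, hc, rfl⟩ := exists_of_mem_imageOn hv
  have h1 : c = ∑ j, c j • (Pi.single j 1 : ι → ℝ) := pi_eq_sum_univ' c
  rw [h1, map_sum]
  refine Submodule.sum_mem _ fun j _ => ?_
  rw [map_smul]
  by_cases hj : j ∈ s
  · exact Submodule.smul_mem _ _ (h j hj)
  · rw [hc j hj, zero_smul]; exact Submodule.zero_mem _

lemma designMap_single (X : Matrix (Fin n) (Fin p) ℝ) (j : Fin p) :
    designMap X (Pi.single j 1) = WithLp.toLp 2 (fun i => X i j) := by
  rw [designMap_apply, Matrix.mulVec_single_one]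
  rfl

lemma colSpace_eq_imageOn (X : Matrix (Fin n) (Fin p) ℝ) (k : Finset (Fin p)) :
    colSpace X k = imageOn (designMap X) k := by
  refine le_antisymm (Submodule.span_le.2 ?_) (imageOn_le_of_single _ fun j hj => ?_)
  · rintro _ ⟨j, hj, rfl⟩
    have : designMap X (Pi.single j 1) ∈ imageOn (designMap X) k :=
      apply_mem_imageOn _ fun i hi => Pi.single_eq_of_ne (by rintro rfl; exact hi hj) _
    rwa [designMap_single] at this
  · rw [designMap_single]
    exact Submodule.subset_span ⟨j, hj, rfl⟩

lemma modelRank_eq_finrank (X : Matrix (Fin n) (Fin p) ℝ) (k : Finset (Fin p)) :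
    modelRank X k = Module.finrank ℝ (imageOn (designMap X) k) := by
  have h : LinearMap.range (subDesign X k).mulVecLin
      = (imageOn (designMap X) k).map (WithLp.linearEquiv 2 ℝ (Fin n → ℝ)).toLinearMap := by
    rw [imageOn, ← LinearMap.range_comp]
    congr 1
    exact LinearMap.ext fun z => subDesign_mulVec X k z
  rw [modelRank, Matrix.rank, h, LinearEquiv.finrank_map_eq]

lemma Indep.finrank_eq {X : Matrix (Fin n) (Fin p) ℝ} {b : Finset (Fin p)} (h : Indep X b) :
    Module.finrank ℝ (imageOn (designMap X) b) = b.card := by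
  unfold imageOn
  rw [LinearMap.finrank_range_of_inj]
  · simp
  · rw [injective_iff_map_eq_zero]
    intro z hz
    have h1 := h _ (fun i hi => zeroExtend_apply_notMem b z hi) hz
    ext i
    have := congrFun h1 i
    rwa [zeroExtend_apply_mem b z i.2] at this

/-- Every set of linearly independent covariates of a model extends to a basis of the model. -/
lemma exists_basis {X : Matrix (Fin n) (Fin p) ℝ} {a k : Finset (Fin p)} (ha : Indep X a)
    (hak : a ⊆ k) : ∃ b, a ⊆ b ∧ b ⊆ k ∧ Indep X b ∧ b.card = modelRank X k ∧
      imageOn (designMap X) k = imageOn (designMap X) b := by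
  classical
  obtain ⟨b, hb, hmax⟩ := Finset.exists_max_image
    (Finset.univ.filter fun b => a ⊆ b ∧ b ⊆ k ∧ Indep X b) Finset.card ⟨a, by simp [ha, hak]⟩
  simp only [Finset.mem_filter, Finset.mem_univ, true_and] at hb hmax
  have himg : imageOn (designMap X) k = imageOn (designMap X) b := by
    refine le_antisymm (imageOn_le_of_single _ fun j hj => ?_) (imageOn_mono _ hb.2.1)
    by_cases hjb : j ∈ b
    · exact apply_mem_imageOn _ fun i hi => Pi.single_eq_of_ne (by rintro rfl; exact hi hjb) _
    have hni : ¬ Indep X (insert j b) := by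
      intro hi
      have := hmax (insert j b) ⟨hb.1.trans (Finset.subset_insert _ _),
        Finset.insert_subset hj hb.2.1, hi⟩
      rw [Finset.card_insert_of_notMem hjb] at this
      omega
    unfold Indep at hni
    push Not at hni
    obtain ⟨c, hc, hXc, hc0⟩ := hni
    have hcj : c j ≠ 0 := by
      intro h0
      refine hc0 (hb.2.2 c (fun i hi => ?_) hXc)
      by_cases hij : i = j
      · rw [hij, h0]
      · exact hc i (by simp [hij, hi])
    have h1 : designMap X (c - c j • Pi.single j 1) ∈ imageOn (designMap X) b := by
      refine apply_mem_imageOn _ fun i hi => ?_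
      by_cases hij : i = j
      · subst hij; simp
      · simp [hij, hc i (by simp [hij, hi])]
    have h2 : designMap X (Pi.single j 1)
        = (-(c j)⁻¹) • designMap X (c - c j • Pi.single j 1) := by
      rw [map_sub, hXc, map_smul, zero_sub, smul_neg, neg_smul, neg_neg, smul_smul,
        inv_mul_cancel₀ hcj, one_smul]
    rw [h2]
    exact Submodule.smul_mem _ _ h1
  refine ⟨b, hb.1, hb.2.1, hb.2.2, ?_, himg⟩
  rw [modelRank_eq_finrank, himg, hb.2.2.finrank_eq]

lemma modelRank_le (X : Matrix (Fin n) (Fin p) ℝ) (k : Finset (Fin p)) : modelRank X k ≤ p := by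
  rw [modelRank_eq_finrank]
  exact (finrank_imageOn_le _ _).trans (by simpa using Finset.card_le_univ k)

/-! ### Identifiability of the true model -/

/-- `separation` bounds the distance of `X_t β_t` to any vector in the span of few covariates. -/
lemma separation_le {X : Matrix (Fin n) (Fin p) ℝ} {β : Fin p → ℝ} {t k : Finset (Fin p)} {K : ℝ}
    (hk : (k.card : ℝ) ≤ K * t.card) (htk : ¬ t ⊆ k) {c : Fin p → ℝ} (hc : ∀ i ∉ k, c i = 0) :
    separation X β t K ≤ ENNReal.ofReal (‖partialMean X β t - designMap X c‖ ^ 2) := by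
  refine (iInf₂_le k ⟨hk, htk⟩).trans (ENNReal.ofReal_le_ofReal ?_)
  refine norm_sub_starProjection_le _ _ _ ?_
  rw [colSpace_eq_imageOn]
  exact apply_mem_imageOn _ hc

/-- If `X_t β_t` is at a positive distance from the models of size at most `K |t|` which miss a
covariate of `t`, then no covariate of `t` is a linear combination of the others and at most one
further covariate. -/
lemma indep_of_separation_pos {X : Matrix (Fin n) (Fin p) ℝ} {β : Fin p → ℝ} {t u : Finset (Fin p)}
    {K : ℝ} (hK : 1 ≤ K) (hsep : 0 < separation X β t K) (htu : t ⊆ u)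
    (hcard : u.card ≤ t.card + 1) (hcol : ∀ j, ∃ i, X i j ≠ 0) : Indep X u := by
  intro c hc hXc
  by_contra hc0
  by_cases h : ∃ i ∈ t, c i ≠ 0
  -- a relation which involves `i ∈ t` would put `X_t β_t` in the span of the covariates in `u \ {i}`
  · obtain ⟨i, hit, hci⟩ := h
    have hk : (((u.erase i).card : ℕ) : ℝ) ≤ K * t.card := by
      have h1 : (u.erase i).card ≤ t.card := by
        rw [Finset.card_erase_of_mem (htu hit)]; omega
      have h2 : ((u.erase i).card : ℝ) ≤ t.card := by exact_mod_cast h1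
      nlinarith [(Nat.cast_nonneg t.card : (0 : ℝ) ≤ t.card)]
    set b : Fin p → ℝ := fun j => if j ∈ t then β j else 0 with hb
    have h1 := separation_le (X := X) (β := β) hk (fun h => (Finset.notMem_erase i u) (h hit))
      (c := b - (b i / c i) • c) (fun j hj => by
        by_cases hji : j = i
        · subst hji; simp [hci]
        · have hju : j ∉ u := fun hju => hj (Finset.mem_erase.2 ⟨hji, hju⟩)
          have hjt : j ∉ t := fun hjt => hju (htu hjt)
          simp [hb, hjt, hc j hju])
    rw [map_sub, map_smul, hXc, smul_zero, sub_zero] at h1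
    have h2 : partialMean X β t = designMap X b := rfl
    rw [h2, sub_self] at h1
    simp only [norm_zero, ne_eq, OfNat.ofNat_ne_zero, not_false_eq_true, zero_pow,
      ENNReal.ofReal_zero] at h1
    exact absurd hsep (not_lt.2 h1)
  -- otherwise the relation says that the further covariate is identically zero
  · push Not at h
    obtain ⟨j, hj⟩ := Function.ne_iff.1 hc0
    simp only [Pi.zero_apply] at hj
    have hju : j ∈ u := by by_contra hju; exact hj (hc j hju)
    have hjt : j ∉ t := fun hjt => hj (h j hjt)
    have huj : u = insert j t := by
      refine (Finset.eq_of_subset_of_card_le (Finset.insert_subset hju htu) ?_).symm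
      rw [Finset.card_insert_of_notMem hjt]; exact hcard
    have h1 : c = c j • Pi.single j 1 := by
      ext i
      by_cases hij : i = j
      · subst hij; simp
      · rw [Pi.smul_apply, Pi.single_eq_of_ne hij, smul_zero]
        by_cases hit : i ∈ t
        · exact h i hit
        · exact hc i (by rw [huj]; simp [hij, hit])
    rw [h1, map_smul, smul_eq_zero, or_iff_right hj, designMap_single] at hXc
    obtain ⟨i, hi⟩ := hcol j
    exact hi (congrFun (congrArg WithLp.ofLp hXc) i)

end

/-! ### The excess of a model over the true model -/

section

variable {n p : ℕ}

lemma shrunkDesign_apply (X : Matrix (Fin n) (Fin p) ℝ) (τ : ℝ) (c : Fin p → ℝ) :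
    shrunkDesign X τ c = shrink X τ (designMap X c) := rfl

/-- The part of the shrunk mean of the response which is not explained by the covariates in `b`. -/
noncomputable def residMean (X : Matrix (Fin n) (Fin p) ℝ) (β : Fin p → ℝ) (τ : ℝ)
    (b : Finset (Fin p)) : Aug n p :=
  shrunkDesign X τ β - (imageOn (shrunkDesign X τ) b).starProjection (shrunkDesign X τ β)

/-- The residual sum of squares at the true coefficients of `t` minus the residual sum of squares of
the fit on `b`, both for shrunk responses. -/
noncomputable def excess (X : Matrix (Fin n) (Fin p) ℝ) (β : Fin p → ℝ) (t : Finset (Fin p)) (τ : ℝ)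
    (b : Finset (Fin p)) (y : Fin n → ℝ) : ℝ :=
  ‖shrink X τ (WithLp.toLp 2 y - partialMean X β t)‖ ^ 2
    - ‖shrink X τ (WithLp.toLp 2 y)
      - (imageOn (shrunkDesign X τ) b).starProjection (shrink X τ (WithLp.toLp 2 y))‖ ^ 2

lemma partialMean_add_compl (X : Matrix (Fin n) (Fin p) ℝ) (β : Fin p → ℝ) (t : Finset (Fin p)) :
    partialMean X β t + partialMean X β tᶜ = designMap X β := by
  change designMap X _ + designMap X _ = _
  rw [← map_add]
  congr 1
  ext j
  by_cases h : j ∈ t <;> simp [h]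

lemma toLp_sub_mean (X : Matrix (Fin n) (Fin p) ℝ) (β : Fin p → ℝ) (y : Fin n → ℝ) :
    (WithLp.toLp 2 (y - X *ᵥ β) : EuclideanSpace ℝ (Fin n)) = WithLp.toLp 2 y - designMap X β := rfl

lemma excess_eq (X : Matrix (Fin n) (Fin p) ℝ) (β : Fin p → ℝ) (t : Finset (Fin p)) (τ : ℝ)
    (b : Finset (Fin p)) (y : Fin n → ℝ) :
    excess X β t τ b y
      = (‖(imageOn (shrunkDesign X τ) b).starProjection (shrink X τ (WithLp.toLp 2 (y - X *ᵥ β)))‖ ^ 2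
          - 2 * inner ℝ (residMean X β τ b - shrink X τ (partialMean X β tᶜ))
              (shrink X τ (WithLp.toLp 2 (y - X *ᵥ β))))
        + (‖shrink X τ (partialMean X β tᶜ)‖ ^ 2 - ‖residMean X β τ b‖ ^ 2) := by
  set V := imageOn (shrunkDesign X τ) b
  set e := shrink X τ (WithLp.toLp 2 (y - X *ᵥ β)) with he
  set w := shrink X τ (partialMean X β tᶜ) with hw
  set ρ := residMean X β τ b with hρ
  have h1 : shrink X τ (WithLp.toLp 2 y - partialMean X β t) = e + w := by
    rw [he, hw, ← map_add, toLp_sub_mean, ← partialMean_add_compl X β t]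
    congr 1
    abel
  have h2 : shrink X τ (WithLp.toLp 2 y) = e + shrunkDesign X τ β := by
    rw [he, shrunkDesign_apply, ← map_add, toLp_sub_mean, sub_add_cancel]
  have h3 : shrink X τ (WithLp.toLp 2 y) - V.starProjection (shrink X τ (WithLp.toLp 2 y))
      = (e - V.starProjection e) + ρ := by
    rw [h2, map_add, hρ, residMean]; abel
  have h4 : inner ℝ (V.starProjection e) ρ = 0 := by
    rw [real_inner_comm]
    exact Submodule.starProjection_inner_eq_zero _ _ (Submodule.starProjection_apply_mem _ _)
  have h5 : ‖e‖ ^ 2 = ‖e - V.starProjection e‖ ^ 2 + ‖V.starProjection e‖ ^ 2 := by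
    have := norm_sub_sq_of_mem V e 0 (Submodule.zero_mem _)
    rwa [sub_zero, sub_zero] at this
  rw [excess, h1, h3, norm_add_sq_real, norm_add_sq_real, inner_sub_left, inner_sub_left, h4, h5,
    real_inner_comm e ρ, real_inner_comm e w]
  ring

instance isProbabilityMeasure_trueLaw (X : Matrix (Fin n) (Fin p) ℝ) (β : Fin p → ℝ) (σ : ℝ) :
    IsProbabilityMeasure (trueLaw X β σ) := by
  unfold trueLaw; infer_instance

lemma measurable_excess (X : Matrix (Fin n) (Fin p) ℝ) (β : Fin p → ℝ) (t : Finset (Fin p)) (τ : ℝ)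
    (b : Finset (Fin p)) : Measurable (excess X β t τ b) := by
  have h := continuous_map_sub (shrink X τ) (X *ᵥ β)
  have h2 : Continuous (excess X β t τ b) := by
    simp_rw [funext (excess_eq X β t τ b)]
    fun_prop
  exact h2.measurable

lemma ofReal_inv_sqrt_pow_le {θ : ℝ} (hθ0 : 0 ≤ θ) (hθ1 : θ < 1) {d e : ℕ} (h : d ≤ e) :
    ENNReal.ofReal (Real.sqrt (1 - θ))⁻¹ ^ d ≤ ENNReal.ofReal ((Real.sqrt (1 - θ))⁻¹ ^ e) := by
  have h1 : 0 < Real.sqrt (1 - θ) := Real.sqrt_pos.2 (by linarith)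
  have h2 : 1 ≤ (Real.sqrt (1 - θ))⁻¹ :=
    (one_le_inv₀ h1).2 (Real.sqrt_le_one.2 (by linarith))
  rw [← ENNReal.ofReal_pow (by positivity)]
  exact ENNReal.ofReal_le_ofReal (pow_le_pow_right₀ h2 h)

/-- The projection of the inactive part of the mean is all that the projection of
`residMean - shrink w` retains. -/
lemma norm_starProjection_residMean_sub_le (X : Matrix (Fin n) (Fin p) ℝ) (β : Fin p → ℝ)
    (t : Finset (Fin p)) (τ : ℝ) (b : Finset (Fin p)) :
    ‖(imageOn (shrunkDesign X τ) b).starProjection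
        (residMean X β τ b - shrink X τ (partialMean X β tᶜ))‖ ≤ ‖partialMean X β tᶜ‖ := by
  set V := imageOn (shrunkDesign X τ) b
  have h1 : V.starProjection (residMean X β τ b) = 0 := by
    rw [residMean, map_sub, sub_eq_zero, eq_comm]
    exact Submodule.starProjection_eq_self_iff.2 (Submodule.starProjection_apply_mem _ _)
  rw [map_sub, h1, zero_sub, norm_neg]
  exact (Submodule.norm_starProjection_apply_le _ _).trans (norm_shrink_le _ _ _)

/-- Exponential moments of the excess. -/
lemma lintegral_exp_excess_le (X : Matrix (Fin n) (Fin p) ℝ) (β : Fin p → ℝ) (t : Finset (Fin p))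
    (τ : ℝ) (b : Finset (Fin p)) {σ θ : ℝ} (hσ : 0 < σ) (hθ0 : 0 ≤ θ) (hθ1 : θ < 1) :
    ∫⁻ y, eexp (θ * (excess X β t τ b y / (2 * σ ^ 2))) ∂trueLaw X β σ
      ≤ ENNReal.ofReal ((Real.sqrt (1 - θ))⁻¹ ^ b.card * Real.exp ((
          θ ^ 2 * ((‖residMean X β τ b‖ + ‖partialMean X β tᶜ‖) ^ 2
            + θ / (1 - θ) * ‖partialMean X β tᶜ‖ ^ 2)
          + θ * (‖partialMean X β tᶜ‖ ^ 2 - ‖residMean X β τ b‖ ^ 2)) / (2 * σ ^ 2))) := by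
  set w := partialMean X β tᶜ with hw
  set ρ := residMean X β τ b with hρ
  have hθ2 : 0 ≤ θ / (1 - θ) := div_nonneg hθ0 (by linarith)
  have h := lintegral_exp_proj_le (X *ᵥ β) hσ hθ0 hθ1 (shrink X τ) (norm_shrink_le X τ)
    (imageOn (shrunkDesign X τ) b) (ρ - shrink X τ w)
  have h1 : ∀ y, eexp (θ * (excess X β t τ b y / (2 * σ ^ 2)))
      = eexp (θ / (2 * σ ^ 2) *
          (‖(imageOn (shrunkDesign X τ) b).starProjection
              (shrink X τ (WithLp.toLp 2 (y - X *ᵥ β)))‖ ^ 2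
            - 2 * inner ℝ (ρ - shrink X τ w) (shrink X τ (WithLp.toLp 2 (y - X *ᵥ β)))))
        * eexp (θ * (‖shrink X τ w‖ ^ 2 - ‖ρ‖ ^ 2) / (2 * σ ^ 2)) := by
    intro y
    rw [excess_eq, ← eexp_add]
    congr 1
    ring
  have hc := continuous_map_sub (shrink X τ) (X *ᵥ β)
  simp_rw [h1]
  rw [lintegral_mul_const _ (measurable_eexp_comp (Continuous.measurable (by fun_prop)))]
  refine (mul_le_mul_left (h.trans (mul_le_mul_left (ofReal_inv_sqrt_pow_le hθ0 hθ1
    ((finrank_imageOn_le _ _))) _)) _).trans ?_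
  rw [mul_assoc, ← eexp_add, ENNReal.ofReal_mul (by positivity)]
  refine mul_le_mul_right (eexp_mono ?_) _
  have e1 : ‖shrink X τ w‖ ≤ ‖w‖ := norm_shrink_le X τ w
  have e2 : ‖ρ - shrink X τ w‖ ≤ ‖ρ‖ + ‖w‖ := (norm_sub_le _ _).trans (by gcongr)
  have e3 := norm_starProjection_residMean_sub_le X β t τ b
  rw [← hw, ← hρ] at e3
  have e4 : θ ^ 2 / (2 * σ ^ 2) * (‖ρ - shrink X τ w‖ ^ 2 + θ / (1 - θ)
      * ‖(imageOn (shrunkDesign X τ) b).starProjection (ρ - shrink X τ w)‖ ^ 2)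
      ≤ θ ^ 2 / (2 * σ ^ 2) * ((‖ρ‖ + ‖w‖) ^ 2 + θ / (1 - θ) * ‖w‖ ^ 2) := by gcongr
  have e5 : θ * (‖shrink X τ w‖ ^ 2 - ‖ρ‖ ^ 2) / (2 * σ ^ 2)
      ≤ θ * (‖w‖ ^ 2 - ‖ρ‖ ^ 2) / (2 * σ ^ 2) := by gcongr
  refine (add_le_add e4 e5).trans (le_of_eq ?_)
  ring

/-! ### Sums over models -/

lemma sum_pow_card_univ (x : ℝ) : ∑ k : Finset (Fin p), x ^ k.card = (1 + x) ^ p := by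
  have h := Finset.sum_pow_mul_eq_add_pow x 1 (Finset.univ : Finset (Fin p))
  simp only [one_pow, mul_one, Finset.powerset_univ, Finset.card_univ, Fintype.card_fin] at h
  rw [h, add_comm]

lemma sum_pow_card_superset_le {x : ℝ} (hx : 0 ≤ x) (b : Finset (Fin p))
    (S : Finset (Finset (Fin p))) (hS : ∀ k ∈ S, b ⊆ k) :
    ∑ k ∈ S, x ^ k.card ≤ x ^ b.card * (1 + x) ^ p := by
  have h1 : ∀ k ∈ S, x ^ k.card = x ^ b.card * x ^ (k \ b).card := fun k hk => by
    rw [← pow_add, ← Finset.card_sdiff_add_card_eq_card (hS k hk), add_comm]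
  rw [Finset.sum_congr rfl h1, ← Finset.mul_sum, ← sum_pow_card_univ]
  gcongr
  rw [← Finset.sum_image (f := fun k => x ^ k.card) (g := fun k => k \ b)]
  · exact Finset.sum_le_sum_of_subset_of_nonneg (Finset.subset_univ _) fun _ _ _ => by positivity
  · intro k hk l hl hkl
    simp only at hkl
    rw [← Finset.sdiff_union_of_subset (hS k hk), hkl, Finset.sdiff_union_of_subset (hS l hl)]

/-- The number of sets of size at least `d` is accounted for by a factor `p ^ d`. -/
lemma sum_pow_card_le {x : ℝ} (hx : 0 < x) (hpx : p * x ≤ 1) (hp : 0 < p) (d : ℕ)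
    (S : Finset (Finset (Fin p))) (hS : ∀ k ∈ S, d ≤ k.card) :
    ∑ k ∈ S, x ^ k.card ≤ Real.exp 1 * (p * x) ^ d := by
  have hp' : (0 : ℝ) < p := by exact_mod_cast hp
  have h1 : ∀ k ∈ S, x ^ k.card ≤ (p * x) ^ d * (p : ℝ)⁻¹ ^ k.card := fun k hk => by
    have : x ^ k.card = (p * x) ^ k.card * (p : ℝ)⁻¹ ^ k.card := by
      rw [← mul_pow]; congr 1; field_simp
    rw [this]
    gcongr ?_ * _
    exact pow_le_pow_of_le_one (by positivity) hpx (hS k hk)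
  calc ∑ k ∈ S, x ^ k.card ≤ ∑ k ∈ S, (p * x) ^ d * (p : ℝ)⁻¹ ^ k.card := Finset.sum_le_sum h1
    _ ≤ ∑ k : Finset (Fin p), (p * x) ^ d * (p : ℝ)⁻¹ ^ k.card :=
        Finset.sum_le_sum_of_subset_of_nonneg (Finset.subset_univ _) fun _ _ _ => by positivity
    _ = (p * x) ^ d * (1 + (p : ℝ)⁻¹) ^ p := by rw [← Finset.mul_sum, sum_pow_card_univ]
    _ ≤ (p * x) ^ d * Real.exp 1 := by
        gcongr
        calc (1 + (p : ℝ)⁻¹) ^ p ≤ Real.exp ((p : ℝ)⁻¹) ^ p := by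
              gcongr; rw [add_comm]; exact Real.add_one_le_exp _
          _ = Real.exp 1 := by rw [← Real.exp_nat_mul]; congr 1; field_simp
    _ = _ := mul_comm _ _

/-- The finite-sample bounds on which the estimates of the posterior ratios rest. With the prior odds
`q / (1 - q)` kept apart, `g` bounds the factor gained for an active covariate that is missed and `l`
the factor paid for a superfluous one; `A` is a constant, and shrinking distorts squared norms by at
most a factor `1 + η`. The number `G` in `ratio_le` is a lower bound for the residual sums of squares
of the fits on `b`, whatever the coefficients of the covariates in `k \ b`. -/
structure StageBound (X : Matrix (Fin n) (Fin p) ℝ) (β : Fin p → ℝ) (t : Finset (Fin p))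
    (σ τ₀ τ₁ q ν η A g l : ℝ) : Prop where
  A_pos : 0 < A
  g_pos : 0 < g
  l_pos : 0 < l
  q_pos : 0 < q
  q_lt_one : q < 1
  indep : ∀ u, t ⊆ u → u.card ≤ t.card + 1 → Indep X u
  shrink_ge : ∀ x, ‖x‖ ^ 2 ≤ (1 + η) * ‖shrink X τ₀ x‖ ^ 2
  ratio_le : ∀ {k b : Finset (Fin p)} (y : Fin n → ℝ) (G : ℝ), b ⊆ k → Indep X b →
    (b.card : ℝ) ≤ sizeBound n p ν →
    (∀ c : Fin p → ℝ, (∀ i ∉ k \ b, c i = 0) →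
      G ≤ ‖shrink X τ₀ (WithLp.toLp 2 y - designMap X c)
        - (imageOn (shrunkDesign X τ₀) b).starProjection
          (shrink X τ₀ (WithLp.toLp 2 y - designMap X c))‖ ^ 2) →
    posteriorRatio X σ τ₀ τ₁ q k t y
      ≤ (q / (1 - q)) ^ k.card / (q / (1 - q)) ^ t.card
        * (A * g ^ (t \ b).card * l ^ (b \ t).card
          * Real.exp ((‖shrink X τ₀ (WithLp.toLp 2 y - partialMean X β t)‖ ^ 2 - G)
              / (2 * σ ^ 2)))

variable {X : Matrix (Fin n) (Fin p) ℝ} {β : Fin p → ℝ} {t : Finset (Fin p)}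
  {σ τ₀ τ₁ q ν η A g l : ℝ}

lemma StageBound.odds_pos (h : StageBound X β t σ τ₀ τ₁ q ν η A g l) : 0 < q / (1 - q) :=
  div_pos h.q_pos (by linarith [h.q_lt_one])

/-- If `b` spans the column space of `k`, the residual sums of squares in `StageBound.ratio_le` do not
depend on the coefficients of the covariates in `k \ b`. -/
lemma StageBound.ratio_le_excess (h : StageBound X β t σ τ₀ τ₁ q ν η A g l)
    {k b : Finset (Fin p)} (y : Fin n → ℝ) (hbk : b ⊆ k) (hb : Indep X b)
    (hcard : (b.card : ℝ) ≤ sizeBound n p ν)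
    (himg : imageOn (designMap X) k = imageOn (designMap X) b) :
    posteriorRatio X σ τ₀ τ₁ q k t y
      ≤ (q / (1 - q)) ^ k.card / (q / (1 - q)) ^ t.card
        * (A * g ^ (t \ b).card * l ^ (b \ t).card
          * Real.exp (excess X β t τ₀ b y / (2 * σ ^ 2))) := by
  refine h.ratio_le y _ hbk hb hcard fun c hc => le_of_eq ?_
  have h1 : designMap X c ∈ imageOn (designMap X) b := by
    rw [← himg]
    exact apply_mem_imageOn _ fun i hi => hc i fun hik => hi (Finset.mem_sdiff.1 hik).1
  obtain ⟨c', hc', he⟩ := exists_of_mem_imageOn h1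
  rw [← he, map_sub, map_sub, ← shrunkDesign_apply,
    Submodule.starProjection_eq_self_iff.2 (apply_mem_imageOn (shrunkDesign X τ₀) hc')]
  congr 2
  abel

open scoped Classical in
/-- The sum of the posterior ratios over a class of models is controlled by a sum over bases. Each
model `k` is assigned a basis which contains `k ∩ t`; the models with a given basis `b` contain `b`,
and their prior odds add up to those of `b` up to the factor `(1 + q / (1 - q)) ^ p`, which is
bounded as `q` is of the order `1 / p`. -/
lemma StageBound.sum_ratio_le (h : StageBound X β t σ τ₀ τ₁ q ν η A g l)
    (M : Finset (Finset (Fin p))) (hM : ∀ k ∈ M, (modelRank X k : ℝ) ≤ sizeBound n p ν)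
    (Q : Finset (Fin p) → Prop)
    (hQ : ∀ k ∈ M, ∀ b, k ∩ t ⊆ b → b ⊆ k → Indep X b → b.card = modelRank X k → Q b)
    (y : Fin n → ℝ) :
    ∑ k ∈ M, posteriorRatio X σ τ₀ τ₁ q k t y
      ≤ ∑ b ∈ Finset.univ.filter Q, ((1 + q / (1 - q)) ^ p * A *
          ((q / (1 - q)) ^ b.card / (q / (1 - q)) ^ t.card)
            * g ^ (t \ b).card * l ^ (b \ t).card)
          * Real.exp (excess X β t τ₀ b y / (2 * σ ^ 2)) := by
  have hx := h.odds_pos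
  set x := q / (1 - q) with hxdef
  have hex : ∀ k, ∃ b, k ∩ t ⊆ b ∧ b ⊆ k ∧ Indep X b ∧ b.card = modelRank X k ∧
      imageOn (designMap X) k = imageOn (designMap X) b := fun k =>
    exists_basis ((h.indep t subset_rfl (by omega)).mono Finset.inter_subset_right)
      Finset.inter_subset_left
  choose f hf1 hf2 hf3 hf4 hf5 using hex
  have hA := h.A_pos
  have hg := h.g_pos
  have hl := h.l_pos
  set Ψ : Finset (Fin p) → ℝ := fun b => A * g ^ (t \ b).card * l ^ (b \ t).card
          * Real.exp (excess X β t τ₀ b y / (2 * σ ^ 2)) with hΨ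
  have hΨ0 : ∀ b, 0 ≤ Ψ b := fun b => by positivity
  calc ∑ k ∈ M, posteriorRatio X σ τ₀ τ₁ q k t y
      ≤ ∑ k ∈ M, x ^ k.card / x ^ t.card * Ψ (f k) := by
        refine Finset.sum_le_sum fun k hk => h.ratio_le_excess y (hf2 k) (hf3 k) ?_ (hf5 k)
        rw [hf4 k]; exact hM k hk
    _ = ∑ b ∈ Finset.univ.filter Q, ∑ k ∈ M.filter (fun k => f k = b),
          x ^ k.card / x ^ t.card * Ψ (f k) := by
        refine (Finset.sum_fiberwise_of_maps_to (fun k hk => ?_) _).symm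
        simp only [Finset.mem_filter, Finset.mem_univ, true_and]
        exact hQ k hk _ (hf1 k) (hf2 k) (hf3 k) (hf4 k)
    _ ≤ _ := by
        refine Finset.sum_le_sum fun b _ => ?_
        calc ∑ k ∈ M.filter (fun k => f k = b), x ^ k.card / x ^ t.card * Ψ (f k)
            = (∑ k ∈ M.filter (fun k => f k = b), x ^ k.card) / x ^ t.card * Ψ b := by
              rw [Finset.sum_div, Finset.sum_mul]
              refine Finset.sum_congr rfl fun k hk => ?_
              rw [(Finset.mem_filter.1 hk).2]
          _ ≤ (x ^ b.card * (1 + x) ^ p) / x ^ t.card * Ψ b := by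
              have := sum_pow_card_superset_le hx.le b (M.filter (fun k => f k = b))
                fun k hk => by rw [← (Finset.mem_filter.1 hk).2]; exact hf2 k
              have := hΨ0 b
              gcongr
          _ = _ := by rw [hΨ]; ring

end

/-! ### Classes of models with more superfluous than missed covariates -/

section

variable {n p : ℕ} {X : Matrix (Fin n) (Fin p) ℝ} {β : Fin p → ℝ} {t : Finset (Fin p)}
  {σ τ₀ τ₁ q ν η A g l : ℝ}

lemma pow_card_div_pow_card {x : ℝ} (hx : 0 < x) (b t : Finset (Fin p)) :
    x ^ b.card / x ^ t.card = x ^ (b \ t).card / x ^ (t \ b).card := by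
  rw [div_eq_div_iff (by positivity) (by positivity), ← pow_add, ← pow_add]
  congr 1
  have h1 := Finset.card_sdiff_add_card b t
  have h2 := Finset.card_sdiff_add_card t b
  rw [Finset.union_comm] at h2
  omega

/-- Summation over `b`, by its part inside `t` and its part outside `t`. -/
lemma sum_pow_mul_pow_le {r z R : ℝ} (hr : 0 < r) (hz : 0 < z) (hp : 0 < p) (hpz : p * z ≤ 1)
    (hR : 0 ≤ R) (d₀ : ℕ) (S : Finset (Finset (Fin p)))
    (hd : ∀ b ∈ S, (t \ b).card + d₀ ≤ (b \ t).card)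
    (hRb : ∀ b ∈ S, (r * (p * z)) ^ (t \ b).card ≤ R) :
    ∑ b ∈ S, r ^ (t \ b).card * z ^ (b \ t).card
      ≤ 2 ^ t.card * (Real.exp 1 * R * (p * z) ^ d₀) := by
  have hp' : (0 : ℝ) < p := by exact_mod_cast hp
  rw [← Finset.sum_fiberwise_of_maps_to (g := fun b => b ∩ t) (t := t.powerset)
    fun b _ => Finset.mem_powerset.2 Finset.inter_subset_right]
  have h1 : ∀ a ∈ t.powerset, ∑ b ∈ S.filter (fun b => b ∩ t = a),
      r ^ (t \ b).card * z ^ (b \ t).card ≤ Real.exp 1 * R * (p * z) ^ d₀ := by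
    intro a _
    rcases (S.filter fun b => b ∩ t = a).eq_empty_or_nonempty with h0 | ⟨b₀, hb₀⟩
    · rw [h0, Finset.sum_empty]; positivity
    have hm : ∀ b ∈ S.filter (fun b => b ∩ t = a), (t \ b).card = (t \ b₀).card := fun b hb => by
      rw [← Finset.sdiff_inter_self_left t b, ← Finset.sdiff_inter_self_left t b₀,
        Finset.inter_comm t b, Finset.inter_comm t b₀, (Finset.mem_filter.1 hb).2,
        (Finset.mem_filter.1 hb₀).2]
    set m := (t \ b₀).card
    rw [Finset.sum_congr rfl fun b hb => by rw [hm b hb], ← Finset.mul_sum,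
      ← Finset.sum_image (f := fun k => z ^ k.card) (g := fun b => b \ t)]
    · have h2 := sum_pow_card_le hz hpz hp (m + d₀)
        ((S.filter fun b => b ∩ t = a).image fun b => b \ t) (by
          intro k hk
          obtain ⟨b, hb, rfl⟩ := Finset.mem_image.1 hk
          rw [← hm b hb]
          exact hd b (Finset.mem_filter.1 hb).1)
      calc _ ≤ r ^ m * (Real.exp 1 * (p * z) ^ (m + d₀)) := by gcongr
        _ = Real.exp 1 * (r * (p * z)) ^ m * (p * z) ^ d₀ := by rw [mul_pow, pow_add]; ring
        _ ≤ _ := by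
            gcongr
            exact hRb b₀ (Finset.mem_filter.1 hb₀).1
    · intro b hb c hc hbc
      have e1 := (Finset.mem_filter.1 (Finset.mem_coe.1 hb)).2
      have e2 := (Finset.mem_filter.1 (Finset.mem_coe.1 hc)).2
      simp only at hbc
      rw [← Finset.sdiff_union_inter b t, hbc, e1, ← e2, Finset.sdiff_union_inter]
  calc _ ≤ ∑ a ∈ t.powerset, Real.exp 1 * R * (p * z) ^ d₀ := Finset.sum_le_sum h1
    _ = _ := by rw [Finset.sum_const, Finset.card_powerset, nsmul_eq_mul]; push_cast; ring

lemma lintegral_exp_half_excess_le (X : Matrix (Fin n) (Fin p) ℝ) (β : Fin p → ℝ)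
    (t : Finset (Fin p)) (τ : ℝ) (b : Finset (Fin p)) (hσ : 0 < σ) :
    ∫⁻ y, eexp (1 / 2 * (excess X β t τ b y / (2 * σ ^ 2))) ∂trueLaw X β σ
      ≤ ENNReal.ofReal (Real.sqrt 2 ^ b.card
          * Real.exp (‖partialMean X β tᶜ‖ ^ 2 / σ ^ 2)) := by
  refine (lintegral_exp_excess_le X β t τ b hσ (by norm_num) (by norm_num)).trans
    (ENNReal.ofReal_le_ofReal ?_)
  have h1 : (Real.sqrt (1 - 1 / 2))⁻¹ = Real.sqrt 2 := by
    rw [← Real.sqrt_inv]; norm_num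
  rw [h1]
  refine mul_le_mul_of_nonneg_left (Real.exp_le_exp.2 ?_) (by positivity)
  rw [div_le_div_iff₀ (by positivity) (by positivity)]
  nlinarith [sq_nonneg (‖residMean X β τ b‖ - ‖partialMean X β tᶜ‖), sq_nonneg σ,
    mul_nonneg (sq_nonneg (‖residMean X β τ b‖ - ‖partialMean X β tᶜ‖)) (sq_nonneg σ),
    mul_nonneg (sq_nonneg (‖partialMean X β tᶜ‖)) (sq_nonneg σ)]

open scoped Classical in
/-- Markov's inequality for the moment of order one half, which is finite uniformly in the
unexplained mean, for classes of models which have `d₀` more superfluous covariates than they miss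
active ones. -/
lemma StageBound.prob_lt_sum_ratio_le (h : StageBound X β t σ τ₀ τ₁ q ν η A g l) (hσ : 0 < σ)
    (hp : 0 < p) (M : Finset (Finset (Fin p)))
    (hM : ∀ k ∈ M, (modelRank X k : ℝ) ≤ sizeBound n p ν) (d₀ : ℕ) {R z : ℝ}
    (hz : z = Real.sqrt (2 * (q / (1 - q) * l))) (hpz : p * z ≤ 1) (hR : 0 ≤ R)
    (Q : Finset (Fin p) → Prop)
    (hQ : ∀ k ∈ M, ∀ b, k ∩ t ⊆ b → b ⊆ k → Indep X b → b.card = modelRank X k → Q b)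
    (hd : ∀ b, Q b → (t \ b).card + d₀ ≤ (b \ t).card)
    (hRb : ∀ b, Q b → (Real.sqrt (g / (q / (1 - q))) * (p * z)) ^ (t \ b).card ≤ R)
    {lam : ℝ} (hlam : 0 < lam) :
    trueLaw X β σ {y | lam < ∑ k ∈ M, posteriorRatio X σ τ₀ τ₁ q k t y}
      ≤ ENNReal.ofReal (lam ^ (-(1 / 2) : ℝ) * (Real.sqrt ((1 + q / (1 - q)) ^ p * A)
          * Real.sqrt 2 ^ t.card * Real.exp (‖partialMean X β tᶜ‖ ^ 2 / σ ^ 2)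
          * (2 ^ t.card * (Real.exp 1 * R * (p * z) ^ d₀)))) := by
  have hx := h.odds_pos
  set x := q / (1 - q) with hxdef
  have hA := h.A_pos
  have hg := h.g_pos
  have hl := h.l_pos
  have hz0 : 0 < z := by rw [hz]; positivity
  set W : Finset (Fin p) → ℝ := fun b => (1 + x) ^ p * A * (x ^ b.card / x ^ t.card)
            * g ^ (t \ b).card * l ^ (b \ t).card with hW
  have hsub : {y | lam < ∑ k ∈ M, posteriorRatio X σ τ₀ τ₁ q k t y}
      ⊆ {y | lam < ∑ b ∈ Finset.univ.filter Q, W b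
          * Real.exp (excess X β t τ₀ b y / (2 * σ ^ 2))} := fun y hy =>
    lt_of_lt_of_le hy (h.sum_ratio_le M hM Q hQ y)
  refine (measure_mono hsub).trans ((measure_lt_sum_exp_le _ _ (fun b _ => by positivity)
    (fun b _ => (measurable_excess X β t τ₀ b).div_const _) (by norm_num) (by norm_num) hlam
    (fun b _ => by positivity) fun b _ => lintegral_exp_half_excess_le X β t τ₀ b hσ).trans
    (ENNReal.ofReal_le_ofReal ?_))
  have hWb : ∀ b, W b ^ (1 / 2 : ℝ) * (Real.sqrt 2 ^ b.card
      * Real.exp (‖partialMean X β tᶜ‖ ^ 2 / σ ^ 2))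
      ≤ Real.sqrt ((1 + x) ^ p * A) * Real.sqrt 2 ^ t.card
        * Real.exp (‖partialMean X β tᶜ‖ ^ 2 / σ ^ 2)
        * (Real.sqrt (g / x) ^ (t \ b).card * z ^ (b \ t).card) := by
    intro b
    have e1 : W b = (1 + x) ^ p * A * ((g / x) ^ (t \ b).card * (x * l) ^ (b \ t).card) := by
      rw [hW]; simp only
      clear_value x
      rw [pow_card_div_pow_card hx, div_pow, mul_pow]
      field_simp
    have e2 : b.card ≤ t.card + (b \ t).card := by
      have := Finset.card_sdiff_add_card_inter b t
      have := Finset.card_le_card (Finset.inter_subset_right : b ∩ t ⊆ t)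
      omega
    have hsqrt : ∀ (y : ℝ) (_ : 0 ≤ y) (i : ℕ), Real.sqrt (y ^ i) = Real.sqrt y ^ i := by
      intro y hy i
      rw [Real.sqrt_eq_rpow, Real.sqrt_eq_rpow, Real.rpow_pow_comm hy]
    rw [← Real.sqrt_eq_rpow, e1,
      Real.sqrt_mul (x := (1 + x) ^ p * A) (by positivity),
      Real.sqrt_mul (x := (g / x) ^ (t \ b).card) (by positivity),
      hsqrt (g / x) (by positivity), hsqrt (x * l) (by positivity), hz, Real.sqrt_mul (by norm_num) (x * l),
      mul_pow]
    have e3 : Real.sqrt 2 ^ b.card ≤ Real.sqrt 2 ^ t.card * Real.sqrt 2 ^ (b \ t).card := by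
      rw [← pow_add]
      exact pow_le_pow_right₀ (Real.one_le_sqrt.2 (by norm_num)) e2
    calc _ ≤ Real.sqrt ((1 + x) ^ p * A) * (Real.sqrt (g / x) ^ (t \ b).card
            * Real.sqrt (x * l) ^ (b \ t).card)
            * ((Real.sqrt 2 ^ t.card * Real.sqrt 2 ^ (b \ t).card)
              * Real.exp (‖partialMean X β tᶜ‖ ^ 2 / σ ^ 2)) := by gcongr
      _ = _ := by ring
  gcongr
  refine (Finset.sum_le_sum fun b _ => hWb b).trans ?_
  rw [← Finset.mul_sum]
  gcongr
  exact sum_pow_mul_pow_le (by positivity) hz0 hp hpz hR d₀ _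
    (fun b hb => hd b (Finset.mem_filter.1 hb).2) fun b hb => hRb b (Finset.mem_filter.1 hb).2

end

/-! ### Models of large dimension -/

section

variable {n p : ℕ} {X : Matrix (Fin n) (Fin p) ℝ} {β : Fin p → ℝ} {t : Finset (Fin p)}
  {σ τ₀ τ₁ q ν η A g l : ℝ}

/-- Chernoff's bound for the squared norm of the noise. -/
lemma prob_lt_norm_sq_le (X : Matrix (Fin n) (Fin p) ℝ) (β : Fin p → ℝ) (hσ : 0 < σ) {a : ℝ}
    (ha : 0 < a) :
    trueLaw X β σ {y | (1 + a) * n * σ ^ 2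
        < ‖(WithLp.toLp 2 (y - X *ᵥ β) : EuclideanSpace ℝ (Fin n))‖ ^ 2}
      ≤ ENNReal.ofReal (Real.exp (-((a - Real.log (1 + a)) / 2) * n)) := by
  have h1a : 0 < 1 + a := by linarith
  set θ := a / (1 + a) with hθ
  have hθ1 : θ < 1 := by rw [hθ, div_lt_one h1a]; linarith
  have hθ0 : 0 < θ := by positivity
  have h := measure_lt_sum_exp_le (trueLaw X β σ) (Finset.univ : Finset Unit) (W := fun _ => 1)
    (fun _ _ => zero_le_one)
    (Y := fun _ y => θ / (2 * σ ^ 2) *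
      ‖(WithLp.toLp 2 (y - X *ᵥ β) : EuclideanSpace ℝ (Fin n))‖ ^ 2)
    (fun _ _ => Continuous.measurable (by
      have := continuous_map_sub (LinearMap.id (R := ℝ) (M := EuclideanSpace ℝ (Fin n))) (X *ᵥ β)
      simp only [LinearMap.id_apply] at this
      fun_prop)) one_pos le_rfl
    (Real.exp_pos (θ / (2 * σ ^ 2) * ((1 + a) * n * σ ^ 2)))
    (R := fun _ => (Real.sqrt (1 - θ))⁻¹ ^ n) (fun _ _ => by positivity) (fun _ _ => by
      simp_rw [one_mul]
      rw [trueLaw, lintegral_exp_norm_sq _ hσ hθ1, ENNReal.ofReal_pow (by positivity)])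
  simp only [Finset.univ_unique, Finset.sum_singleton, one_mul, Real.exp_lt_exp, Real.one_rpow] at h
  have hset : {y : Fin n → ℝ | (1 + a) * n * σ ^ 2
        < ‖(WithLp.toLp 2 (y - X *ᵥ β) : EuclideanSpace ℝ (Fin n))‖ ^ 2}
      = {y | θ / (2 * σ ^ 2) * ((1 + a) * n * σ ^ 2) < θ / (2 * σ ^ 2) *
          ‖(WithLp.toLp 2 (y - X *ᵥ β) : EuclideanSpace ℝ (Fin n))‖ ^ 2} := by
    ext y
    simp only [Set.mem_ofPred_eq]
    rw [mul_lt_mul_iff_right₀ (show 0 < θ / (2 * σ ^ 2) by positivity)]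
  rw [hset]
  refine h.trans (ENNReal.ofReal_le_ofReal (le_of_eq ?_))
  have h2 : (1 - θ)⁻¹ = 1 + a := by rw [hθ]; field_simp; ring
  rw [← Real.sqrt_inv, h2, ← Real.exp_mul, Real.sqrt_eq_rpow, Real.rpow_def_of_pos h1a,
    ← Real.exp_nat_mul, ← Real.exp_add, hθ]
  congr 1
  field_simp
  ring

/-- A model of rank at least `N` is penalized through `N` of its covariates. This only uses that
residual sums of squares are nonnegative. -/
lemma StageBound.sum_ratio_large_le (h : StageBound X β t σ τ₀ τ₁ q ν η A g l) (hσ : 0 < σ)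
    (M : Finset (Finset (Fin p))) {N : ℕ} (hN : (N : ℝ) ≤ sizeBound n p ν) (htN : t.card ≤ N)
    (hM : ∀ k ∈ M, N ≤ modelRank X k) {g' : ℝ} (hg1 : 1 ≤ g') (hgg : g ≤ g') (hl1 : l ≤ 1)
    {a : ℝ} (ha : 0 < a) {y : Fin n → ℝ}
    (hy : ‖(WithLp.toLp 2 (y - X *ᵥ β) : EuclideanSpace ℝ (Fin n))‖ ^ 2 ≤ (1 + a) * n * σ ^ 2) :
    ∑ k ∈ M, posteriorRatio X σ τ₀ τ₁ q k t y
      ≤ (1 + q / (1 - q)) ^ p / (q / (1 - q)) ^ t.card * (A * g' ^ t.card * l ^ (N - t.card)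
          * Real.exp ((1 + a) ^ 2 / 2 * n
            + (1 + a⁻¹) * ‖partialMean X β tᶜ‖ ^ 2 / (2 * σ ^ 2))) := by
  have hx := h.odds_pos
  set x := q / (1 - q) with hxdef
  have hA := h.A_pos
  have hg := h.g_pos
  have hl := h.l_pos
  set w := partialMean X β tᶜ with hw
  set e : EuclideanSpace ℝ (Fin n) := WithLp.toLp 2 (y - X *ᵥ β) with he
  have hnorm : ‖shrink X τ₀ (WithLp.toLp 2 y - partialMean X β t)‖ ^ 2
      ≤ (1 + a) * ‖e‖ ^ 2 + (1 + a⁻¹) * ‖w‖ ^ 2 := by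
    have h1 : WithLp.toLp 2 y - partialMean X β t = e + w := by
      rw [he, hw, toLp_sub_mean, ← partialMean_add_compl X β t]
      abel
    have h2 : ‖shrink X τ₀ (e + w)‖ ≤ ‖e‖ + ‖w‖ :=
      (norm_shrink_le _ _ _).trans (norm_add_le _ _)
    have h3 : ‖shrink X τ₀ (e + w)‖ ^ 2 ≤ (‖e‖ + ‖w‖) ^ 2 := by gcongr
    have h4 : 0 ≤ a⁻¹ * (a * ‖e‖ - ‖w‖) ^ 2 := by positivity
    have h5 : a⁻¹ * (a * ‖e‖ - ‖w‖) ^ 2 = a * ‖e‖ ^ 2 - 2 * ‖e‖ * ‖w‖ + a⁻¹ * ‖w‖ ^ 2 := by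
      field_simp
      ring
    rw [h1]
    nlinarith
  set F := A * g' ^ t.card * l ^ (N - t.card)
          * Real.exp ((1 + a) ^ 2 / 2 * n + (1 + a⁻¹) * ‖w‖ ^ 2 / (2 * σ ^ 2)) with hF
  have hterm : ∀ k ∈ M, posteriorRatio X σ τ₀ τ₁ q k t y ≤ x ^ k.card / x ^ t.card * F := by
    intro k hk
    obtain ⟨b₀, h1, h2, h3, h4, -⟩ := exists_basis
      ((h.indep t subset_rfl (by omega)).mono Finset.inter_subset_right)
      (Finset.inter_subset_left : k ∩ t ⊆ k)
    obtain ⟨b, hb1, hb2, hb3⟩ := Finset.exists_subsuperset_card_eq h1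
      ((Finset.card_le_card Finset.inter_subset_right).trans htN) (by rw [h4]; exact hM k hk)
    -- `b` need not span the model, so only the trivial bound `0` is available for the residuals
    refine (h.ratio_le y 0 (hb2.trans h2) (h3.mono hb2) (by rw [hb3]; exact hN)
      fun c _ => by positivity).trans ?_
    have h5 : (t \ b).card ≤ t.card := Finset.card_le_card Finset.sdiff_subset
    have h6 : N - t.card ≤ (b \ t).card := by
      rw [← hb3]; exact Finset.le_card_sdiff t b
    have h7 : g ^ (t \ b).card ≤ g' ^ t.card :=
      (pow_le_pow_left₀ hg.le hgg _).trans (pow_le_pow_right₀ hg1 h5)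
    have h8 : l ^ (b \ t).card ≤ l ^ (N - t.card) := pow_le_pow_of_le_one hl.le hl1 h6
    rw [hF]
    gcongr
    rw [sub_zero]
    have h9 : ((1 + a) * ((1 + a) * n * σ ^ 2) + (1 + a⁻¹) * ‖w‖ ^ 2) / (2 * σ ^ 2)
        = (1 + a) ^ 2 / 2 * n + (1 + a⁻¹) * ‖w‖ ^ 2 / (2 * σ ^ 2) := by
      field_simp
    rw [← h9]
    gcongr
    exact hnorm.trans (by gcongr)
  refine (Finset.sum_le_sum hterm).trans ?_
  rw [← Finset.sum_mul, ← Finset.sum_div]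
  have h1 : ∑ k ∈ M, x ^ k.card ≤ (1 + x) ^ p := by
    rw [← sum_pow_card_univ]
    exact Finset.sum_le_sum_of_subset_of_nonneg (Finset.subset_univ _) fun _ _ _ => by positivity
  have hF0 : 0 ≤ F := by positivity
  gcongr

/-! ### Models of moderate dimension which miss an active covariate -/

/-- At most `p ^ d` sets have a prescribed part inside `t` and `d` covariates outside. -/
lemma card_le_pow_of_inter_eq (hp : 0 < p) {a : Finset (Fin p)} {d : ℕ} (S : Finset (Finset (Fin p)))
    (ha : ∀ b ∈ S, b ∩ t = a) (hd : ∀ b ∈ S, (b \ t).card = d) :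
    (S.card : ℝ) ≤ Real.exp (d * Real.log p) := by
  have hp' : (0 : ℝ) < p := by exact_mod_cast hp
  rw [Real.exp_nat_mul, Real.exp_log hp']
  have h1 : S.card ≤ (Finset.powersetCard d (Finset.univ : Finset (Fin p))).card := by
    refine Finset.card_le_card_of_injOn (fun b => b \ t) (fun b hb => ?_) fun b hb c hc hbc => ?_
    · exact Finset.mem_coe.2 (Finset.mem_powersetCard.2 ⟨Finset.subset_univ _, hd b hb⟩)
    · simp only at hbc
      rw [← Finset.sdiff_union_inter b t, hbc, ha b hb, ← ha c hc, Finset.sdiff_union_inter]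
  rw [Finset.card_powersetCard, Finset.card_univ, Fintype.card_fin] at h1
  exact_mod_cast h1.trans (Nat.choose_le_pow p d)

/-- Markov's inequality for the moment of order `θ`, for covariates which leave at least `D` of the
squared norm of the mean unexplained: the moment of a single term decays like
`exp (-θ (1 - θ) D / (2 σ²))`. -/
lemma prob_lt_sum_exp_excess_le (X : Matrix (Fin n) (Fin p) ℝ) (β : Fin p → ℝ)
    (t : Finset (Fin p)) (τ : ℝ) (hσ : 0 < σ) {θ η L ω cS D : ℝ} (hθ0 : 0 < θ) (hθ1 : θ ≤ 1 / 2)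
    (hη0 : 0 < η) (hη1 : η ≤ 1) {N : ℕ} (S : Finset (Finset (Fin p)))
    (hcard : ∀ b ∈ S, b.card ≤ N) (hS : (S.card : ℝ) ≤ Real.exp cS) {W : Finset (Fin p) → ℝ}
    (hW0 : ∀ b ∈ S, 0 ≤ W b) (hW : ∀ b ∈ S, W b ≤ Real.exp ω)
    (hD : ∀ b ∈ S, D ≤ ‖residMean X β τ b‖ ^ 2) :
    trueLaw X β σ {y | Real.exp (-L) < ∑ b ∈ S, W b * Real.exp (excess X β t τ b y / (2 * σ ^ 2))}
      ≤ ENNReal.ofReal (Real.exp (θ * (L + ω) + cS + N * Real.log 2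
          + (2 / η * ‖partialMean X β tᶜ‖ ^ 2 - θ * (1 - θ) * (1 - η) * D) / (2 * σ ^ 2))) := by
  set w := ‖partialMean X β tᶜ‖ with hw
  have hw0 : 0 ≤ w := norm_nonneg _
  refine (measure_lt_sum_exp_le _ S hW0
    (fun b _ => (measurable_excess X β t τ b).div_const _) hθ0 (by linarith) (Real.exp_pos _)
    (fun b _ => by positivity) fun b _ => lintegral_exp_excess_le X β t τ b hσ hθ0.le
      (by linarith)).trans (ENNReal.ofReal_le_ofReal ?_)
  have hterm : ∀ b ∈ S, W b ^ θ * ((Real.sqrt (1 - θ))⁻¹ ^ b.card * Real.exp ((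
          θ ^ 2 * ((‖residMean X β τ b‖ + w) ^ 2 + θ / (1 - θ) * w ^ 2)
          + θ * (w ^ 2 - ‖residMean X β τ b‖ ^ 2)) / (2 * σ ^ 2)))
      ≤ Real.exp (θ * ω) * (2 ^ N * Real.exp (
          (2 / η * w ^ 2 - θ * (1 - θ) * (1 - η) * D) / (2 * σ ^ 2))) := by
    intro b hb
    set r := ‖residMean X β τ b‖ with hr
    have hr0 : 0 ≤ r := norm_nonneg _
    have h1 : W b ^ θ ≤ Real.exp (θ * ω) := by
      rw [mul_comm, Real.exp_mul]
      exact Real.rpow_le_rpow (hW0 b hb) (hW b hb) hθ0.le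
    have h2 : (Real.sqrt (1 - θ))⁻¹ ≤ 2 := by
      rw [inv_le_comm₀ (Real.sqrt_pos.2 (by linarith)) (by norm_num), Real.le_sqrt (by norm_num)
        (by linarith)]
      linarith
    have h3 : (Real.sqrt (1 - θ))⁻¹ ^ b.card ≤ 2 ^ N :=
      (pow_le_pow_left₀ (by positivity) h2 _).trans (pow_le_pow_right₀ (by norm_num) (hcard b hb))
    have h4 : θ ^ 2 * ((r + w) ^ 2 + θ / (1 - θ) * w ^ 2) + θ * (w ^ 2 - r ^ 2)
        ≤ 2 / η * w ^ 2 - θ * (1 - θ) * (1 - η) * D := by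
      have hθ2 : θ / (1 - θ) ≤ 1 := by rw [div_le_one (by linarith)]; linarith
      have e1 : θ * (1 - θ) * (1 - η) * D ≤ θ * (1 - θ) * (1 - η) * r ^ 2 := by
        have : 0 ≤ θ * (1 - θ) * (1 - η) :=
          mul_nonneg (mul_nonneg hθ0.le (by linarith)) (by linarith)
        exact mul_le_mul_of_nonneg_left (hD b hb) this
      -- the cross term is split by Young's inequality
      have e2 : 2 * θ ^ 2 * (r * w) ≤ θ * (1 - θ) * η * r ^ 2 + 1 / (4 * η) * w ^ 2 := by
        have h5 : 2 * (θ / 2) * (r * w) ≤ θ / 2 * (η / 2 * 2 * r ^ 2 + (1 / η) * w ^ 2) := by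
          have : 0 ≤ θ / 2 * (1 / η) * (η * r - w) ^ 2 := by positivity
          have e : θ / 2 * (1 / η) * (η * r - w) ^ 2
              = θ / 2 * (η / 2 * 2 * r ^ 2 + (1 / η) * w ^ 2) - 2 * (θ / 2) * (r * w) := by
            field_simp
            ring
          linarith
        have h6 : 2 * θ ^ 2 * (r * w) ≤ 2 * (θ / 2) * (r * w) := by
          have : 2 * θ ^ 2 ≤ 2 * (θ / 2) := by nlinarith
          exact mul_le_mul_of_nonneg_right this (by positivity)
        have h7 : θ / 2 * (η / 2 * 2 * r ^ 2) ≤ θ * (1 - θ) * η * r ^ 2 := by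
          have : θ / 2 * (η / 2 * 2) ≤ θ * (1 - θ) * η := by
            nlinarith [mul_pos hθ0 hη0]
          nlinarith [mul_le_mul_of_nonneg_right this (sq_nonneg r)]
        have h8 : θ / 2 * ((1 / η) * w ^ 2) ≤ 1 / (4 * η) * w ^ 2 := by
          have : 1 / (4 * η) * w ^ 2 = (1 / 4) * ((1 / η) * w ^ 2) := by field_simp
          rw [this]
          exact mul_le_mul_of_nonneg_right (by linarith) (by positivity)
        linarith
      have e3 : θ ^ 2 * (θ / (1 - θ) * w ^ 2) ≤ 1 / 4 * w ^ 2 := by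
        have : θ ^ 2 * (θ / (1 - θ)) ≤ 1 / 4 * 1 := by
          have : 0 ≤ θ / (1 - θ) := div_nonneg hθ0.le (by linarith)
          gcongr
          nlinarith
        nlinarith [mul_le_mul_of_nonneg_right this (sq_nonneg w)]
      have e4 : θ ^ 2 * w ^ 2 + θ * w ^ 2 ≤ 3 / 4 * w ^ 2 := by
        have : θ ^ 2 + θ ≤ 3 / 4 := by nlinarith
        nlinarith [mul_le_mul_of_nonneg_right this (sq_nonneg w)]
      have e5 : 1 / 4 * w ^ 2 + 3 / 4 * w ^ 2 + 1 / (4 * η) * w ^ 2 ≤ 2 / η * w ^ 2 := by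
        have h9 : 1 ≤ 1 / η := by rw [le_div_iff₀ hη0]; linarith
        have h10 : 1 + 1 / (4 * η) ≤ 2 / η := by
          have : 1 / (4 * η) = 1 / 4 * (1 / η) := by field_simp
          have : 2 / η = 2 * (1 / η) := by field_simp
          linarith
        nlinarith [mul_le_mul_of_nonneg_right h10 (sq_nonneg w)]
      have e6 : θ ^ 2 * ((r + w) ^ 2 + θ / (1 - θ) * w ^ 2) + θ * (w ^ 2 - r ^ 2)
          = 2 * θ ^ 2 * (r * w) + θ ^ 2 * (θ / (1 - θ) * w ^ 2) + (θ ^ 2 * w ^ 2 + θ * w ^ 2)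
            - θ * (1 - θ) * r ^ 2 := by ring
      have e7 : θ * (1 - θ) * (1 - η) * r ^ 2
          = θ * (1 - θ) * r ^ 2 - θ * (1 - θ) * η * r ^ 2 := by ring
      linarith
    gcongr
  calc _ ≤ Real.exp (-L) ^ (-θ) * ∑ b ∈ S, Real.exp (θ * ω) * (2 ^ N * Real.exp (
          (2 / η * w ^ 2 - θ * (1 - θ) * (1 - η) * D) / (2 * σ ^ 2))) := by
        exact mul_le_mul_of_nonneg_left (Finset.sum_le_sum hterm) (by positivity)
    _ = Real.exp (-L) ^ (-θ) * (S.card * (Real.exp (θ * ω) * (2 ^ N * Real.exp (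
          (2 / η * w ^ 2 - θ * (1 - θ) * (1 - η) * D) / (2 * σ ^ 2))))) := by
        rw [Finset.sum_const, nsmul_eq_mul]
    _ ≤ Real.exp (-L) ^ (-θ) * (Real.exp cS * (Real.exp (θ * ω) * (2 ^ N * Real.exp (
          (2 / η * w ^ 2 - θ * (1 - θ) * (1 - η) * D) / (2 * σ ^ 2))))) := by gcongr
    _ = _ := by
        have h2 : (2 : ℝ) ^ N = Real.exp (N * Real.log 2) := by
          rw [Real.exp_nat_mul, Real.exp_log (by norm_num)]
        rw [h2, ← Real.exp_mul, ← Real.exp_add, ← Real.exp_add, ← Real.exp_add, ← Real.exp_add]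
        congr 1
        ring

end

/-! ### The point of least norm of a convex hull -/

section

variable {E : Type*} [NormedAddCommGroup E] [InnerProductSpace ℝ E]

lemma exists_least_norm {R : Set E} (hR : R.Finite) (hne : R.Nonempty) :
    ∃ v ∈ convexHull ℝ R, ∀ r ∈ R, ‖v‖ ^ 2 + ‖r - v‖ ^ 2 ≤ ‖r‖ ^ 2 := by
  obtain ⟨v, hv, h⟩ := exists_norm_eq_iInf_of_complete_convex hne.convexHull
    (hR.isCompact_convexHull ℝ).isComplete (convex_convexHull ℝ R) 0
  rw [norm_eq_iInf_iff_real_inner_le_zero (convex_convexHull ℝ R) hv] at h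
  refine ⟨v, hv, fun r hr => ?_⟩
  have h1 := h r (subset_convexHull ℝ R hr)
  rw [zero_sub, inner_neg_left] at h1
  have h2 := norm_add_sq_real v (r - v)
  rw [add_sub_cancel] at h2
  linarith

/-- `‖r + x‖² - ‖r‖²` is affine in `r`, so a lower bound for it extends to the convex hull. -/
lemma le_norm_add_sq_of_mem_convexHull {R : Set E} {L D : ℝ} {x v : E}
    (h : ∀ r ∈ R, L ≤ ‖r + x‖ ^ 2) (hD : ∀ r ∈ R, ‖r‖ ^ 2 ≤ D) (hv : v ∈ convexHull ℝ R) :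
    L ≤ D - ‖v‖ ^ 2 + ‖v + x‖ ^ 2 := by
  have hc : Convex ℝ {r : E | (L - D - ‖x‖ ^ 2) / 2 ≤ innerSL ℝ x r} :=
    convex_halfSpace_ge (innerSL ℝ x).isLinear _
  have h1 := convexHull_min (fun r hr => ?_) hc hv
  · simp only [Set.mem_ofPred_eq, innerSL_apply_apply] at h1
    rw [norm_add_sq_real, real_inner_comm]
    linarith
  · have h2 := h r hr
    rw [norm_add_sq_real, real_inner_comm] at h2
    simp only [Set.mem_ofPred_eq, innerSL_apply_apply]
    linarith [hD r hr]

/-- If sums of four points of a set are long, so is every point of its convex hull. -/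
lemma le_norm_sq_of_four_sums {R : Set E} {L D : ℝ} {v : E}
    (h : ∀ r₁ ∈ R, ∀ r₂ ∈ R, ∀ r₃ ∈ R, ∀ r₄ ∈ R, L ≤ ‖r₁ + (r₂ + (r₃ + r₄))‖ ^ 2)
    (hD : ∀ r ∈ R, ‖r‖ ^ 2 ≤ D) (hv : v ∈ convexHull ℝ R) : L ≤ 4 * D + 12 * ‖v‖ ^ 2 := by
  have h1 : ∀ r₂ ∈ R, ∀ r₃ ∈ R, ∀ r₄ ∈ R, L - (D - ‖v‖ ^ 2) ≤ ‖r₂ + (v + (r₃ + r₄))‖ ^ 2 := by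
    intro r₂ h2 r₃ h3 r₄ h4
    have := le_norm_add_sq_of_mem_convexHull (fun r hr => h r hr r₂ h2 r₃ h3 r₄ h4) hD hv
    rw [add_left_comm] at this
    linarith
  have h2 : ∀ r₃ ∈ R, ∀ r₄ ∈ R, L - 2 * (D - ‖v‖ ^ 2) ≤ ‖r₃ + (v + (v + r₄))‖ ^ 2 := by
    intro r₃ h3 r₄ h4
    have := le_norm_add_sq_of_mem_convexHull (fun r hr => h1 r hr r₃ h3 r₄ h4) hD hv
    rw [show v + (v + (r₃ + r₄)) = r₃ + (v + (v + r₄)) by abel] at this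
    linarith
  have h3 : ∀ r₄ ∈ R, L - 3 * (D - ‖v‖ ^ 2) ≤ ‖r₄ + (v + (v + v))‖ ^ 2 := by
    intro r₄ h4
    have := le_norm_add_sq_of_mem_convexHull (fun r hr => h2 r hr r₄ h4) hD hv
    rw [show v + (v + (v + r₄)) = r₄ + (v + (v + v)) by abel] at this
    linarith
  have h4 := le_norm_add_sq_of_mem_convexHull h3 hD hv
  have h5 : v + (v + (v + v)) = (4 : ℝ) • v := by module
  rw [h5, norm_smul, mul_pow] at h4
  norm_num at h4
  linarith

end

/-! ### Excesses with a common unexplained mean -/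

section

variable {n p : ℕ} {X : Matrix (Fin n) (Fin p) ℝ} {β : Fin p → ℝ} {t : Finset (Fin p)}

/-- Gaussian tail bound for a linear functional of the shrunk noise. -/
lemma prob_lt_inner_le (X : Matrix (Fin n) (Fin p) ℝ) (β : Fin p → ℝ) (τ : ℝ) (hσ : 0 < σ)
    (v : Aug n p) {a : ℝ} (ha : 0 < a) :
    trueLaw X β σ {y | a * ‖v‖ ^ 2
        < -2 * inner ℝ v (shrink X τ (WithLp.toLp 2 (y - X *ᵥ β)))}
      ≤ ENNReal.ofReal (Real.exp (-(a ^ 2 * ‖v‖ ^ 2 / (8 * σ ^ 2)))) := by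
  have hc := continuous_map_sub (shrink X τ) (X *ᵥ β)
  set s := a / (4 * σ ^ 2) with hs
  have hs0 : 0 < s := by positivity
  have h := measure_lt_sum_exp_le (trueLaw X β σ) (Finset.univ : Finset Unit) (W := fun _ => 1)
    (fun _ _ => zero_le_one)
    (Y := fun _ y => s * (-2 * inner ℝ v (shrink X τ (WithLp.toLp 2 (y - X *ᵥ β)))))
    (fun _ _ => Continuous.measurable (by fun_prop)) one_pos le_rfl
    (Real.exp_pos (s * (a * ‖v‖ ^ 2)))
    (R := fun _ => Real.exp (σ ^ 2 * ‖(-2 * s) • v‖ ^ 2 / 2))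
    (fun _ _ => by positivity) (fun _ _ => by
      refine le_trans (le_of_eq ?_) (lintegral_exp_inner_le (X *ᵥ β) hσ (shrink X τ)
        (norm_shrink_le X τ) ((-2 * s) • v))
      refine lintegral_congr fun y => ?_
      rw [inner_smul_left]
      congr 1
      simp only [conj_trivial]
      ring)
  simp only [Finset.univ_unique, Finset.sum_singleton, one_mul, Real.one_rpow,
    Real.exp_lt_exp] at h
  refine (measure_mono ?_).trans (h.trans (ENNReal.ofReal_le_ofReal (le_of_eq ?_)))
  · intro y hy
    simp only [Set.mem_ofPred_eq] at hy ⊢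
    gcongr
  · rw [← Real.exp_mul, ← Real.exp_add, norm_smul, mul_pow, Real.norm_eq_abs, sq_abs, hs]
    congr 1
    field_simp
    ring

/-- Moments of order one half when the unexplained means of all the sets `b` have a long common
part `v`: the linear functional of the noise given by `v` is the same for all `b`, so that it need
not enter the union bound. -/
lemma prob_lt_sum_exp_excess_le_of_center (X : Matrix (Fin n) (Fin p) ℝ) (β : Fin p → ℝ)
    (t : Finset (Fin p)) (τ : ℝ) (hσ : 0 < σ) {a L ω cS r : ℝ} (ha : 0 < a)
    {N : ℕ} (S : Finset (Finset (Fin p)))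
    (hcard : ∀ b ∈ S, b.card ≤ N) (hS : (S.card : ℝ) ≤ Real.exp cS) {W : Finset (Fin p) → ℝ}
    (hW0 : ∀ b ∈ S, 0 ≤ W b) (hW : ∀ b ∈ S, W b ≤ Real.exp ω) (v : Aug n p)
    (hv : ∀ b ∈ S, ‖v‖ ^ 2 + ‖residMean X β τ b - v‖ ^ 2 ≤ ‖residMean X β τ b‖ ^ 2)
    (hr : ∀ b ∈ S, ‖residMean X β τ b - v‖ ≤ r) :
    trueLaw X β σ {y | Real.exp (-L) < ∑ b ∈ S, W b * Real.exp (excess X β t τ b y / (2 * σ ^ 2))}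
      ≤ ENNReal.ofReal (Real.exp (-(a ^ 2 * ‖v‖ ^ 2 / (8 * σ ^ 2)))
        + Real.exp (1 / 2 * (L + ω - (1 - a) * ‖v‖ ^ 2 / (2 * σ ^ 2)) + cS + N * Real.log 2
          + (r * ‖partialMean X β tᶜ‖ + ‖partialMean X β tᶜ‖ ^ 2) / (2 * σ ^ 2))) := by
  set w := partialMean X β tᶜ with hw
  set e : (Fin n → ℝ) → Aug n p := fun y => shrink X τ (WithLp.toLp 2 (y - X *ᵥ β)) with he
  have hec : Continuous e := continuous_map_sub (shrink X τ) (X *ᵥ β)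
  set h : Finset (Fin p) → Aug n p := fun b => residMean X β τ b - v - shrink X τ w with hh
  set Z : Finset (Fin p) → (Fin n → ℝ) → ℝ := fun b y =>
    ((‖(imageOn (shrunkDesign X τ) b).starProjection (e y)‖ ^ 2 - 2 * inner ℝ (h b) (e y))
      + (‖shrink X τ w‖ ^ 2 - ‖residMean X β τ b - v‖ ^ 2)) / (2 * σ ^ 2) with hZ
  set lam := Real.exp (-(L - (1 - a) * ‖v‖ ^ 2 / (2 * σ ^ 2))) with hlam
  have hsub : {y | Real.exp (-L)
        < ∑ b ∈ S, W b * Real.exp (excess X β t τ b y / (2 * σ ^ 2))}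
      ⊆ {y | a * ‖v‖ ^ 2 < -2 * inner ℝ v (e y)}
        ∪ {y | lam < ∑ b ∈ S, W b * Real.exp (Z b y)} := by
    intro y hy
    simp only [Set.mem_union, Set.mem_ofPred_eq] at hy ⊢
    by_contra hcon
    push Not at hcon
    obtain ⟨h1, h2⟩ := hcon
    refine absurd hy (not_lt.2 ?_)
    -- splitting off `v` from the unexplained mean leaves `Z b`, at a gain of `(1 - a) ‖v‖²`
    have h3 : ∀ b ∈ S, W b * Real.exp (excess X β t τ b y / (2 * σ ^ 2))
        ≤ W b * Real.exp (Z b y) * Real.exp (-((1 - a) * ‖v‖ ^ 2 / (2 * σ ^ 2))) := by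
      intro b hb
      rw [mul_assoc, ← Real.exp_add]
      have h4 : excess X β t τ b y / (2 * σ ^ 2)
          ≤ Z b y + -((1 - a) * ‖v‖ ^ 2 / (2 * σ ^ 2)) := by
        rw [hZ, ← neg_div, ← add_div]
        gcongr
        rw [excess_eq, hh]
        simp only [inner_sub_left]
        have := hv b hb
        simp only [he, hw] at h1 ⊢
        linarith
      exact mul_le_mul_of_nonneg_left (Real.exp_le_exp.2 h4) (hW0 b hb)
    refine (Finset.sum_le_sum h3).trans ?_
    rw [← Finset.sum_mul]
    refine (mul_le_mul_of_nonneg_right h2 (Real.exp_pos _).le).trans (le_of_eq ?_)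
    rw [hlam, ← Real.exp_add]
    congr 1
    ring
  have hZint : ∀ b ∈ S, ∫⁻ y, eexp (1 / 2 * Z b y) ∂trueLaw X β σ
      ≤ ENNReal.ofReal (2 ^ N * Real.exp ((r * ‖w‖ + ‖w‖ ^ 2) / (2 * σ ^ 2))) := by
    intro b hb
    have h0 := lintegral_exp_proj_le (X *ᵥ β) hσ (θ := 1 / 2) (by norm_num) (by norm_num)
      (shrink X τ) (norm_shrink_le X τ) (imageOn (shrunkDesign X τ) b) (h b)
    have h1 : ∀ y, eexp (1 / 2 * Z b y)
        = eexp (1 / 2 / (2 * σ ^ 2) * (‖(imageOn (shrunkDesign X τ) b).starProjection (e y)‖ ^ 2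
            - 2 * inner ℝ (h b) (e y)))
          * eexp (1 / 2 * (‖shrink X τ w‖ ^ 2 - ‖residMean X β τ b - v‖ ^ 2) / (2 * σ ^ 2)) := by
      intro y
      rw [← eexp_add]
      congr 1
      rw [hZ]
      ring
    simp_rw [h1]
    rw [lintegral_mul_const _ (measurable_eexp_comp (Continuous.measurable (by fun_prop)))]
    refine (mul_le_mul_left (h0.trans (mul_le_mul_left (ofReal_inv_sqrt_pow_le (by norm_num)
      (by norm_num) ((finrank_imageOn_le _ _).trans (hcard b hb))) _)) _).trans ?_
    rw [mul_assoc, ← eexp_add, ENNReal.ofReal_mul (by positivity)]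
    refine mul_le_mul' (ENNReal.ofReal_le_ofReal ?_) (eexp_mono ?_)
    · refine pow_le_pow_left₀ (by positivity) ?_ _
      rw [inv_le_comm₀ (Real.sqrt_pos.2 (by norm_num)) (by norm_num), Real.le_sqrt (by norm_num)
        (by norm_num)]
      norm_num
    · have e1 : ‖shrink X τ w‖ ≤ ‖w‖ := norm_shrink_le X τ w
      have e2 : ‖h b‖ ≤ ‖residMean X β τ b - v‖ + ‖w‖ := (norm_sub_le _ _).trans (by gcongr)
      have e3 : ‖(imageOn (shrunkDesign X τ) b).starProjection (h b)‖
          ≤ ‖residMean X β τ b - v‖ + ‖w‖ :=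
        (Submodule.norm_starProjection_apply_le _ _).trans e2
      have e4 := hr b hb
      have e5 := norm_nonneg (residMean X β τ b - v)
      set r' := ‖residMean X β τ b - v‖
      have e6 : ‖h b‖ ^ 2 ≤ (r' + ‖w‖) ^ 2 := by gcongr
      have e7 : ‖(imageOn (shrunkDesign X τ) b).starProjection (h b)‖ ^ 2 ≤ (r' + ‖w‖) ^ 2 := by
        gcongr
      have e8 : ‖shrink X τ w‖ ^ 2 ≤ ‖w‖ ^ 2 := by gcongr
      have e9 : r' * ‖w‖ ≤ r * ‖w‖ := by gcongr
      calc _ = ((1 / 2) ^ 2 * (‖h b‖ ^ 2 + 1 / 2 / (1 - 1 / 2)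
              * ‖(imageOn (shrunkDesign X τ) b).starProjection (h b)‖ ^ 2)
              + 1 / 2 * (‖shrink X τ w‖ ^ 2 - r' ^ 2)) / (2 * σ ^ 2) := by ring
        _ ≤ _ := by
            refine div_le_div_of_nonneg_right ?_ (by positivity)
            norm_num
            nlinarith
  have hP2 := measure_lt_sum_exp_le (trueLaw X β σ) S hW0 (Y := Z) (fun b _ =>
      Continuous.measurable (by simp only [hZ]; fun_prop)) (θ := 1 / 2) (by norm_num) (by norm_num)
    (Real.exp_pos (-(L - (1 - a) * ‖v‖ ^ 2 / (2 * σ ^ 2)))) (fun b _ => by positivity) hZint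
  refine (measure_mono hsub).trans ((measure_union_le _ _).trans ?_)
  rw [ENNReal.ofReal_add (Real.exp_pos _).le (Real.exp_pos _).le]
  refine add_le_add (prob_lt_inner_le X β τ hσ v ha) (hP2.trans (ENNReal.ofReal_le_ofReal ?_))
  have hterm : ∀ b ∈ S, W b ^ (1 / 2 : ℝ)
      * (2 ^ N * Real.exp ((r * ‖w‖ + ‖w‖ ^ 2) / (2 * σ ^ 2)))
      ≤ Real.exp (1 / 2 * ω) * (2 ^ N * Real.exp ((r * ‖w‖ + ‖w‖ ^ 2) / (2 * σ ^ 2))) := by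
    intro b hb
    refine mul_le_mul_of_nonneg_right ?_ (by positivity)
    rw [mul_comm, Real.exp_mul]
    exact Real.rpow_le_rpow (hW0 b hb) (hW b hb) (by norm_num)
  refine (mul_le_mul_of_nonneg_left (Finset.sum_le_sum hterm) (by positivity)).trans ?_
  rw [Finset.sum_const, nsmul_eq_mul]
  calc _ ≤ Real.exp (-(L - (1 - a) * ‖v‖ ^ 2 / (2 * σ ^ 2))) ^ (-(1 / 2) : ℝ)
        * (Real.exp cS * (Real.exp (1 / 2 * ω)
          * (2 ^ N * Real.exp ((r * ‖w‖ + ‖w‖ ^ 2) / (2 * σ ^ 2))))) := by gcongr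
    _ = _ := by
        have h2 : (2 : ℝ) ^ N = Real.exp (N * Real.log 2) := by
          rw [Real.exp_nat_mul, Real.exp_log (by norm_num)]
        rw [h2, ← Real.exp_mul, ← Real.exp_add, ← Real.exp_add, ← Real.exp_add, ← Real.exp_add]
        congr 1
        ring

/-! ### A fibre of models which miss an active covariate -/

/-- The unexplained means of four sets `b` with a common part inside `t` have a long sum: their
average is the mean minus a linear combination of the covariates in the union of the four sets, which
is still small and misses a covariate of `t`. -/
lemma le_norm_sq_add_four (X : Matrix (Fin n) (Fin p) ℝ) (β : Fin p → ℝ) {t a : Finset (Fin p)}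
    (τ K : ℝ) {D : ℝ} (hta : ¬ t ⊆ a) {d : ℕ} (hd : 4 * d ≤ (K - 1) * t.card)
    (hsep : ∀ (k : Finset (Fin p)) (c : Fin p → ℝ), (k.card : ℝ) ≤ K * t.card → ¬ t ⊆ k →
      (∀ i ∉ k, c i = 0) → D ≤ ‖shrunkDesign X τ (β - c)‖ ^ 2)
    (S : Finset (Finset (Fin p))) (ha : ∀ b ∈ S, b ∩ t = a) (hbd : ∀ b ∈ S, (b \ t).card = d)
    {b₁ b₂ b₃ b₄ : Finset (Fin p)} (h₁ : b₁ ∈ S) (h₂ : b₂ ∈ S) (h₃ : b₃ ∈ S) (h₄ : b₄ ∈ S) :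
    16 * D ≤ ‖residMean X β τ b₁ + (residMean X β τ b₂ + (residMean X β τ b₃
      + residMean X β τ b₄))‖ ^ 2 := by
  have hex : ∀ b, ∃ c : Fin p → ℝ, (∀ i ∉ b, c i = 0) ∧
      residMean X β τ b = shrunkDesign X τ (β - c) := by
    intro b
    obtain ⟨c, hc, he⟩ := exists_of_mem_imageOn
      ((imageOn (shrunkDesign X τ) b).starProjection_apply_mem (shrunkDesign X τ β))
    exact ⟨c, hc, by rw [residMean, ← he, map_sub]⟩
  obtain ⟨c₁, hc₁, e₁⟩ := hex b₁
  obtain ⟨c₂, hc₂, e₂⟩ := hex b₂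
  obtain ⟨c₃, hc₃, e₃⟩ := hex b₃
  obtain ⟨c₄, hc₄, e₄⟩ := hex b₄
  set k := b₁ ∪ (b₂ ∪ (b₃ ∪ b₄)) with hk
  have hkt : k ∩ t = a := by
    rw [hk, Finset.union_inter_distrib_right, Finset.union_inter_distrib_right,
      Finset.union_inter_distrib_right, ha _ h₁, ha _ h₂, ha _ h₃, ha _ h₄]
    simp
  have hat : a ⊆ t := by rw [← hkt]; exact Finset.inter_subset_right
  have hacard : a.card ≤ t.card := Finset.card_le_card hat
  have hkcard : k.card ≤ a.card + 4 * d := by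
    have e1 : k.card = (k \ t).card + (k ∩ t).card := (Finset.card_sdiff_add_card_inter k t).symm
    have e2 : (k \ t).card ≤ 4 * d := by
      rw [hk, Finset.union_sdiff_distrib, Finset.union_sdiff_distrib, Finset.union_sdiff_distrib]
      have := hbd _ h₁
      have := hbd _ h₂
      have := hbd _ h₃
      have := hbd _ h₄
      have := Finset.card_union_le (b₁ \ t) ((b₂ \ t) ∪ ((b₃ \ t) ∪ (b₄ \ t)))
      have := Finset.card_union_le (b₂ \ t) ((b₃ \ t) ∪ (b₄ \ t))
      have := Finset.card_union_le (b₃ \ t) (b₄ \ t)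
      omega
    rw [hkt] at e1
    omega
  have h := hsep k ((1 / 4 : ℝ) • (c₁ + c₂ + c₃ + c₄)) (by
      have h1 : (k.card : ℝ) ≤ t.card + 4 * d := by
        exact_mod_cast hkcard.trans (by omega)
      linarith)
    (fun htk => hta (by
      rw [← hkt]; exact Finset.subset_inter htk subset_rfl)) (fun i hi => by
      simp only [hk, Finset.mem_union, not_or] at hi
      simp [hc₁ i hi.1, hc₂ i hi.2.1, hc₃ i hi.2.2.1, hc₄ i hi.2.2.2])
  have h2 : residMean X β τ b₁ + (residMean X β τ b₂ + (residMean X β τ b₃ + residMean X β τ b₄))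
      = (4 : ℝ) • shrunkDesign X τ (β - (1 / 4 : ℝ) • (c₁ + c₂ + c₃ + c₄)) := by
    rw [e₁, e₂, e₃, e₄, ← map_smul, ← map_add, ← map_add, ← map_add]
    congr 1
    module
  rw [h2, norm_smul, mul_pow, show ‖(4 : ℝ)‖ ^ 2 = 16 by norm_num]
  linarith

lemma le_norm_sq_residMean (X : Matrix (Fin n) (Fin p) ℝ) (β : Fin p → ℝ) {t b : Finset (Fin p)}
    (τ K : ℝ) {D : ℝ} (hsep : ∀ (k : Finset (Fin p)) (c : Fin p → ℝ), (k.card : ℝ) ≤ K * t.card →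
      ¬ t ⊆ k → (∀ i ∉ k, c i = 0) → D ≤ ‖shrunkDesign X τ (β - c)‖ ^ 2)
    (hb : (b.card : ℝ) ≤ K * t.card) (htb : ¬ t ⊆ b) : D ≤ ‖residMean X β τ b‖ ^ 2 := by
  obtain ⟨c, hc, he⟩ := exists_of_mem_imageOn
    ((imageOn (shrunkDesign X τ) b).starProjection_apply_mem (shrunkDesign X τ β))
  rw [residMean, ← he, ← map_sub]
  exact hsep b c hb htb hc

end

/-! ### Exponents for the models which miss an active covariate -/

section

/-- The weight of `m ≤ T` missed covariates, in units of `T H`. -/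
lemma missed_weight_le {δ ℓ H m T : ℝ} (hδ : 0 < δ) (hℓ : 0 ≤ ℓ) (hH : (1 + δ) * ℓ ≤ H)
    (hmT : m ≤ T) (hm : 0 ≤ m) :
    m * (H + (1 + δ / 2) * ℓ) ≤ (2 - δ / (2 * (1 + δ))) * (T * H) := by
  have h1 : 0 < 1 + δ := by linarith
  have hH0 : 0 ≤ H := le_trans (by positivity) hH
  have h2 : (1 + δ / 2) * ℓ ≤ (1 - δ / (2 * (1 + δ))) * H := by
    have e : (1 - δ / (2 * (1 + δ))) * H = (1 + δ / 2) * (H / (1 + δ)) := by field_simp; ring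
    rw [e]
    gcongr
    rw [le_div_iff₀ h1]; linarith
  have h3 : 0 ≤ (1 + δ / 2) * ℓ := by positivity
  calc m * (H + (1 + δ / 2) * ℓ) ≤ T * (H + (1 - δ / (2 * (1 + δ))) * H) := by
        gcongr
        linarith
    _ = _ := by ring

/-- For `δ ≥ 2` moments of order `1 / 4` suffice. In this and the next two lemmas `ℓ = log p`, `D₂` is
the separation in units of `2 σ²`, the left-hand side is the exponent of the bound for the sets which
miss `m` active covariates and have `d` superfluous ones, and `d ℓ` is the logarithm of their
number. -/
lemma exponent_quarter_le {δ ℓ H m T d D₂ C₀ η : ℝ} (hδ : 2 ≤ δ) (hℓ : 0 ≤ ℓ)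
    (hH : (1 + δ) * ℓ ≤ H) (hmT : m ≤ T) (hm : 0 ≤ m) (hd : 0 ≤ d) (hTD : 5 / 2 * (T * H) ≤ D₂)
    (hη0 : 0 < η) (hη : η ≤ δ / (200 * (1 + δ))) (hC₀ : 0 ≤ C₀) :
    1 / 4 * (η * D₂ + (C₀ + m * (H + (1 + δ / 2) * ℓ) - d * (H + ℓ))) + d * ℓ
      - 1 / 4 * (1 - 1 / 4) * (1 - η) * ((1 - 2 * η) * D₂) ≤ C₀ - η * D₂ := by
  have h1 := missed_weight_le (by linarith) hℓ hH hmT hm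
  have hH0 : 0 ≤ H := le_trans (by positivity) hH
  have hT0 : 0 ≤ T * H := mul_nonneg (hm.trans hmT) hH0
  have hs : 1 / 3 ≤ δ / (2 * (1 + δ)) := by
    rw [div_le_div_iff₀ (by norm_num) (by linarith)]; linarith
  have hη' : η ≤ 1 / 200 := hη.trans (by
    rw [div_le_div_iff₀ (by linarith) (by norm_num)]; linarith)
  have h2 : (2 - δ / (2 * (1 + δ))) * (T * H) ≤ (2 - 1 / 3) * (T * H) := by
    gcongr
  have h3 : 0 ≤ d * (H - 3 * ℓ) := mul_nonneg hd (by nlinarith)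
  have hD0 : 0 ≤ D₂ := le_trans (by positivity) hTD
  have h4 : (1 - 3 * η) * D₂ ≤ (1 - η) * ((1 - 2 * η) * D₂) := by
    rw [← mul_assoc]; gcongr; nlinarith
  have h5 : η * D₂ ≤ 1 / 200 * D₂ := by gcongr
  nlinarith

/-- For `δ ≤ 2` moments of order `1 / 2` suffice if there are many superfluous covariates. -/
lemma exponent_half_le {δ ℓ H m T d D₂ C₀ η : ℝ} (hδ : 0 < δ) (hδ2 : δ ≤ 2) (hℓ : 0 ≤ ℓ)
    (hH : (1 + δ) * ℓ ≤ H) (hmT : m ≤ T) (hm : 0 ≤ m) (hd : 2 * T ≤ d * δ)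
    (hd0 : 0 ≤ d) (hTD : 5 / 2 * (T * H) ≤ D₂)
    (hη0 : 0 < η) (hη : η ≤ δ / (200 * (1 + δ))) (hC₀ : 0 ≤ C₀) :
    1 / 2 * (η * D₂ + (C₀ + m * (H + (1 + δ / 2) * ℓ) - d * (H + ℓ))) + d * ℓ
      - 1 / 2 * (1 - 1 / 2) * (1 - η) * ((1 - 2 * η) * D₂) ≤ C₀ - η * D₂ := by
  have h1 := missed_weight_le hδ hℓ hH hmT hm
  have hH0 : 0 ≤ H := le_trans (by positivity) hH
  have hT0 : 0 ≤ T * H := mul_nonneg (hm.trans hmT) hH0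
  have hδ1 : 0 < 1 + δ := by linarith
  have hη' : η ≤ 1 / 200 := hη.trans (by
    rw [div_le_div_iff₀ (by linarith) (by norm_num)]; linarith)
  have h3 : 2 / (1 + δ) * (T * H) ≤ d * (H - ℓ) := by
    have e1 : δ / (1 + δ) * H ≤ H - ℓ := by
      rw [div_mul_eq_mul_div, div_le_iff₀ hδ1]; nlinarith
    calc 2 / (1 + δ) * (T * H) = 1 / (1 + δ) * H * (2 * T) := by ring
      _ ≤ 1 / (1 + δ) * H * (d * δ) := by gcongr
      _ = d * (δ / (1 + δ) * H) := by ring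
      _ ≤ _ := by gcongr
  have h4 : (2 - δ / (2 * (1 + δ))) * (T * H) - 2 / (1 + δ) * (T * H) ≤ T * H := by
    rw [← sub_mul]
    have : 2 - δ / (2 * (1 + δ)) - 2 / (1 + δ) ≤ 1 := by
      have e : 2 - δ / (2 * (1 + δ)) - 2 / (1 + δ) = 3 * δ / (2 * (1 + δ)) := by field_simp; ring
      rw [e, div_le_one (by linarith)]; linarith
    nlinarith
  have hD0 : 0 ≤ D₂ := le_trans (by positivity) hTD
  have h5 : (1 - 3 * η) * D₂ ≤ (1 - η) * ((1 - 2 * η) * D₂) := by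
    rw [← mul_assoc]; gcongr; nlinarith
  have h6 : η * D₂ ≤ 1 / 200 * D₂ := by gcongr
  nlinarith

/-- Moments of order `1 / 2`, when `8 / 5` of the separation is unexplained, up to a small error. -/
lemma exponent_half_le_of_far {δ ℓ H m T d D₂ C₀ η : ℝ} (hδ : 0 < δ) (hℓ : 0 ≤ ℓ)
    (hH : (1 + δ) * ℓ ≤ H) (hmT : m ≤ T) (hm : 0 ≤ m)
    (hd0 : 0 ≤ d) (hTD : 5 / 2 * (T * H) ≤ D₂)
    (hη0 : 0 < η) (hη : η ≤ δ / (200 * (1 + δ))) (hC₀ : 0 ≤ C₀) :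
    1 / 2 * (η * D₂ + (C₀ + m * (H + (1 + δ / 2) * ℓ) - d * (H + ℓ))) + d * ℓ
      - 1 / 2 * (4 / 5 - 8 * η) * D₂ ≤ C₀ - η * D₂ := by
  have h1 := missed_weight_le hδ hℓ hH hmT hm
  have hH0 : 0 ≤ H := le_trans (by positivity) hH
  have hT0 : 0 ≤ T * H := mul_nonneg (hm.trans hmT) hH0
  have hδ1 : 0 < 1 + δ := by linarith
  have hD0 : 0 ≤ D₂ := le_trans (by positivity) hTD
  set s := δ / (2 * (1 + δ)) with hs
  have hs0 : 0 < s := by positivity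
  have hs1 : s ≤ 1 / 2 := by rw [hs, div_le_div_iff₀ (by linarith) (by norm_num)]; linarith
  have hηs : 100 * η ≤ s := by
    have : δ / (200 * (1 + δ)) = s / 100 := by rw [hs]; field_simp; norm_num
    linarith
  have h2 : (2 - s) * (T * H) ≤ (2 - s) * (2 / 5 * D₂) := by
    have : 0 ≤ 2 - s := by linarith
    exact mul_le_mul_of_nonneg_left (by linarith) this
  have h3 : 0 ≤ d * (H - ℓ) := mul_nonneg hd0 (by nlinarith)
  have h4 : 100 * η * D₂ ≤ s * D₂ := by gcongr
  nlinarith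

end

section

variable {n p : ℕ} {X : Matrix (Fin n) (Fin p) ℝ} {β : Fin p → ℝ} {t : Finset (Fin p)}

/-- The constant part of the exponent in `prob_lt_sum_fiber_le`. -/
noncomputable def fiberConst (σ η C₀ C₁ : ℝ) (N : ℕ) : ℝ :=
  C₀ + N * Real.log 2 + (4 / η * C₀ ^ 2 + 2 * C₁) / (2 * σ ^ 2)

set_option maxHeartbeats 1000000 in
/-- A fibre of sets `b` which miss an active covariate: they share the part inside `t` and the number
`d` of covariates outside `t`. If `d` is small, the sets whose unexplained mean is short share a long
common part of it. -/
lemma prob_lt_sum_fiber_le (X : Matrix (Fin n) (Fin p) ℝ) (β : Fin p → ℝ) {t a : Finset (Fin p)}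
    (τ : ℝ) {σ δ K Δ η H C₀ C₁ ω : ℝ} (hσ : 0 < σ) (hδ : 0 < δ) (hK : 1 + 8 / δ < K) (hp : 0 < p)
    (hta : ¬ t ⊆ a)
    (hη0 : 0 < η) (hη : η ≤ δ / (200 * (1 + δ))) (hC₀ : 0 ≤ C₀) (hC₁ : 0 ≤ C₁)
    (hH : (1 + δ) * Real.log p ≤ H) (hΔ : 5 / 2 * (t.card * H) ≤ Δ / (2 * σ ^ 2))
    (hw : ‖partialMean X β tᶜ‖ ≤ C₀)
    (hsep : ∀ (k : Finset (Fin p)) (c : Fin p → ℝ), (k.card : ℝ) ≤ K * t.card → ¬ t ⊆ k →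
      (∀ i ∉ k, c i = 0) → (1 - 2 * η) * Δ - C₁ ≤ ‖shrunkDesign X τ (β - c)‖ ^ 2)
    {N d m : ℕ} (hm : m ≤ t.card) (S : Finset (Finset (Fin p))) (ha : ∀ b ∈ S, b ∩ t = a)
    (hbd : ∀ b ∈ S, (b \ t).card = d) (hbK : ∀ b ∈ S, (b.card : ℝ) ≤ K * t.card)
    (hcard : ∀ b ∈ S, b.card ≤ N) {W : Finset (Fin p) → ℝ} (hW0 : ∀ b ∈ S, 0 ≤ W b)
    (hW : ∀ b ∈ S, W b ≤ Real.exp ω)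
    (hω : ω ≤ C₀ + m * (H + (1 + δ / 2) * Real.log p) - d * (H + Real.log p)) :
    trueLaw X β σ {y | 2 * Real.exp (-(η * (Δ / (2 * σ ^ 2))))
        < ∑ b ∈ S, W b * Real.exp (excess X β t τ b y / (2 * σ ^ 2))}
      ≤ ENNReal.ofReal
          (3 * Real.exp (fiberConst σ η C₀ C₁ N - η ^ 2 / 8 * (Δ / (2 * σ ^ 2)))) := by
  obtain ⟨D₂, hD₂⟩ : ∃ D, D = Δ / (2 * σ ^ 2) := ⟨_, rfl⟩
  rw [← hD₂] at hΔ ⊢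
  have hσ2 : 0 < 2 * σ ^ 2 := by positivity
  have hΔD : Δ = 2 * σ ^ 2 * D₂ := by rw [hD₂]; field_simp
  have hℓ : 0 ≤ Real.log p := Real.log_nonneg (by exact_mod_cast hp)
  obtain ⟨ℓ, hℓdef⟩ : ∃ ℓ, ℓ = Real.log p := ⟨_, rfl⟩
  rw [← hℓdef] at hH hω hℓ
  have hH0 : 0 ≤ H := le_trans (by positivity) hH
  have hT0 : (0 : ℝ) ≤ t.card := Nat.cast_nonneg _
  have hm' : (m : ℝ) ≤ t.card := by exact_mod_cast hm
  have hm0 : (0 : ℝ) ≤ m := Nat.cast_nonneg _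
  have hd0 : (0 : ℝ) ≤ d := Nat.cast_nonneg _
  have hD0 : 0 ≤ D₂ := le_trans (mul_nonneg (by norm_num) (mul_nonneg hT0 hH0)) hΔ
  have hΔ0 : 0 ≤ Δ := by rw [hΔD]; positivity
  have hη1 : η ≤ 1 / 200 := hη.trans (by
    rw [div_le_div_iff₀ (by linarith) (by norm_num)]; linarith)
  have hη2 : η ^ 2 / 8 * D₂ ≤ η * D₂ := by gcongr; nlinarith only [hη0, hη1]
  have hw2 : ‖partialMean X β tᶜ‖ ^ 2 ≤ C₀ ^ 2 := by gcongr
  obtain ⟨c, hc⟩ : ∃ c, c = C₁ / (2 * σ ^ 2) := ⟨_, rfl⟩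
  have hc0 : 0 ≤ c := by rw [hc]; positivity
  obtain ⟨e, he⟩ : ∃ e, e = C₀ ^ 2 / η / (2 * σ ^ 2) := ⟨_, rfl⟩
  have he0 : 0 ≤ e := by rw [he]; positivity
  have hconst : fiberConst σ η C₀ C₁ N = C₀ + N * Real.log 2 + (4 * e + 2 * c) := by
    rw [fiberConst, he, hc]; field_simp
  have hN0 : 0 ≤ N * Real.log 2 := mul_nonneg (Nat.cast_nonneg _) (Real.log_nonneg (by norm_num))
  obtain ⟨B, hB⟩ : ∃ B, B = fiberConst σ η C₀ C₁ N - η ^ 2 / 8 * D₂ := ⟨_, rfl⟩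
  rw [← hB]
  have hcardS : ∀ S' ⊆ S, (S'.card : ℝ) ≤ Real.exp (d * ℓ) := fun S' h => by
    rw [hℓdef]
    exact card_le_pow_of_inter_eq hp S' (fun b hb => ha b (h hb)) fun b hb => hbd b (h hb)
  have hdirect : ∀ S' ⊆ S, ∀ θ D' : ℝ, 0 < θ → θ ≤ 1 / 2 →
      (∀ b ∈ S', D' ≤ ‖residMean X β τ b‖ ^ 2) →
      θ * (η * D₂ + (C₀ + m * (H + (1 + δ / 2) * ℓ) - d * (H + ℓ))) + d * ℓ
        - θ * (1 - θ) * (1 - η) * (D' / (2 * σ ^ 2)) ≤ C₀ - η * D₂ + c →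
      trueLaw X β σ {y | Real.exp (-(η * D₂))
          < ∑ b ∈ S', W b * Real.exp (excess X β t τ b y / (2 * σ ^ 2))}
        ≤ ENNReal.ofReal (Real.exp B) := by
    intro S' hS' θ D' hθ0 hθ1 hD' hexp
    refine (prob_lt_sum_exp_excess_le X β t τ hσ hθ0 hθ1 hη0 (by linarith) S'
      (fun b hb => hcard b (hS' hb)) (hcardS S' hS') (fun b hb => hW0 b (hS' hb))
      (fun b hb => hW b (hS' hb)) hD').trans (ENNReal.ofReal_le_ofReal (Real.exp_le_exp.2 ?_))
    have h1 : θ * (η * D₂ + ω)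
        ≤ θ * (η * D₂ + (C₀ + m * (H + (1 + δ / 2) * ℓ) - d * (H + ℓ))) := by gcongr
    have h2 : (2 / η * ‖partialMean X β tᶜ‖ ^ 2 - θ * (1 - θ) * (1 - η) * D') / (2 * σ ^ 2)
        ≤ 2 * e - θ * (1 - θ) * (1 - η) * (D' / (2 * σ ^ 2)) := by
      have : 2 * e = 2 / η * C₀ ^ 2 / (2 * σ ^ 2) := by rw [he]; field_simp
      rw [this, sub_div, mul_div_assoc (θ * (1 - θ) * (1 - η))]
      gcongr
    rw [hB, hconst]
    linarith
  have hmono : ∀ f : (Fin n → ℝ) → ℝ,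
      trueLaw X β σ {y | Real.exp (-(η * D₂)) < f y} ≤ ENNReal.ofReal (Real.exp B) →
      trueLaw X β σ {y | 2 * Real.exp (-(η * D₂)) < f y}
        ≤ ENNReal.ofReal (3 * Real.exp B) := by
    intro f hf
    refine (measure_mono fun y hy => ?_).trans (hf.trans (ENNReal.ofReal_le_ofReal ?_))
    · simp only [Set.mem_ofPred_eq] at hy ⊢
      linarith [Real.exp_pos (-(η * D₂))]
    · linarith [Real.exp_pos B]
  have hsep1 : ∀ b ∈ S, (1 - 2 * η) * Δ - C₁ ≤ ‖residMean X β τ b‖ ^ 2 := fun b hb =>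
    le_norm_sq_residMean X β τ K hsep (hbK b hb) fun htb => hta (by
      rw [← ha b hb]; exact Finset.subset_inter htb subset_rfl)
  have hDdiv : ((1 - 2 * η) * Δ - C₁) / (2 * σ ^ 2) = (1 - 2 * η) * D₂ - c := by
    rw [hc, hD₂]; ring
  -- for `δ ≥ 2` the weight of the missed covariates is small enough for moments of order `1 / 4`
  rcases le_or_gt 2 δ with hδ2 | hδ2
  · refine hmono _ (hdirect S subset_rfl (1 / 4) _ (by norm_num) (by norm_num) hsep1 ?_)
    have := exponent_quarter_le hδ2 hℓ hH hm' hm0 hd0 hΔ hη0 hη hC₀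
    have h1 : 1 / 4 * (1 - 1 / 4) * (1 - η) * c ≤ 1 * c := by gcongr; linarith
    rw [hDdiv]
    linarith
  -- for large `d` the prior odds of the superfluous covariates help
  rcases le_or_gt (2 * (t.card : ℝ)) (d * δ) with hd2 | hd2
  · refine hmono _ (hdirect S subset_rfl (1 / 2) _ (by norm_num) le_rfl hsep1 ?_)
    have := exponent_half_le hδ hδ2.le hℓ hH hm' hm0 hd2 hd0 hΔ hη0 hη hC₀
    have h1 : 1 / 2 * (1 - 1 / 2) * (1 - η) * c ≤ 1 * c := by gcongr; linarith
    rw [hDdiv]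
    linarith
  classical
  -- for small `d` the sets whose unexplained mean is long are handled by moments of order `1 / 2`, and
  -- the others all lean towards the point `v` of least norm of the convex hull of their unexplained
  -- means, which is long because four sets have a union of size at most `K |t|`
  set S₁ := S.filter fun b => 8 / 5 * Δ ≤ ‖residMean X β τ b‖ ^ 2 with hS₁
  set S₂ := S.filter fun b => ¬ 8 / 5 * Δ ≤ ‖residMean X β τ b‖ ^ 2 with hS₂
  have hS₁S : S₁ ⊆ S := Finset.filter_subset _ _
  have hS₂S : S₂ ⊆ S := Finset.filter_subset _ _
  have hfar := exponent_half_le_of_far hδ hℓ hH hm' hm0 hd0 hΔ hη0 hη hC₀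
  have hηD : 0 ≤ η * D₂ := by positivity
  have hP₁ : trueLaw X β σ {y | Real.exp (-(η * D₂))
      < ∑ b ∈ S₁, W b * Real.exp (excess X β t τ b y / (2 * σ ^ 2))}
      ≤ ENNReal.ofReal (Real.exp B) := by
    refine hdirect S₁ hS₁S (1 / 2) (8 / 5 * Δ) (by norm_num) le_rfl
      (fun b hb => (Finset.mem_filter.1 hb).2) ?_
    rw [mul_div_assoc, ← hD₂]
    linarith
  have hP₂ : trueLaw X β σ {y | Real.exp (-(η * D₂))
      < ∑ b ∈ S₂, W b * Real.exp (excess X β t τ b y / (2 * σ ^ 2))}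
      ≤ ENNReal.ofReal (2 * Real.exp B) := by
    rcases S₂.eq_empty_or_nonempty with h0 | hne
    · have : {y : Fin n → ℝ | Real.exp (-(η * D₂))
          < ∑ b ∈ S₂, W b * Real.exp (excess X β t τ b y / (2 * σ ^ 2))} = ∅ := by
        ext y
        simp [h0, (Real.exp_pos _).le]
      rw [this, measure_empty]
      exact zero_le
    set R : Set (Aug n p) := (fun b => residMean X β τ b) '' (S₂ : Set (Finset (Fin p))) with hR
    obtain ⟨v, hvR, hv⟩ := exists_least_norm ((Finset.finite_toSet S₂).image _ : R.Finite)
      (hne.to_set.image _)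
    have hsmall : ∀ b ∈ S₂, ‖residMean X β τ b‖ ^ 2 ≤ 8 / 5 * Δ := fun b hb =>
      (not_le.1 (Finset.mem_filter.1 hb).2).le
    -- this is where `K > 1 + 8 / δ` enters
    have hd4 : 4 * (d : ℝ) ≤ (K - 1) * t.card := by
      have h1 : 8 / δ * t.card ≤ (K - 1) * t.card :=
        mul_le_mul_of_nonneg_right (by linarith) hT0
      refine le_trans ?_ h1
      rw [div_mul_eq_mul_div, le_div_iff₀ hδ]
      linarith
    have h4 := le_norm_sq_of_four_sums (R := R) (L := 16 * ((1 - 2 * η) * Δ - C₁)) (D := 8 / 5 * Δ)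
      (by
        rintro _ ⟨b₁, h₁, rfl⟩ _ ⟨b₂, h₂, rfl⟩ _ ⟨b₃, h₃, rfl⟩ _ ⟨b₄, h₄, rfl⟩
        exact le_norm_sq_add_four X β τ K hta hd4 hsep S ha hbd (hS₂S h₁) (hS₂S h₂) (hS₂S h₃)
          (hS₂S h₄))
      (by rintro _ ⟨b, hb, rfl⟩; exact hsmall b hb) hvR
    obtain ⟨V, hV⟩ : ∃ V, V = ‖v‖ ^ 2 / (2 * σ ^ 2) := ⟨_, rfl⟩
    have hV1 : (4 / 5 - 8 / 3 * η) * D₂ - 4 / 3 * c ≤ V := by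
      have e1 : (4 / 5 - 8 / 3 * η) * D₂ - 4 / 3 * c
          = ((4 / 5 - 8 / 3 * η) * Δ - 4 / 3 * C₁) / (2 * σ ^ 2) := by rw [hc, hD₂]; ring
      rw [e1, hV]
      gcongr
      linarith
    have hV0 : 0 ≤ V := by rw [hV]; positivity
    have hv' : ∀ b ∈ S₂, ‖v‖ ^ 2 + ‖residMean X β τ b - v‖ ^ 2 ≤ ‖residMean X β τ b‖ ^ 2 :=
      fun b hb => hv _ ⟨b, hb, rfl⟩
    have hr : ∀ b ∈ S₂, ‖residMean X β τ b - v‖ ≤ Real.sqrt (8 / 5 * Δ) := fun b hb =>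
      Real.le_sqrt_of_sq_le (by linarith [hv' b hb, hsmall b hb, sq_nonneg ‖v‖])
    refine (prob_lt_sum_exp_excess_le_of_center X β t τ hσ hη0 S₂ (fun b hb => hcard b (hS₂S hb))
      (hcardS S₂ hS₂S) (fun b hb => hW0 b (hS₂S hb)) (fun b hb => hW b (hS₂S hb)) v hv' hr).trans
      (ENNReal.ofReal_le_ofReal ?_)
    rw [two_mul (Real.exp B)]
    refine add_le_add (Real.exp_le_exp.2 ?_) (Real.exp_le_exp.2 ?_)
    · have e1 : η ^ 2 * ‖v‖ ^ 2 / (8 * σ ^ 2) = η ^ 2 / 4 * V := by rw [hV]; field_simp; ring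
      have e2 : η ^ 2 / 4 * ((4 / 5 - 8 / 3 * η) * D₂ - 4 / 3 * c) ≤ η ^ 2 / 4 * V := by gcongr
      have e3 : η ^ 2 / 4 * (1 / 2 * D₂) ≤ η ^ 2 / 4 * ((4 / 5 - 8 / 3 * η) * D₂) := by
        gcongr; linarith
      have e4 : η ^ 2 / 4 * (4 / 3 * c) ≤ 1 * (2 * c) := by
        gcongr
        · nlinarith only [hη0, hη1]
        · norm_num
      rw [e1, hB, hconst]
      linarith
    · set w := ‖partialMean X β tᶜ‖ with hwdef
      have hw0 : 0 ≤ w := norm_nonneg _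
      have e1 : (Real.sqrt (8 / 5 * Δ) * w + w ^ 2) / (2 * σ ^ 2) ≤ η * D₂ + 2 * e := by
        have h5 : Real.sqrt (8 / 5 * Δ) ^ 2 = 8 / 5 * Δ := Real.sq_sqrt (by positivity)
        have h6 : Real.sqrt (8 / 5 * Δ) * w + w ^ 2 ≤ η * Δ + 2 * (C₀ ^ 2 / η) := by
          set r := Real.sqrt (8 / 5 * Δ)
          have h7 : r * w ≤ 5 / 8 * η * r ^ 2 + w ^ 2 / η := by
            have : 0 ≤ (1 / 4 * η * r ^ 2 - r * w + w ^ 2 / η) := by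
              have e : 1 / 4 * η * r ^ 2 - r * w + w ^ 2 / η = (η * r / 2 - w) ^ 2 / η := by
                field_simp; ring
              rw [e]; positivity
            linarith [mul_nonneg hη0.le (sq_nonneg r)]
          have h8 : w ^ 2 / η ≤ C₀ ^ 2 / η := by gcongr
          have h9 : w ^ 2 ≤ C₀ ^ 2 / η := by
            rw [le_div_iff₀ hη0]; nlinarith only [sq_nonneg w, hw2, hη1]
          rw [h5] at h7
          linarith
        calc _ ≤ (η * Δ + 2 * (C₀ ^ 2 / η)) / (2 * σ ^ 2) := by gcongr
          _ = _ := by rw [hD₂, he]; ring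
      have e2 : (1 - η) * ‖v‖ ^ 2 / (2 * σ ^ 2) = (1 - η) * V := by rw [hV]; ring
      have e3 : (4 / 5 - 4 * η) * D₂ - 4 / 3 * c ≤ (1 - η) * V := by
        have h5 : (1 - η) * ((4 / 5 - 8 / 3 * η) * D₂ - 4 / 3 * c) ≤ (1 - η) * V :=
          mul_le_mul_of_nonneg_left hV1 (by linarith)
        have h6 : (4 / 5 - 4 * η) * D₂ ≤ (1 - η) * ((4 / 5 - 8 / 3 * η) * D₂) := by
          rw [← mul_assoc]; gcongr; nlinarith only [hη0]
        have h7 : 0 ≤ η * c := by positivity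
        linarith
      rw [e2, hB, hconst]
      linarith
  have hsplit : {y | 2 * Real.exp (-(η * D₂))
        < ∑ b ∈ S, W b * Real.exp (excess X β t τ b y / (2 * σ ^ 2))}
      ⊆ {y | Real.exp (-(η * D₂))
          < ∑ b ∈ S₁, W b * Real.exp (excess X β t τ b y / (2 * σ ^ 2))}
        ∪ {y | Real.exp (-(η * D₂))
          < ∑ b ∈ S₂, W b * Real.exp (excess X β t τ b y / (2 * σ ^ 2))} := by
    intro y hy
    simp only [Set.mem_union, Set.mem_ofPred_eq] at hy ⊢
    by_contra hcon
    push Not at hcon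
    rw [← Finset.sum_filter_add_sum_filter_not S
      (fun b => 8 / 5 * Δ ≤ ‖residMean X β τ b‖ ^ 2)] at hy
    linarith [hcon.1, hcon.2]
  refine (measure_mono hsplit).trans ((measure_union_le _ _).trans
    ((add_le_add hP₁ hP₂).trans (le_of_eq ?_)))
  rw [← ENNReal.ofReal_add (by positivity) (by positivity)]
  congr 1
  ring

end

/-! ### The union of the fibres -/

section

variable {n p : ℕ} {X : Matrix (Fin n) (Fin p) ℝ} {β : Fin p → ℝ} {t : Finset (Fin p)}
  {σ τ₀ τ₁ q ν K η A g l : ℝ}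

lemma measure_lt_sum_le_card_mul {Ω ι : Type*} [MeasurableSpace Ω] (P : Measure Ω) (I : Finset ι)
    (f : ι → Ω → ℝ) {c E N : ℝ} (hc : 0 ≤ c) (hE : 0 ≤ E) (hN : (I.card : ℝ) ≤ N)
    (h : ∀ i ∈ I, P {ω | c < f i ω} ≤ ENNReal.ofReal E) :
    P {ω | N * c < ∑ i ∈ I, f i ω} ≤ ENNReal.ofReal (N * E) := by
  have hsub : {ω | N * c < ∑ i ∈ I, f i ω} ⊆ ⋃ i ∈ I, {ω | c < f i ω} := by
    intro ω hω
    simp only [Set.mem_iUnion, Set.mem_ofPred_eq, exists_prop] at hω ⊢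
    by_contra hcon
    push Not at hcon
    have h1 : ∑ i ∈ I, f i ω ≤ I.card * c := by
      have := Finset.sum_le_card_nsmul I (fun i => f i ω) c hcon
      rwa [nsmul_eq_mul] at this
    have h2 : I.card * c ≤ N * c := by gcongr
    linarith
  refine (measure_mono hsub).trans ((measure_biUnion_finset_le _ _).trans
    ((Finset.sum_le_sum h).trans ?_))
  rw [Finset.sum_const, nsmul_eq_mul, ← ENNReal.ofReal_natCast, ← ENNReal.ofReal_mul (by positivity)]
  exact ENNReal.ofReal_le_ofReal (by gcongr)

open scoped Classical in
/-- The tail of the sum of the posterior ratios over the models of moderate dimension which miss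
an active covariate: a union bound over the fibres. -/
lemma StageBound.prob_lt_sum_class4_le (h : StageBound X β t σ τ₀ τ₁ q ν η A g l) (hσ : 0 < σ)
    {δ Δ H C₀ C₁ : ℝ} (hδ : 0 < δ) (hK : 1 + 8 / δ < K) (hp : 0 < p)
    (hη0 : 0 < η) (hη : η ≤ δ / (200 * (1 + δ))) (hC₀ : 0 ≤ C₀) (hC₁ : 0 ≤ C₁)
    (hH : (1 + δ) * Real.log p ≤ H) (hΔ : 5 / 2 * (t.card * H) ≤ Δ / (2 * σ ^ 2))
    (hw : ‖partialMean X β tᶜ‖ ≤ C₀)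
    (hsep : ∀ (k : Finset (Fin p)) (c : Fin p → ℝ), (k.card : ℝ) ≤ K * t.card → ¬ t ⊆ k →
      (∀ i ∉ k, c i = 0) → (1 - 2 * η) * Δ - C₁ ≤ ‖shrunkDesign X τ₀ (β - c)‖ ^ 2)
    (hsize : K * t.card ≤ sizeBound n p ν) {N : ℕ} (hN : N = ⌊K * (t.card : ℝ)⌋₊)
    (hW : ∀ m d : ℕ, m ≤ t.card → d ≤ N →
      (1 + q / (1 - q)) ^ p * A * ((g / (q / (1 - q))) ^ m * (q / (1 - q) * l) ^ d)
        ≤ Real.exp (C₀ + m * (H + (1 + δ / 2) * Real.log p) - d * (H + Real.log p))) :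
    trueLaw X β σ {y | 2 ^ t.card * (N + 1) * (2 * Real.exp (-(η * (Δ / (2 * σ ^ 2)))))
        < ∑ k ∈ class4 X t K, posteriorRatio X σ τ₀ τ₁ q k t y}
      ≤ ENNReal.ofReal (2 ^ t.card * (N + 1)
          * (3 * Real.exp (fiberConst σ η C₀ C₁ N - η ^ 2 / 8 * (Δ / (2 * σ ^ 2))))) := by
  have hx := h.odds_pos
  have hA := h.A_pos
  have hg := h.g_pos
  have hl := h.l_pos
  set W : Finset (Fin p) → ℝ := fun b => (1 + q / (1 - q)) ^ p * A *
    ((q / (1 - q)) ^ b.card / (q / (1 - q)) ^ t.card) * g ^ (t \ b).card * l ^ (b \ t).card with hWdef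
  set B : Finset (Finset (Fin p)) :=
    Finset.univ.filter fun b => ¬ t ⊆ b ∧ (b.card : ℝ) ≤ K * t.card with hB
  have hcard : ∀ b ∈ B, b.card ≤ N := fun b hb => by
    rw [hN]; exact Nat.le_floor (Finset.mem_filter.1 hb).2.2
  set I := (t.powerset.filter fun a => ¬ t ⊆ a) ×ˢ Finset.range (N + 1) with hI
  set φ : Finset (Fin p) → Finset (Fin p) × ℕ := fun b => (b ∩ t, (b \ t).card) with hφ
  have hmaps : ∀ b ∈ B, φ b ∈ I := by
    intro b hb
    refine Finset.mem_product.2 ⟨Finset.mem_filter.2 ⟨Finset.mem_powerset.2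
      Finset.inter_subset_right, fun h => (Finset.mem_filter.1 hb).2.1
        (h.trans Finset.inter_subset_left)⟩, Finset.mem_range.2 ?_⟩
    have := Finset.card_le_card (Finset.sdiff_subset : b \ t ⊆ b)
    have := hcard b hb
    simp only [hφ]
    omega
  have hIcard : (I.card : ℝ) ≤ 2 ^ t.card * (N + 1) := by
    rw [hI, Finset.card_product, Finset.card_range]
    have : (t.powerset.filter fun a => ¬ t ⊆ a).card ≤ 2 ^ t.card := by
      rw [← Finset.card_powerset]; exact Finset.card_filter_le _ _
    push_cast
    gcongr
    exact_mod_cast this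
  have hsub : {y | 2 ^ t.card * (N + 1) * (2 * Real.exp (-(η * (Δ / (2 * σ ^ 2)))))
        < ∑ k ∈ class4 X t K, posteriorRatio X σ τ₀ τ₁ q k t y}
      ⊆ {y | 2 ^ t.card * (N + 1) * (2 * Real.exp (-(η * (Δ / (2 * σ ^ 2)))))
        < ∑ i ∈ I, ∑ b ∈ B.filter (fun b => φ b = i),
            W b * Real.exp (excess X β t τ₀ b y / (2 * σ ^ 2))} := by
    intro y hy
    simp only [Set.mem_ofPred_eq] at hy ⊢
    refine lt_of_lt_of_le hy ?_
    rw [Finset.sum_fiberwise_of_maps_to hmaps]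
    refine (h.sum_ratio_le (class4 X t K) (fun k hk => ?_)
      (fun b => ¬ t ⊆ b ∧ (b.card : ℝ) ≤ K * t.card) (fun k hk b h1 h2 h3 h4 => ?_) y).trans
      (le_of_eq (by rw [hB]; congr!))
    · exact (Finset.mem_filter.1 hk).2.2.trans hsize
    · have hk' := (Finset.mem_filter.1 hk).2
      exact ⟨fun htb => hk'.1 (htb.trans h2), by rw [h4]; exact hk'.2⟩
  refine (measure_mono hsub).trans (measure_lt_sum_le_card_mul _ I _ (by positivity) (by positivity)
    hIcard fun i hi => ?_)
  obtain ⟨a, d⟩ := i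
  obtain ⟨hi1, hi2⟩ := Finset.mem_product.1 hi
  simp only [Finset.mem_filter, Finset.mem_powerset, Finset.mem_range] at hi1 hi2
  have hfib : ∀ b ∈ B.filter (fun b => φ b = (a, d)), b ∈ B ∧ b ∩ t = a ∧ (b \ t).card = d :=
    fun b hb => by
      obtain ⟨h1, h2⟩ := Finset.mem_filter.1 hb
      exact ⟨h1, congrArg Prod.fst h2, congrArg Prod.snd h2⟩
  have hm : (t \ a).card ≤ t.card := Finset.card_le_card Finset.sdiff_subset
  refine prob_lt_sum_fiber_le X β τ₀ hσ hδ hK hp hi1.2 hη0 hη hC₀ hC₁ hH hΔ hw hsep hm _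
    (fun b hb => (hfib b hb).2.1) (fun b hb => (hfib b hb).2.2)
    (fun b hb => (Finset.mem_filter.1 (hfib b hb).1).2.2) (fun b hb => hcard b (hfib b hb).1)
    (fun b _ => by positivity) (fun b hb => ?_) le_rfl
  refine le_trans (le_of_eq ?_) (hW _ d hm (by omega))
  have h1 : t \ b = t \ a := by
    rw [← (hfib b hb).2.1, Finset.inter_comm, Finset.sdiff_inter_self_left]
  rw [hWdef]
  simp only
  generalize q / (1 - q) = x at hx ⊢
  rw [pow_card_div_pow_card hx, h1, (hfib b hb).2.2, div_pow, mul_pow]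
  ring

end

/-! ### The scale of the penalty for a superfluous covariate -/

section

/-- `log (√n ∨ p ^ (1 + δ))`: a superfluous covariate costs a factor of the order
`exp (-scaleLog n p δ)`, besides its prior odds. -/
noncomputable def scaleLog (n p : ℕ) (δ : ℝ) : ℝ :=
  max (Real.log n / 2) ((1 + δ) * Real.log p)

lemma exp_two_scaleLog {n p : ℕ} (hn : 0 < n) (hp : 0 < p) (δ : ℝ) :
    Real.exp (2 * scaleLog n p δ) = max (n : ℝ) ((p : ℝ) ^ (2 + 2 * δ)) := by
  have hn' : (0 : ℝ) < n := by exact_mod_cast hn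
  have hp' : (0 : ℝ) < p := by exact_mod_cast hp
  rw [scaleLog, mul_max_of_nonneg _ _ (by norm_num), Real.exp_monotone.map_max]
  congr 1
  · rw [mul_div_cancel₀ _ (by norm_num), Real.exp_log hn']
  · rw [Real.rpow_def_of_pos hp']; congr 1; ring

lemma vRate_eq {n p : ℕ} (hn : 0 < n) (hp : 0 < p) (δ : ℝ) :
    vRate n p δ = Real.exp ((1 + δ / 2) * Real.log p - scaleLog n p δ) := by
  have hn' : (0 : ℝ) < n := by exact_mod_cast hn
  have hp' : (0 : ℝ) < p := by exact_mod_cast hp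
  rw [scaleLog, ← min_sub_sub_left, Real.exp_monotone.map_min, vRate, min_comm]
  congr 1
  · rw [Real.exp_sub, Real.rpow_def_of_pos hp', Real.sqrt_eq_rpow, Real.rpow_def_of_pos hn']
    congr 2 <;> ring
  · rw [Real.rpow_def_of_pos hp']; congr 1; ring

lemma scaleLog_le_gammaBound {n p T : ℕ} (hn : 0 < n) (hp : 0 < p) {σ δ : ℝ} (hδ : 0 < δ) :
    5 * σ ^ 2 * T * scaleLog n p δ ≤ gammaBound n p T σ δ := by
  have hn' : (0 : ℝ) < n := by exact_mod_cast hn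
  have hn1 : (1 : ℝ) ≤ n := by exact_mod_cast hn
  have hp' : (0 : ℝ) < p := by exact_mod_cast hp
  have h1 : scaleLog n p δ ≤ (1 + δ) * Real.log (max (Real.sqrt n) p) := by
    refine max_le ?_ ?_
    · have h2 : Real.log n / 2 ≤ Real.log (max (Real.sqrt n) p) := by
        rw [← Real.log_sqrt hn'.le]
        exact Real.log_le_log (Real.sqrt_pos.2 hn') (le_max_left _ _)
      have h3 : 0 ≤ Real.log n := Real.log_nonneg hn1
      nlinarith
    · gcongr
      exact le_max_right _ _
  calc _ ≤ 5 * σ ^ 2 * T * ((1 + δ) * Real.log (max (Real.sqrt n) p)) := by gcongr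
    _ = _ := by rw [gammaBound]; ring

end

/-! ### Regular problems -/

section

variable {n p : ℕ}

/-- The size of the relative errors which the exponents leave room for. -/
noncomputable def slack (δ : ℝ) : ℝ := δ / (200 * (1 + δ))

lemma slack_pos {δ : ℝ} (hδ : 0 < δ) : 0 < slack δ := by unfold slack; positivity

lemma slack_le {δ : ℝ} (hδ : 0 < δ) : slack δ ≤ 1 / 200 := by
  unfold slack
  rw [div_le_div_iff₀ (by linarith) (by norm_num)]; linarith

/-- A regression problem which satisfies the growth conditions at a single stage, with a constant `C`
that is meant not to depend on the stage. In terms of `H = scaleLog n p δ`, the constants of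
`StageBound` obey `l ≲ exp (-H)` and `g ≲ exp H * p ^ (δ / 2)`; the product `g l` has the better bound
`p ^ (κ / 2)`, because the slab variance cancels in it. -/
structure Regular (X : Matrix (Fin n) (Fin p) ℝ) (β : Fin p → ℝ) (t : Finset (Fin p))
    (σ τ₀ τ₁ q δ ν κ K : ℝ) (T : ℕ) (C A g l : ℝ) : Prop where
  stage : StageBound X β t σ τ₀ τ₁ q ν (slack δ) A g l
  n_pos : 0 < n
  p_pos : 0 < p
  card_eq : t.card = T
  A_le : A ≤ C
  odds_pow_le : (1 + q / (1 - q)) ^ p ≤ C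
  odds_le : q / (1 - q) ≤ C * Real.exp (-Real.log p)
  inv_odds_le : (q / (1 - q))⁻¹ ≤ C * Real.exp (Real.log p)
  l_le : l ≤ C * Real.exp (-scaleLog n p δ)
  g_le : g ≤ C * Real.exp (scaleLog n p δ + δ / 2 * Real.log p)
  g_mul_l_le : g * l ≤ C * Real.exp (κ / 2 * Real.log p)
  inactive_le : ‖partialMean X β tᶜ‖ ≤ C
  size : K * T ≤ sizeBound n p ν
  sep : ENNReal.ofReal (gammaBound n p T σ δ) < separation X β t K

lemma lambdaMin_nonneg (X : Matrix (Fin n) (Fin p) ℝ) (ν : ℝ) : 0 ≤ lambdaMin X ν := by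
  refine Real.sInf_nonneg ?_
  rintro x ⟨k, -, -, rfl⟩
  exact Real.sInf_nonneg fun y hy => gram_eigenvalue_nonneg X k hy.1

/-- The constant of `regular_of_bounds`. -/
noncomputable def regularConst (σ : ℝ) (T : ℕ) (c₁ c₂ c₃ c₄ c₅ c₆ : ℝ) : ℝ :=
  1 + Real.sqrt 2 ^ T * Real.exp (c₅ / σ ^ 2) + Real.exp (4 * c₂) + 4 * c₂ + 2 / c₂
    + Real.sqrt (4 * c₃) + Real.sqrt (2 * c₁ * c₄) + Real.sqrt (2 * c₃ * c₄) + c₆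

lemma le_regularConst (σ : ℝ) (T : ℕ) (c₁ : ℝ) {c₂ : ℝ} (hc₂ : 0 ≤ c₂) (c₃ c₄ c₅ : ℝ) {c₆ : ℝ}
    (hc₆ : 0 ≤ c₆) : let C := regularConst σ T c₁ c₂ c₃ c₄ c₅ c₆
    Real.sqrt 2 ^ T * Real.exp (c₅ / σ ^ 2) ≤ C ∧ 1 ≤ C ∧ Real.exp (4 * c₂) ≤ C ∧ 4 * c₂ ≤ C ∧
      2 / c₂ ≤ C ∧ Real.sqrt (4 * c₃) ≤ C ∧ Real.sqrt (2 * c₁ * c₄) ≤ C ∧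
      Real.sqrt (2 * c₃ * c₄) ≤ C ∧ c₆ ≤ C := by
  have h1 : 0 ≤ Real.sqrt 2 ^ T * Real.exp (c₅ / σ ^ 2) := by positivity
  have h2 := Real.exp_pos (4 * c₂)
  have h3 : 0 ≤ 2 / c₂ := by positivity
  have h4 := Real.sqrt_nonneg (4 * c₃)
  have h5 := Real.sqrt_nonneg (2 * c₁ * c₄)
  have h6 := Real.sqrt_nonneg (2 * c₃ * c₄)
  simp only [regularConst]
  refine ⟨?_, ?_, ?_, ?_, ?_, ?_, ?_, ?_, ?_⟩ <;> linarith

set_option maxHeartbeats 1000000 in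
/-- The constants are `g = √(s M)` and `l = √((1 + η) / (s Λ))`, where `s` is the excess of the slab
over the spike variance, `Λ = n λ_m`, and `M` is `n` times the bound on the eigenvalues of the active
Gram matrix. -/
lemma regular_of_bounds {X : Matrix (Fin n) (Fin p) ℝ} {β : Fin p → ℝ} {t : Finset (Fin p)}
    {σ τ₀ τ₁ q δ ν κ K : ℝ} {T : ℕ} {c₁ c₂ c₃ c₄ c₅ c₆ : ℝ} (hσ : 0 < σ) (hδ : 0 < δ)
    (hK : 1 ≤ K) (hc₁ : 0 < c₁) (hc₂ : 0 < c₂) (hc₃ : 0 < c₃) (hc₄ : 0 < c₄) (hc₅ : 0 < c₅)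
    (hc₆ : 0 < c₆) (hτ₀ : 0 < τ₀) (hτ₁ : 0 < τ₁) (hq0 : 0 < q) (hq1 : q < 1)
    (hn : 0 < n) (hp : 0 < p) (hpq : 4 * c₂ ≤ p) (hpc : 4 * c₃ ≤ p)
    (hspike : n * τ₀ ^ 2 ≤ c₁ / 4)
    (hslab1 : c₁ / 2 * max (n : ℝ) ((p : ℝ) ^ (2 + 3 * δ)) ≤ n * τ₁ ^ 2)
    (hslab2 : n * τ₁ ^ 2 ≤ 2 * c₁ * max (n : ℝ) ((p : ℝ) ^ (2 + 3 * δ)))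
    (hincl1 : c₂ / 2 ≤ q * p) (hincl2 : q * p ≤ 2 * c₂)
    (hcard : t.card = T) (hw : ‖partialMean X β tᶜ‖ ≤ c₆)
    (hsep : ENNReal.ofReal (gammaBound n p T σ δ) < separation X β t K)
    (hmax : lambdaMax X ≤ slack δ * (n * τ₀ ^ 2)⁻¹)
    (hmin : max (max (n : ℝ) ((p : ℝ) ^ (2 + 2 * δ)) / (n * τ₁ ^ 2)) ((p : ℝ) ^ (-κ))
      ≤ c₃ * lambdaMin X ν)
    (hcol : ∀ j, ∃ i, X i j ≠ 0) (hgram : maxEig (gram X t) ≤ c₄)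
    (hcoef : ∑ j ∈ t, β j ^ 2 ≤ c₅ * τ₁ ^ 2) (hsize : K * T ≤ sizeBound n p ν) :
    ∃ A g l, Regular X β t σ τ₀ τ₁ q δ ν κ K T (regularConst σ T c₁ c₂ c₃ c₄ c₅ c₆) A g l := by
  have hn' : (0 : ℝ) < n := by exact_mod_cast hn
  have hn1 : (1 : ℝ) ≤ n := by exact_mod_cast hn
  have hp' : (0 : ℝ) < p := by exact_mod_cast hp
  have hp1 : (1 : ℝ) ≤ p := by exact_mod_cast hp
  have hη := slack_pos hδ
  have hη1 := slack_le hδ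
  set s := τ₁ ^ 2 - τ₀ ^ 2 with hs
  have hs1 : τ₁ ^ 2 / 2 ≤ s := by
    have h1 : c₁ / 2 * 1 ≤ n * τ₁ ^ 2 := by
      refine le_trans ?_ hslab1
      gcongr
      exact hn1.trans (le_max_left _ _)
    have h2 : n * τ₀ ^ 2 ≤ n * (τ₁ ^ 2 / 2) := by linarith
    have := le_of_mul_le_mul_left h2 hn'
    rw [hs]; linarith
  have hs0 : 0 < s := lt_of_lt_of_le (by positivity) hs1
  have hs2 : s ≤ τ₁ ^ 2 := by rw [hs]; linarith only [sq_nonneg τ₀]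
  set lm := lambdaMin X ν with hlm
  have hlm0 : 0 < lm := by
    have h1 : 0 < (p : ℝ) ^ (-κ) := Real.rpow_pos_of_pos hp' _
    have h2 : 0 < c₃ * lm := h1.trans_le ((le_max_right _ _).trans hmin)
    exact pos_of_mul_pos_right h2 hc₃.le
  set Λ := n * lm with hΛ
  have hΛ0 : 0 < Λ := by positivity
  set M := n * c₄ with hM
  have hM0 : 0 < M := by positivity
  set H := scaleLog n p δ with hH
  have hU : Real.exp (2 * H) = max (n : ℝ) ((p : ℝ) ^ (2 + 2 * δ)) := exp_two_scaleLog hn hp δ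
  have hsΛ : Real.exp (2 * H) ≤ 2 * c₃ * (s * Λ) := by
    have h1 : Real.exp (2 * H) / (n * τ₁ ^ 2) ≤ c₃ * lm := by
      rw [hU]; exact (le_max_left _ _).trans hmin
    rw [div_le_iff₀ (by positivity)] at h1
    calc Real.exp (2 * H) ≤ c₃ * lm * (n * τ₁ ^ 2) := h1
      _ = 2 * c₃ * (τ₁ ^ 2 / 2 * Λ) := by rw [hΛ]; ring
      _ ≤ _ := by gcongr
  have hpU : (p : ℝ) ≤ Real.exp (2 * H) := by
    rw [hU]
    refine le_trans ?_ (le_max_right _ _)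
    conv_lhs => rw [← Real.rpow_one (p : ℝ)]
    exact Real.rpow_le_rpow_of_exponent_le hp1 (by linarith)
  have hsΛ1 : 1 + slack δ ≤ s * Λ := by
    have h1 : 4 * c₃ ≤ 2 * c₃ * (s * Λ) := hpc.trans (hpU.trans hsΛ)
    have h2 : 2 ≤ s * Λ := by
      have : 2 * c₃ * 2 ≤ 2 * c₃ * (s * Λ) := by linarith
      exact le_of_mul_le_mul_left this (by positivity)
    linarith
  have hsM : s * M ≤ 2 * c₁ * c₄ * Real.exp (2 * H + δ * Real.log p) := by
    have h1 : max (n : ℝ) ((p : ℝ) ^ (2 + 3 * δ)) ≤ Real.exp (2 * H + δ * Real.log p) := by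
      have e1 : Real.exp (δ * Real.log p) = (p : ℝ) ^ δ := by
        rw [Real.rpow_def_of_pos hp', mul_comm]
      have e2 : 1 ≤ (p : ℝ) ^ δ := Real.one_le_rpow hp1 hδ.le
      rw [Real.exp_add, hU, e1]
      refine max_le ?_ ?_
      · calc (n : ℝ) = n * 1 := (mul_one _).symm
          _ ≤ _ := by gcongr; exact le_max_left _ _
      · calc (p : ℝ) ^ (2 + 3 * δ) = (p : ℝ) ^ (2 + 2 * δ) * (p : ℝ) ^ δ := by
              rw [← Real.rpow_add hp']; congr 1; ring
          _ ≤ _ := by gcongr; exact le_max_right _ _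
    calc s * M ≤ τ₁ ^ 2 * (n * c₄) := by gcongr
      _ = n * τ₁ ^ 2 * c₄ := by ring
      _ ≤ 2 * c₁ * max (n : ℝ) ((p : ℝ) ^ (2 + 3 * δ)) * c₄ := by gcongr
      _ = 2 * c₁ * c₄ * max (n : ℝ) ((p : ℝ) ^ (2 + 3 * δ)) := by ring
      _ ≤ _ := by gcongr
  set A := Real.sqrt 2 ^ T * Real.exp (c₅ / σ ^ 2) with hA
  set g := Real.sqrt (s * M) with hg
  set l := Real.sqrt ((1 + slack δ) / (s * Λ)) with hl
  set C := regularConst σ T c₁ c₂ c₃ c₄ c₅ c₆ with hC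
  have hA0 : 0 < A := by positivity
  obtain ⟨k₁, -, k₂, k₃, k₄, k₅, k₆, k₇, k₈⟩ := le_regularConst σ T c₁ hc₂.le c₃ c₄ c₅ hc₆.le
  rw [← hC] at k₁ k₂ k₃ k₄ k₅ k₆ k₇ k₈
  have hq2 : q ≤ 1 / 2 := by
    by_contra hcon
    push Not at hcon
    have : 1 / 2 * (p : ℝ) < q * p := by gcongr
    linarith
  have hx1 : q ≤ q / (1 - q) := by rw [le_div_iff₀ (by linarith only [hq1])]; nlinarith only [hq0]
  have hx2 : q / (1 - q) ≤ 2 * q := by rw [div_le_iff₀ (by linarith only [hq1])]; nlinarith only [hq0, hq2]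
  have hx0 : 0 < q / (1 - q) := div_pos hq0 (by linarith only [hq1])
  have hind : ∀ u, t ⊆ u → u.card ≤ t.card + 1 → Indep X u := fun u h1 h2 =>
    indep_of_separation_pos hK (lt_of_le_of_lt zero_le hsep) h1 h2 hcol
  have hshr : ∀ x, ‖x‖ ^ 2 ≤ (1 + slack δ) * ‖shrink X τ₀ x‖ ^ 2 := by
    refine norm_sq_le_shrink X hη fun c => (norm_sq_designMap_le_lambdaMax X hn c).trans ?_
    gcongr
    calc n * lambdaMax X ≤ n * (slack δ * (n * τ₀ ^ 2)⁻¹) := by gcongr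
      _ = _ := by field_simp
  have htsize : (t.card : ℝ) ≤ sizeBound n p ν := by
    rw [hcard]
    refine le_trans ?_ hsize
    exact le_mul_of_one_le_left (Nat.cast_nonneg _) hK
  have hΛt := (hind t subset_rfl (by omega)).lambdaMin_mul_le hn htsize
  refine ⟨A, g, l, ⟨⟨hA0, by positivity, by positivity, hq0, hq1, hind, hshr, ?_⟩, hn, hp, hcard,
    k₁, ?_, ?_, ?_, ?_, ?_, ?_, hw.trans k₈, hsize, hsep⟩⟩
  · intro k b y G hbk hb hbsize hG
    refine (posteriorRatio_le X hσ hτ₀ hs0 (by rw [hs]; ring) hq0 hq1 hη hΛ0 hM0 hbk β y hshr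
      (hb.lambdaMin_mul_le hn hbsize) hΛt hsΛ1 (fun j hj => (norm_sq_column_le X hn hj).trans
        (by rw [hM]; gcongr)) hG).trans ?_
    rw [hcard, hA]
    gcongr ?_ / _ * (_ * ?_ * _ * _ * _)
    refine Real.exp_le_exp.2 ?_
    rw [div_le_div_iff₀ (by positivity) (by positivity)]
    calc (∑ j ∈ t, β j ^ 2) * σ ^ 2 ≤ c₅ * τ₁ ^ 2 * σ ^ 2 := by gcongr
      _ ≤ c₅ * (2 * s) * σ ^ 2 := by gcongr; linarith
      _ = _ := by ring
  · have h1 : (1 + q / (1 - q)) ^ p ≤ Real.exp (4 * c₂) := by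
      calc (1 + q / (1 - q)) ^ p ≤ Real.exp (q / (1 - q)) ^ p := by
            gcongr; rw [add_comm]; exact Real.add_one_le_exp _
        _ = Real.exp (p * (q / (1 - q))) := (Real.exp_nat_mul _ _).symm
        _ ≤ _ := by
            apply Real.exp_le_exp.2
            calc p * (q / (1 - q)) ≤ p * (2 * q) := by gcongr
              _ ≤ _ := by linarith only [hincl2]
    exact h1.trans k₂
  · rw [Real.exp_neg, Real.exp_log hp', ← div_eq_mul_inv, le_div_iff₀ hp']
    calc q / (1 - q) * p ≤ 2 * q * p := by gcongr
      _ ≤ 4 * c₂ := by linarith only [hincl2]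
      _ ≤ C := k₃
  · rw [Real.exp_log hp']
    calc (q / (1 - q))⁻¹ ≤ q⁻¹ := by gcongr
      _ ≤ 2 / c₂ * p := by
          rw [inv_eq_one_div, div_mul_eq_mul_div, div_le_div_iff₀ hq0 hc₂]; linarith only [hincl1]
      _ ≤ C * p := by gcongr
  · have h1 : l ≤ Real.sqrt (4 * c₃) * Real.exp (-H) := by
      have e1 : Real.exp (-H) = Real.sqrt (Real.exp (-(2 * H))) := by
        rw [← Real.exp_half]; congr 1; ring
      rw [hl, e1, ← Real.sqrt_mul (by positivity)]
      apply Real.sqrt_le_sqrt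
      rw [Real.exp_neg, ← div_eq_mul_inv, div_le_div_iff₀ (by positivity) (Real.exp_pos _)]
      calc (1 + slack δ) * Real.exp (2 * H) ≤ 2 * (2 * c₃ * (s * Λ)) := by gcongr; linarith
        _ = _ := by ring
    refine h1.trans ?_
    gcongr
  · have h1 : g ≤ Real.sqrt (2 * c₁ * c₄) * Real.exp (H + δ / 2 * Real.log p) := by
      have e1 : Real.exp (H + δ / 2 * Real.log p)
          = Real.sqrt (Real.exp (2 * H + δ * Real.log p)) := by
        rw [← Real.exp_half]; congr 1; ring
      rw [hg, e1, ← Real.sqrt_mul (by positivity)]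
      exact Real.sqrt_le_sqrt hsM
    refine h1.trans ?_
    gcongr
  · have h1 : g * l ≤ Real.sqrt (2 * c₃ * c₄) * Real.exp (κ / 2 * Real.log p) := by
      have e1 : Real.exp (κ / 2 * Real.log p) = Real.sqrt ((p : ℝ) ^ κ) := by
        rw [Real.rpow_def_of_pos hp', ← Real.exp_half]; congr 1; ring
      rw [hg, hl, e1, ← Real.sqrt_mul (by positivity), ← Real.sqrt_mul (by positivity)]
      apply Real.sqrt_le_sqrt
      have h2 : ((p : ℝ) ^ κ)⁻¹ ≤ c₃ * lm := by
        rw [← Real.rpow_neg hp'.le]; exact (le_max_right _ _).trans hmin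
      have h3 : 0 < (p : ℝ) ^ κ := Real.rpow_pos_of_pos hp' _
      rw [inv_le_iff_one_le_mul₀ h3] at h2
      have h4 : s * M * ((1 + slack δ) / (s * Λ)) = c₄ * (1 + slack δ) / lm := by
        rw [hM, hΛ]; field_simp
      rw [h4, div_le_iff₀ hlm0]
      calc c₄ * (1 + slack δ) ≤ c₄ * 2 * 1 := by
            have : 1 + slack δ ≤ 2 := by linarith
            rw [mul_one]; gcongr
        _ ≤ c₄ * 2 * (c₃ * lm * (p : ℝ) ^ κ) := by gcongr
        _ = _ := by ring
    refine h1.trans ?_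
    gcongr

/-- All but finitely many problems of the sequence are regular, with the same constant. -/
lemma eventually_regular {D : RegressionSeq} {δ ν κ K σ : ℝ} {T : ℕ} (hδ : 0 < δ) (hν : 0 < ν)
    (hK : 1 ≤ K) (hσ : 0 < σ) (hD : Conditions D δ ν κ K σ T) :
    ∃ C, 1 ≤ C ∧ ∀ᶠ n in atTop, ∃ A g l, Regular (D.X n) (D.β n) (D.t n) σ (D.τ₀ n) (D.τ₁ n) (D.q n)
      δ ν κ K T C A g l := by
  obtain ⟨c₁, hc₁, h₁⟩ := hD.prior_slab
  obtain ⟨c₂, hc₂, h₂⟩ := hD.prior_incl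
  obtain ⟨c₃, hc₃, h₃⟩ := hD.eigen_min.exists_pos
  obtain ⟨c₄, hc₄, h₄⟩ := hD.active_gram.exists_pos
  obtain ⟨c₅, hc₅, h₅⟩ := hD.active_coef.exists_pos
  obtain ⟨c₆, hc₆, h₆⟩ := hD.true_inactive.exists_pos
  refine ⟨regularConst σ T c₁ c₂ c₃ c₄ c₅ c₆,
    (le_regularConst σ T c₁ hc₂.le c₃ c₄ c₅ hc₆.le).2.1, ?_⟩
  have hp0 := hD.dim_tendsto.eventually_ge_atTop (⌈4 * c₂⌉₊ + ⌈4 * c₃⌉₊ + ⌈K * T⌉₊ + 2)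
  -- the constant makes `K |t|` at most `n / ((2 + ν) log p)`
  have hlog := hD.dim_log.bound (c := ((2 + ν) * (|K * T| + 1))⁻¹) (by positivity)
  filter_upwards [h₁.eventually_lt_const (show c₁ < 2 * c₁ by linarith),
    h₁.eventually_const_lt (show c₁ / 2 < c₁ by linarith),
    h₂.eventually_lt_const (show c₂ < 2 * c₂ by linarith),
    h₂.eventually_const_lt (show c₂ / 2 < c₂ by linarith), h₃.bound, h₄.bound, h₅.bound, h₆.bound,
    hp0, hlog, hD.prior_spike.bound (show 0 < c₁ / 4 by linarith), hD.true_card,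
    hD.identifiable, hD.eigen_max.bound (slack_pos hδ), hD.col_ne_zero, eventually_gt_atTop 0]
    with n a₁ a₂ a₃ a₄ a₅ a₆ a₇ a₈ a₉ a₁₀ a₁₁ a₁₂ a₁₃ a₁₄ a₁₅ hn
  have hn' : (0 : ℝ) < n := by exact_mod_cast hn
  have hp : 0 < D.p n := by omega
  have hp' : (0 : ℝ) < D.p n := by exact_mod_cast hp
  have hτ₀ := D.τ₀_pos n
  have hτ₁ := D.τ₁_pos n
  have hpc : ∀ x : ℝ, ⌈x⌉₊ ≤ D.p n → x ≤ D.p n := fun x hx =>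
    (Nat.le_ceil x).trans (by exact_mod_cast hx)
  have hmax0 : 0 < max (n : ℝ) ((D.p n : ℝ) ^ (2 + 3 * δ)) := lt_max_of_lt_left hn'
  have hlog0 : 0 < Real.log (D.p n) :=
    Real.log_pos (by exact_mod_cast (by omega : 1 < D.p n))
  rw [div_lt_iff₀ hmax0] at a₁
  rw [lt_div_iff₀ hmax0] at a₂
  rw [div_inv_eq_mul] at a₃ a₄
  rw [Real.norm_of_nonneg (le_max_of_le_right (by positivity)),
    Real.norm_of_nonneg (lambdaMin_nonneg _ _)] at a₅
  rw [norm_one, mul_one] at a₆ a₈ a₁₁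
  rw [Real.norm_of_nonneg (by positivity)] at a₁₁
  rw [norm_norm] at a₈
  rw [Real.norm_of_nonneg (Finset.sum_nonneg fun _ _ => by positivity),
    Real.norm_of_nonneg (by positivity)] at a₇
  rw [Real.norm_of_nonneg hlog0.le, Real.norm_of_nonneg hn'.le] at a₁₀
  rw [Real.norm_of_nonneg (by positivity : (0 : ℝ)
    ≤ min ((n : ℝ) * D.τ₀ n ^ 2)⁻¹ ((n : ℝ) * D.τ₁ n ^ 2))] at a₁₄
  refine regular_of_bounds hσ hδ hK hc₁ hc₂ hc₃ hc₄ hc₅ hc₆ hτ₀ hτ₁ (D.q_pos n)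
    (D.q_lt_one n) hn hp (hpc _ (by omega)) (hpc _ (by omega)) a₁₁ a₂.le a₁.le a₄.le a₃.le a₁₂ a₈ a₁₃
    ?_ a₅ a₁₅ ((Real.le_norm_self _).trans a₆) a₇ ?_
  · refine (Real.le_norm_self _).trans (a₁₄.trans ?_)
    have := slack_pos hδ
    gcongr
    exact min_le_left _ _
  · refine le_min (hpc _ (by omega)) ?_
    rw [le_div_iff₀ (by positivity)]
    calc K * T * ((2 + ν) * Real.log (D.p n))
        ≤ (|K * T| + 1) * ((2 + ν) * Real.log (D.p n)) := by
          gcongr; linarith [le_abs_self (K * T)]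
      _ ≤ (|K * T| + 1) * ((2 + ν) * (((2 + ν) * (|K * T| + 1))⁻¹ * n)) := by gcongr
      _ = n := by field_simp

end

/-! ### Over-fitted models, and large models which miss an active covariate -/

section

variable {n p : ℕ} {X : Matrix (Fin n) (Fin p) ℝ} {β : Fin p → ℝ} {t : Finset (Fin p)}
  {σ τ₀ τ₁ q δ ν κ K C A g l : ℝ} {T : ℕ}

lemma log_nonneg_of_pos (hp : 0 < p) : 0 ≤ Real.log p := Real.log_nonneg (by exact_mod_cast hp)

lemma log_le_scaleLog {δ : ℝ} : (1 + δ) * Real.log p ≤ scaleLog n p δ := le_max_right _ _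

/-- The factor `p z` of `StageBound.prob_lt_sum_ratio_le`, which is paid for each superfluous covariate
after a union bound over the choices of it. -/
lemma Regular.card_mul_sqrt_le (h : Regular X β t σ τ₀ τ₁ q δ ν κ K T C A g l) (hC : 1 ≤ C) :
    p * Real.sqrt (2 * (q / (1 - q) * l))
      ≤ Real.sqrt 2 * C * Real.exp ((Real.log p - scaleLog n p δ) / 2) := by
  have hp' : (0 : ℝ) < p := by exact_mod_cast h.p_pos
  have hx := h.stage.odds_pos
  have hl := h.stage.l_pos
  have h1 : q / (1 - q) * l ≤ C ^ 2 * Real.exp (-(Real.log p + scaleLog n p δ)) := by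
    calc q / (1 - q) * l ≤ C * Real.exp (-Real.log p) * (C * Real.exp (-scaleLog n p δ)) := by
          gcongr
          · exact h.odds_le
          · exact h.l_le
      _ = _ := by rw [neg_add, Real.exp_add]; ring
  have h2 : Real.sqrt (q / (1 - q) * l) ≤ C * Real.exp (-(Real.log p + scaleLog n p δ) / 2) := by
    refine (Real.sqrt_le_sqrt h1).trans (le_of_eq ?_)
    rw [Real.sqrt_mul (by positivity), Real.sqrt_sq (by linarith), ← Real.exp_half]
  rw [Real.sqrt_mul (by norm_num)]
  calc p * (Real.sqrt 2 * Real.sqrt (q / (1 - q) * l))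
      ≤ Real.exp (Real.log p) * (Real.sqrt 2
        * (C * Real.exp (-(Real.log p + scaleLog n p δ) / 2))) := by
        rw [Real.exp_log hp']; gcongr
    _ = Real.sqrt 2 * C * (Real.exp (Real.log p)
        * Real.exp (-(Real.log p + scaleLog n p δ) / 2)) := by ring
    _ = _ := by rw [← Real.exp_add]; congr 2; ring

/-- The constant of `Regular.prob_lt_sum_le`. -/
noncomputable def halfConst (σ C : ℝ) (T d₀ : ℕ) : ℝ :=
  C * Real.sqrt 2 ^ T * Real.exp (C ^ 2 / σ ^ 2) * (2 ^ T * Real.exp 1 * (Real.sqrt 2 * C) ^ d₀)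

/-- Classes of models which have `d₀` more superfluous covariates than they miss active ones. -/
lemma Regular.prob_lt_sum_le (h : Regular X β t σ τ₀ τ₁ q δ ν κ K T C A g l) (hσ : 0 < σ)
    (hδ : 0 < δ) (hC : 1 ≤ C) (M : Finset (Finset (Fin p)))
    (hM : ∀ k ∈ M, (modelRank X k : ℝ) ≤ sizeBound n p ν) (d₀ : ℕ) {R e : ℝ} (he : e ≤ d₀)
    (hlarge : Real.sqrt 2 * C ≤ Real.exp (δ / 2 * Real.log p)) (hR : 0 ≤ R)
    (Q : Finset (Fin p) → Prop)
    (hQ : ∀ k ∈ M, ∀ b, k ∩ t ⊆ b → b ⊆ k → Indep X b → b.card = modelRank X k → Q b)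
    (hd : ∀ b, Q b → (t \ b).card + d₀ ≤ (b \ t).card)
    (hRb : ∀ b, Q b → (Real.sqrt (g / (q / (1 - q))) * (p * Real.sqrt (2 * (q / (1 - q) * l))))
      ^ (t \ b).card ≤ R) :
    trueLaw X β σ {y | vRate n p δ ^ e < ∑ k ∈ M, posteriorRatio X σ τ₀ τ₁ q k t y}
      ≤ ENNReal.ofReal (halfConst σ C T d₀ * R * Real.exp (-(δ / 4 * d₀ * Real.log p))) := by
  have hv := vRate_eq (δ := δ) h.n_pos h.p_pos
  set ℓ := Real.log p with hℓ
  set H := scaleLog n p δ with hH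
  have hℓ0 : 0 ≤ ℓ := log_nonneg_of_pos h.p_pos
  have hHℓ : (1 + δ) * ℓ ≤ H := log_le_scaleLog
  have hpz := h.card_mul_sqrt_le hC
  have hx := h.stage.odds_pos
  have hl := h.stage.l_pos
  have hA := h.stage.A_pos
  set z := Real.sqrt (2 * (q / (1 - q) * l)) with hz
  have hpz1 : p * z ≤ 1 := by
    refine hpz.trans ?_
    calc Real.sqrt 2 * C * Real.exp ((ℓ - H) / 2)
        ≤ Real.exp (δ / 2 * ℓ) * Real.exp ((ℓ - H) / 2) := by gcongr
      _ = Real.exp (δ / 2 * ℓ + (ℓ - H) / 2) := (Real.exp_add _ _).symm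
      _ ≤ 1 := Real.exp_le_one_iff.2 (by linarith)
  have hv0 : 0 < vRate n p δ := by rw [hv]; exact Real.exp_pos _
  refine (h.stage.prob_lt_sum_ratio_le hσ h.p_pos M hM d₀ hz hpz1 hR Q hQ hd hRb
    (Real.rpow_pos_of_pos hv0 e)).trans (ENNReal.ofReal_le_ofReal ?_)
  have h1 : Real.sqrt ((1 + q / (1 - q)) ^ p * A) ≤ C := by
    rw [Real.sqrt_le_left (by linarith), sq]
    gcongr
    · exact h.odds_pow_le
    · exact h.A_le
  have h2 : Real.exp (‖partialMean X β tᶜ‖ ^ 2 / σ ^ 2) ≤ Real.exp (C ^ 2 / σ ^ 2) := by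
    have := h.inactive_le
    gcongr
  have h3 : (p * z) ^ d₀ ≤ (Real.sqrt 2 * C) ^ d₀ * Real.exp (d₀ * ((ℓ - H) / 2)) := by
    rw [Real.exp_nat_mul, ← mul_pow]
    gcongr
  have h4 : (vRate n p δ ^ e) ^ (-(1 / 2) : ℝ) = Real.exp (-(e * ((1 + δ / 2) * ℓ - H) / 2)) := by
    rw [hv, ← Real.exp_mul, ← Real.exp_mul]; congr 1; ring
  have h5 : Real.exp (-(e * ((1 + δ / 2) * ℓ - H) / 2)) * Real.exp (d₀ * ((ℓ - H) / 2))
      ≤ Real.exp (-(δ / 4 * d₀ * ℓ)) := by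
    rw [← Real.exp_add]
    apply Real.exp_le_exp.2
    -- `v ≤ 1`, so `v ^ d₀ ≤ v ^ e`
    have h6 : 0 ≤ (d₀ - e) * (H - (1 + δ / 2) * ℓ) := by
      refine mul_nonneg (by linarith) ?_
      nlinarith only [hHℓ, mul_nonneg hδ.le hℓ0]
    nlinarith only [h6]
  rw [h4, h.card_eq]
  have hexp0 := Real.exp_pos (-(e * ((1 + δ / 2) * ℓ - H) / 2))
  calc _ ≤ Real.exp (-(e * ((1 + δ / 2) * ℓ - H) / 2)) * (C * Real.sqrt 2 ^ T
        * Real.exp (C ^ 2 / σ ^ 2) * (2 ^ T * (Real.exp 1 * R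
          * ((Real.sqrt 2 * C) ^ d₀ * Real.exp (d₀ * ((ℓ - H) / 2)))))) := by gcongr
    _ = halfConst σ C T d₀ * R * (Real.exp (-(e * ((1 + δ / 2) * ℓ - H) / 2))
          * Real.exp (d₀ * ((ℓ - H) / 2))) := by rw [halfConst]; ring
    _ ≤ _ := by
        have : 0 ≤ halfConst σ C T d₀ * R := by
          refine mul_nonneg ?_ hR
          unfold halfConst
          have : 0 ≤ C := by linarith
          positivity
        exact mul_le_mul_of_nonneg_left h5 this

/-- Without this strict inequality the over-fitted models would not be penalized. -/
lemma card_lt_modelRank (h : StageBound X β t σ τ₀ τ₁ q ν (slack δ) A g l) {k : Finset (Fin p)}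
    (hkt : k ≠ t) (htk : t ⊆ k) : t.card < modelRank X k := by
  obtain ⟨j, hjk, hjt⟩ := Finset.exists_of_ssubset (Finset.ssubset_iff_subset_ne.2 ⟨htk, hkt.symm⟩)
  obtain ⟨b, hb, -, -, hcard, -⟩ := exists_basis
    (h.indep (insert j t) (Finset.subset_insert _ _) (Finset.card_insert_le _ _))
    (Finset.insert_subset hjk htk)
  rw [← hcard]
  have := Finset.card_le_card hb
  rw [Finset.card_insert_of_notMem hjt] at this
  omega

/-- The over-fitted models: no active covariate is missed and at least one is superfluous. -/
lemma Regular.prob_lt_sum_class2_le (h : Regular X β t σ τ₀ τ₁ q δ ν κ K T C A g l) (hσ : 0 < σ)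
    (hδ : 0 < δ) (hC : 1 ≤ C) (hlarge : Real.sqrt 2 * C ≤ Real.exp (δ / 2 * Real.log p)) :
    trueLaw X β σ {y | vRate n p δ < ∑ k ∈ class2 X t ν, posteriorRatio X σ τ₀ τ₁ q k t y}
      ≤ ENNReal.ofReal (halfConst σ C T 1 * Real.exp (-(δ / 4 * Real.log p))) := by
  have h0 : ∀ b : Finset (Fin p), t ⊆ b → (t \ b).card = 0 := fun b hb => by
    rw [Finset.sdiff_eq_empty_iff_subset.2 hb, Finset.card_empty]
  have := h.prob_lt_sum_le hσ hδ hC (class2 X t ν) (fun k hk => (Finset.mem_filter.1 hk).2.2.2) 1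
    (R := 1) (e := 1) (by norm_num) hlarge zero_le_one (fun b => t ⊆ b ∧ t.card < b.card)
    (fun k hk b h1 h2 h3 h4 => by
      obtain ⟨hk1, hk2, -⟩ := (Finset.mem_filter.1 hk).2
      refine ⟨?_, ?_⟩
      · rwa [Finset.inter_eq_right.2 hk2] at h1
      · rw [h4]; exact card_lt_modelRank h.stage hk1 hk2)
    (fun b hb => by
      have := Finset.card_sdiff_add_card_eq_card hb.1
      rw [h0 b hb.1]
      omega)
    (fun b hb => by rw [h0 b hb.1, pow_zero])
  simpa using this

/-- A missed active covariate paired with a superfluous one, after a union bound over the choices of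
the latter: the prior odds cancel, and so do the slab variances. -/
lemma Regular.sqrt_mul_card_mul_sqrt_le (h : Regular X β t σ τ₀ τ₁ q δ ν κ K T C A g l)
    (hC : 1 ≤ C) : Real.sqrt (g / (q / (1 - q))) * (p * Real.sqrt (2 * (q / (1 - q) * l)))
      ≤ Real.sqrt 2 * C * Real.exp ((1 + max κ 0 / 4) * Real.log p) := by
  have hp' : (0 : ℝ) < p := by exact_mod_cast h.p_pos
  have hx := h.stage.odds_pos
  have hl := h.stage.l_pos
  have hg := h.stage.g_pos
  have hℓ0 : 0 ≤ Real.log p := log_nonneg_of_pos h.p_pos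
  have hgl := h.g_mul_l_le
  generalize q / (1 - q) = x at hx ⊢
  rw [mul_left_comm, ← Real.sqrt_mul (by positivity)]
  have h1 : g / x * (2 * (x * l)) = 2 * (g * l) := by field_simp
  have h2 : Real.sqrt (g * l) ≤ C * Real.exp (max κ 0 / 4 * Real.log p) := by
    refine Real.sqrt_le_iff.2 ⟨by positivity, hgl.trans ?_⟩
    rw [mul_pow, ← Real.exp_nat_mul]
    refine mul_le_mul (by nlinarith only [hC]) (Real.exp_le_exp.2 ?_) (Real.exp_pos _).le
      (by positivity)
    have : κ * Real.log p ≤ max κ 0 * Real.log p := by gcongr; exact le_max_left _ _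
    push_cast
    linarith
  rw [h1, Real.sqrt_mul (by norm_num)]
  calc p * (Real.sqrt 2 * Real.sqrt (g * l))
      ≤ Real.exp (Real.log p) * (Real.sqrt 2 * (C * Real.exp (max κ 0 / 4 * Real.log p))) := by
        rw [Real.exp_log hp']; gcongr
    _ = Real.sqrt 2 * C * (Real.exp (Real.log p) * Real.exp (max κ 0 / 4 * Real.log p)) := by ring
    _ = _ := by rw [← Real.exp_add]; congr 2; ring

/-- The large models which miss an active covariate: a model of rank above `K |t|` has at least
`⌊(K - 1) |t|⌋ + 1` more superfluous covariates than it misses active ones. -/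
lemma Regular.prob_lt_sum_class3_le (h : Regular X β t σ τ₀ τ₁ q δ ν κ K T C A g l) (hσ : 0 < σ)
    (hδ : 0 < δ) (hK : 1 ≤ K) (hC : 1 ≤ C) (hT : 1 ≤ (K - 1) * T)
    (hlarge : Real.sqrt 2 * C ≤ Real.exp (δ / 2 * Real.log p)) {d₀ : ℕ}
    (hd₀ : d₀ = ⌊(K - 1) * (T : ℝ)⌋₊ + 1) :
    trueLaw X β σ {y | vRate n p δ ^ ((K - 1) * T / 2 + 1)
        < ∑ k ∈ class3 X t ν K, posteriorRatio X σ τ₀ τ₁ q k t y}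
      ≤ ENNReal.ofReal (halfConst σ C T d₀ * (Real.sqrt 2 * C) ^ T
          * Real.exp (-(((K - 1) * δ / 4 - 1 - max κ 0 / 4) * T * Real.log p))) := by
  have hℓ0 : 0 ≤ Real.log p := log_nonneg_of_pos h.p_pos
  have hpow : (K - 1) * T < d₀ := by
    rw [hd₀]; push_cast; exact Nat.lt_floor_add_one _
  -- together with `hpow` this gives `(K - 1) |t| / 2 + 1 ≤ d₀`
  have hd₀2 : (2 : ℝ) ≤ d₀ := by
    have : 2 ≤ d₀ := by
      rw [hd₀]
      have := Nat.le_floor (n := 1) (by exact_mod_cast hT : ((1 : ℕ) : ℝ) ≤ (K - 1) * T)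
      omega
    exact_mod_cast this
  have hbase : 1 ≤ Real.sqrt 2 * C * Real.exp ((1 + max κ 0 / 4) * Real.log p) := by
    have h1 : 1 ≤ Real.sqrt 2 := Real.one_le_sqrt.2 (by norm_num)
    have h2 : 1 ≤ Real.exp ((1 + max κ 0 / 4) * Real.log p) := Real.one_le_exp (by positivity)
    exact one_le_mul_of_one_le_of_one_le (one_le_mul_of_one_le_of_one_le h1 hC) h2
  have hsub : ∀ b : Finset (Fin p), (t \ b).card ≤ T := fun b => by
    rw [← h.card_eq]; exact Finset.card_le_card Finset.sdiff_subset
  have hx := h.stage.odds_pos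
  refine (h.prob_lt_sum_le hσ hδ hC (class3 X t ν K)
    (fun k hk => (Finset.mem_filter.1 hk).2.2.2) d₀
    (R := (Real.sqrt 2 * C * Real.exp ((1 + max κ 0 / 4) * Real.log p)) ^ T)
    (e := (K - 1) * T / 2 + 1) (by linarith) hlarge (by positivity)
    (fun b => K * t.card < b.card)
    (fun k hk b h1 h2 h3 h4 => by rw [h4]; exact (Finset.mem_filter.1 hk).2.2.1)
    (fun b hb => ?_) (fun b _ => ?_)).trans (ENNReal.ofReal_le_ofReal ?_)
  -- `|b \ t| - |t \ b| = |b| - |t|`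
  · have h1 := Finset.card_sdiff_add_card_inter b t
    have h2 := Finset.card_sdiff_add_card_inter t b
    rw [Finset.inter_comm, h.card_eq] at h2
    rw [h.card_eq] at hb
    have h3 : ⌊(K - 1) * (T : ℝ)⌋₊ < b.card - T := by
      have hTb : (T : ℝ) < b.card := by
        have : (T : ℝ) ≤ K * T := le_mul_of_one_le_left (Nat.cast_nonneg _) hK
        linarith
      have hTb' : T < b.card := by exact_mod_cast hTb
      rw [Nat.floor_lt (by linarith), Nat.cast_sub hTb'.le]
      linarith
    omega
  · have h0 := h.sqrt_mul_card_mul_sqrt_le hC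
    exact (pow_le_pow_left₀ (by positivity) h0 _).trans (pow_le_pow_right₀ hbase (hsub b))
  · rw [mul_pow, ← Real.exp_nat_mul, ← mul_assoc, mul_assoc, ← Real.exp_add]
    have h0 : 0 ≤ halfConst σ C T d₀ * (Real.sqrt 2 * C) ^ T := by
      have : 0 ≤ C := by linarith
      unfold halfConst
      positivity
    refine mul_le_mul_of_nonneg_left (Real.exp_le_exp.2 ?_) h0
    have h1 : δ / 4 * ((K - 1) * T) * Real.log p ≤ δ / 4 * d₀ * Real.log p := by gcongr
    nlinarith only [h1]

end

/-! ### Models of large rank, and models of moderate dimension -/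

section

variable {n p : ℕ} {X : Matrix (Fin n) (Fin p) ℝ} {β : Fin p → ℝ} {t : Finset (Fin p)}
  {σ τ₀ τ₁ q δ ν κ K C A g l : ℝ} {T : ℕ}

/-- The constant of `Regular.sum_class1_le`. -/
noncomputable def largeConst (σ C a : ℝ) (T : ℕ) : ℝ :=
  (2 + 2 * T) * Real.log C + (1 + a⁻¹) * C ^ 2 / (2 * σ ^ 2)

/-- The models of large rank, when the noise has about its typical norm: `n / ((2 + ν) log p)`
superfluous covariates outweigh the likelihood gain `exp (n / 2)`, since `(1 + δ) / (2 + ν) > 1 / 2`. -/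
lemma Regular.sum_class1_le (h : Regular X β t σ τ₀ τ₁ q δ ν κ K T C A g l) (hσ : 0 < σ)
    (hδ : 0 < δ) (hν : 0 < ν) (hK : 1 ≤ K) (hC : 1 ≤ C) {r a : ℝ}
    (hr : r = (1 + δ) / (2 + ν) - 1 / 2) (ha0 : 0 < a) (ha1 : a ≤ 1) (har : a ≤ r / 6)
    (hCℓ : 8 * Real.log C ≤ r * (2 + ν) * Real.log p) (hp2 : 0 < Real.log p)
    (hlarge : C ≤ Real.exp (scaleLog n p δ))
    (hHn : (4 * T + δ * T + 2) * scaleLog n p δ + largeConst σ C a T ≤ r / 8 * n)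
    {y : Fin n → ℝ}
    (hy : ‖(WithLp.toLp 2 (y - X *ᵥ β) : EuclideanSpace ℝ (Fin n))‖ ^ 2 ≤ (1 + a) * n * σ ^ 2) :
    ∑ k ∈ class1 X t ν, posteriorRatio X σ τ₀ τ₁ q k t y ≤ Real.exp (-(r / 2) * n) := by
  rcases (class1 X t ν).eq_empty_or_nonempty with h0 | ⟨k₀, hk₀⟩
  · rw [h0, Finset.sum_empty]; exact (Real.exp_pos _).le
  have hn' : (0 : ℝ) < n := by exact_mod_cast h.n_pos
  have hlogC : 0 ≤ Real.log C := Real.log_nonneg hC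
  have hC0 : 0 < C := by linarith
  -- a model of rank above the bound exists, so the bound is not `p`
  have hsize : sizeBound n p ν = n / ((2 + ν) * Real.log p) := by
    have h1 := (Finset.mem_filter.1 hk₀).2.2
    have h2 : (modelRank X k₀ : ℝ) ≤ p := by exact_mod_cast modelRank_le X k₀
    rcases min_choice (p : ℝ) ((n : ℝ) / ((2 + ν) * Real.log p)) with h3 | h3
    · rw [sizeBound, h3] at h1
      linarith
    · rw [sizeBound, h3]
  set S := sizeBound n p ν with hS
  set ℓ := Real.log p with hℓ
  set H := scaleLog n p δ with hH
  have hHℓ : (1 + δ) * ℓ ≤ H := log_le_scaleLog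
  have hT0 : (0 : ℝ) ≤ T := Nat.cast_nonneg _
  have hTS : (T : ℝ) ≤ S := (le_mul_of_one_le_left hT0 hK).trans h.size
  have hS0 : 0 ≤ S := hT0.trans hTS
  set N := ⌊S⌋₊ with hN
  have hNS : (N : ℝ) ≤ S := Nat.floor_le hS0
  have hTN : T ≤ N := Nat.le_floor hTS
  have hx := h.stage.odds_pos
  have hA := h.stage.A_pos
  have hl := h.stage.l_pos
  have hHpos : 0 ≤ H := le_trans (by positivity) hHℓ
  have hlL : l ≤ Real.exp (Real.log C - H) := by
    rw [Real.exp_sub, Real.exp_log hC0, div_eq_mul_inv, ← Real.exp_neg]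
    exact h.l_le
  have hCH : Real.log C ≤ H := by
    rw [Real.log_le_iff_le_exp hC0]; exact hlarge
  have hl1 : l ≤ 1 := hlL.trans (Real.exp_le_one_iff.2 (by linarith))
  have hg1 : 1 ≤ C * Real.exp (H + δ / 2 * ℓ) :=
    one_le_mul_of_one_le_of_one_le hC (Real.one_le_exp (by positivity))
  have hmain := h.stage.sum_ratio_large_le hσ (class1 X t ν) hNS (by rw [h.card_eq]; exact hTN)
    (fun k hk => by
      have h1 := (Finset.mem_filter.1 hk).2.2
      have h2 : (N : ℝ) < modelRank X k := lt_of_le_of_lt hNS h1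
      exact_mod_cast h2.le) hg1 h.g_le hl1 ha0 hy
  refine hmain.trans ?_
  rw [h.card_eq]
  have e1 : (1 + q / (1 - q)) ^ p ≤ Real.exp (Real.log C) := by
    rw [Real.exp_log hC0]; exact h.odds_pow_le
  have e2 : ((q / (1 - q)) ^ T)⁻¹ ≤ Real.exp (T * (Real.log C + ℓ)) := by
    rw [← inv_pow, Real.exp_nat_mul, Real.exp_add, Real.exp_log hC0]
    have := h.inv_odds_le
    gcongr
  have e3 : A ≤ Real.exp (Real.log C) := by rw [Real.exp_log hC0]; exact h.A_le
  have e4 : (C * Real.exp (H + δ / 2 * ℓ)) ^ T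
      = Real.exp (T * (Real.log C + (H + δ / 2 * ℓ))) := by
    rw [Real.exp_nat_mul, Real.exp_add (Real.log C), Real.exp_log hC0]
  have e5 : l ^ (N - T) ≤ Real.exp ((S - 1 - T) * (Real.log C - H)) := by
    calc l ^ (N - T) ≤ Real.exp (Real.log C - H) ^ (N - T) := by gcongr
      _ = Real.exp ((N - T) * (Real.log C - H)) := by
          rw [← Real.exp_nat_mul, Nat.cast_sub hTN]
      _ ≤ _ := by
          apply Real.exp_le_exp.2
          have h1 : S < N + 1 := Nat.lt_floor_add_one S
          have h2 : 0 ≤ (N + 1 - S) * (H - Real.log C) :=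
            mul_nonneg (by linarith) (by linarith)
          linarith
  have e6 : (1 + a⁻¹) * ‖partialMean X β tᶜ‖ ^ 2 / (2 * σ ^ 2)
      ≤ (1 + a⁻¹) * C ^ 2 / (2 * σ ^ 2) := by
    have := h.inactive_le
    gcongr
  rw [e4, div_eq_mul_inv]
  calc _ ≤ Real.exp (Real.log C) * Real.exp (T * (Real.log C + ℓ)) * (Real.exp (Real.log C)
        * Real.exp (T * (Real.log C + (H + δ / 2 * ℓ)))
        * Real.exp ((S - 1 - T) * (Real.log C - H))
        * Real.exp ((1 + a) ^ 2 / 2 * n + (1 + a⁻¹) * C ^ 2 / (2 * σ ^ 2))) := by gcongr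
    _ = Real.exp (Real.log C + T * (Real.log C + ℓ) + (Real.log C
        + T * (Real.log C + (H + δ / 2 * ℓ)) + (S - 1 - T) * (Real.log C - H)
        + ((1 + a) ^ 2 / 2 * n + (1 + a⁻¹) * C ^ 2 / (2 * σ ^ 2)))) := by
        simp only [Real.exp_add]
    _ ≤ _ := by
        apply Real.exp_le_exp.2
        have hSℓ : S * ((2 + ν) * ℓ) = n := by rw [hsize]; field_simp
        have f1 : S * Real.log C ≤ r / 8 * n := by
          rw [← hSℓ]
          have := mul_le_mul_of_nonneg_left hCℓ hS0
          linarith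
        have f2 : (1 + δ) / (2 + ν) * n ≤ S * H := by
          rw [← hSℓ]
          calc (1 + δ) / (2 + ν) * (S * ((2 + ν) * ℓ)) = S * ((1 + δ) * ℓ) := by field_simp
            _ ≤ S * H := by gcongr
        have f3 : (1 + a) ^ 2 / 2 * n ≤ (1 / 2 + r / 4) * n := by
          gcongr
          nlinarith only [ha0, ha1, har]
        have f4 : ℓ ≤ H := by nlinarith only [hHℓ, mul_pos hδ hp2]
        have f5 : T * ℓ ≤ T * H := by gcongr
        have f6 : δ * T * ℓ ≤ δ * T * H := by gcongr
        have f7 : (1 + δ) / (2 + ν) = r + 1 / 2 := by rw [hr]; ring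
        rw [f7] at f2
        have f8 : 0 ≤ δ * T * H := by positivity
        have f9 : 0 ≤ T * H := by positivity
        have f10 : 0 ≤ T * Real.log C := by positivity
        rw [largeConst] at hHn
        linarith

/-- The constant of `Regular.prob_lt_sum_class4_le`. -/
noncomputable def moderateConst (C : ℝ) (T N : ℕ) : ℝ := C + (2 + 2 * T + 2 * N) * Real.log C

/-- The empty model is among the competitors of a nonempty `t`. -/
lemma separation_ne_top {X : Matrix (Fin n) (Fin p) ℝ} {β : Fin p → ℝ} {t : Finset (Fin p)}
    (hK : 0 ≤ K) (ht : t.card ≠ 0) : separation X β t K ≠ ∞ := by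
  refine ne_top_of_le_ne_top ENNReal.ofReal_ne_top
    (separation_le (X := X) (β := β) (k := ∅) (K := K) (c := 0) ?_ ?_ fun _ _ => rfl)
  · rw [Finset.card_empty, Nat.cast_zero]; positivity
  · rw [Finset.subset_empty]; rintro rfl; simp at ht

/-- The models of moderate dimension which miss an active covariate. Shrinking and the inactive part
of the mean reduce the separation only slightly, and the identifiability condition makes it dominate
the gain from the missed covariates. -/
lemma Regular.prob_lt_sum_class4_le (h : Regular X β t σ τ₀ τ₁ q δ ν κ K T C A g l) (hσ : 0 < σ)
    (hδ : 0 < δ) (hK : 1 + 8 / δ < K) (hC : 1 ≤ C) (hT : T ≠ 0) {N : ℕ}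
    (hN : N = ⌊K * (T : ℝ)⌋₊) {Δ : ℝ} (hΔ : Δ = (separation X β t K).toReal) :
    trueLaw X β σ {y | 2 ^ T * (N + 1) * (2 * Real.exp (-(slack δ * (Δ / (2 * σ ^ 2)))))
        < ∑ k ∈ class4 X t K, posteriorRatio X σ τ₀ τ₁ q k t y}
      ≤ ENNReal.ofReal (2 ^ T * (N + 1) * (3 * Real.exp (fiberConst σ (slack δ)
          (moderateConst C T N) (C ^ 2 / slack δ) N - slack δ ^ 2 / 8 * (Δ / (2 * σ ^ 2))))) := by
  have hη := slack_pos hδ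
  have hη1 := slack_le hδ
  have hK0 : 0 ≤ K := le_trans (by positivity) hK.le
  have hC0 : 0 < C := by linarith
  have hlogC : 0 ≤ Real.log C := Real.log_nonneg hC
  have hCm : C ≤ moderateConst C T N := by
    rw [moderateConst]
    have : 0 ≤ (2 + 2 * T + 2 * N) * Real.log C := by positivity
    linarith
  have hsepT := separation_ne_top (X := X) (β := β) hK0 (by rw [h.card_eq]; exact hT)
  have hΔ0 : 0 ≤ Δ := by rw [hΔ]; exact ENNReal.toReal_nonneg
  have hγΔ : gammaBound n p T σ δ ≤ Δ := by
    have h1 := h.sep.le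
    rw [← ENNReal.ofReal_toReal hsepT, ← hΔ] at h1
    exact (ENNReal.ofReal_le_ofReal_iff hΔ0).1 h1
  have hHΔ : 5 / 2 * (T * scaleLog n p δ) ≤ Δ / (2 * σ ^ 2) := by
    rw [le_div_iff₀ (by positivity)]
    have := scaleLog_le_gammaBound (n := n) (p := p) (T := T) (σ := σ) h.n_pos h.p_pos hδ
    linarith
  have hsep : ∀ (k : Finset (Fin p)) (c : Fin p → ℝ), (k.card : ℝ) ≤ K * t.card → ¬ t ⊆ k →
      (∀ i ∉ k, c i = 0) →
      (1 - 2 * slack δ) * Δ - C ^ 2 / slack δ ≤ ‖shrunkDesign X τ₀ (β - c)‖ ^ 2 := by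
    intro k c hk htk hc
    have h1 : Δ ≤ ‖partialMean X β t - designMap X c‖ ^ 2 := by
      have h2 := separation_le (X := X) (β := β) hk htk hc
      rw [← ENNReal.ofReal_toReal hsepT, ← hΔ] at h2
      exact (ENNReal.ofReal_le_ofReal_iff (by positivity)).1 h2
    set u := shrink X τ₀ (partialMean X β t - designMap X c) with hu
    set w := shrink X τ₀ (partialMean X β tᶜ) with hw
    have h3 : shrunkDesign X τ₀ (β - c) = u + w := by
      rw [shrunkDesign_apply, hu, hw, ← map_add, map_sub, ← partialMean_add_compl X β t]
      congr 1
      abel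
    have h4 : Δ ≤ (1 + slack δ) * ‖u‖ ^ 2 := h1.trans (h.stage.shrink_ge _)
    have h5 : ‖w‖ ≤ C := (norm_shrink_le _ _ _).trans h.inactive_le
    have h6 : ‖w‖ ^ 2 ≤ C ^ 2 := by gcongr
    have h7 : ‖u‖ - ‖w‖ ≤ ‖u + w‖ := by
      have := norm_sub_le (u + w) w
      rw [add_sub_cancel_right] at this
      linarith
    have h8 : ‖u‖ ^ 2 ≤ (1 + slack δ) * ‖u + w‖ ^ 2 + (1 + 1 / slack δ) * ‖w‖ ^ 2 := by
      have h9 : ‖u‖ ^ 2 ≤ (‖u + w‖ + ‖w‖) ^ 2 := by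
        gcongr; linarith
      have h10 : 0 ≤ (slack δ * ‖u + w‖ - ‖w‖) ^ 2 / slack δ := by positivity
      have h11 : (slack δ * ‖u + w‖ - ‖w‖) ^ 2 / slack δ
          = slack δ * ‖u + w‖ ^ 2 - 2 * (‖u + w‖ * ‖w‖) + 1 / slack δ * ‖w‖ ^ 2 := by
        field_simp
        ring
      linarith
    have h12 : (1 + 1 / slack δ) * ‖w‖ ^ 2 ≤ (1 + slack δ) * (C ^ 2 / slack δ) := by
      have : (1 + 1 / slack δ) = (1 + slack δ) * (1 / slack δ) := by field_simp; ring
      rw [this, mul_assoc, one_div_mul_eq_div]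
      gcongr
    have h13 : Δ ≤ (1 + slack δ) * ((1 + slack δ) * (‖u + w‖ ^ 2 + C ^ 2 / slack δ)) := by
      refine h4.trans ?_
      gcongr
      linarith
    rw [h3]
    set V := ‖u + w‖ ^ 2 + C ^ 2 / slack δ with hV
    have hV0 : 0 ≤ V := by positivity
    have h14 : (1 - 2 * slack δ) * ((1 + slack δ) * ((1 + slack δ) * V)) ≤ 1 * V := by
      rw [← mul_assoc, ← mul_assoc]
      gcongr
      nlinarith only [mul_pos hη hη, pow_pos hη 3]
    have h15 : (1 - 2 * slack δ) * Δ ≤ (1 - 2 * slack δ) * ((1 + slack δ) * ((1 + slack δ) * V)) :=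
      mul_le_mul_of_nonneg_left h13 (by linarith)
    linarith
  have hres := h.stage.prob_lt_sum_class4_le (K := K) hσ (Δ := Δ) (H := scaleLog n p δ)
    (C₀ := moderateConst C T N) (C₁ := C ^ 2 / slack δ) hδ hK h.p_pos hη le_rfl
    (by linarith) (by positivity) log_le_scaleLog (by rw [h.card_eq]; exact hHΔ)
    (h.inactive_le.trans hCm) hsep (by rw [h.card_eq]; exact h.size) (N := N)
    (by rw [h.card_eq]; exact hN) ?_
  · rwa [h.card_eq] at hres
  intro m d hm hd
  have hx := h.stage.odds_pos
  have hA := h.stage.A_pos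
  have hg := h.stage.g_pos
  have hl := h.stage.l_pos
  set ℓ := Real.log p with hℓ
  set H := scaleLog n p δ with hH
  have e1 : (1 + q / (1 - q)) ^ p ≤ Real.exp (Real.log C) := by
    rw [Real.exp_log hC0]; exact h.odds_pow_le
  have e2 : A ≤ Real.exp (Real.log C) := by rw [Real.exp_log hC0]; exact h.A_le
  have e3 : g / (q / (1 - q)) ≤ Real.exp (2 * Real.log C + (H + (1 + δ / 2) * ℓ)) := by
    have h1 : Real.exp (2 * Real.log C + (H + (1 + δ / 2) * ℓ))
        = C * Real.exp (H + δ / 2 * ℓ) * (C * Real.exp ℓ) := by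
      rw [show 2 * Real.log C + (H + (1 + δ / 2) * ℓ)
        = (Real.log C + (H + δ / 2 * ℓ)) + (Real.log C + ℓ) by ring, Real.exp_add,
        Real.exp_add (Real.log C), Real.exp_add (Real.log C), Real.exp_log hC0]
    rw [h1, div_eq_mul_inv]
    have h2 := h.g_le
    have h3 := h.inv_odds_le
    gcongr
  have e4 : q / (1 - q) * l ≤ Real.exp (2 * Real.log C - (H + ℓ)) := by
    have h1 : Real.exp (2 * Real.log C - (H + ℓ))
        = C * Real.exp (-ℓ) * (C * Real.exp (-H)) := by
      rw [show 2 * Real.log C - (H + ℓ)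
        = (Real.log C + -ℓ) + (Real.log C + -H) by ring, Real.exp_add,
        Real.exp_add (Real.log C), Real.exp_add (Real.log C), Real.exp_log hC0]
    rw [h1]
    have h2 := h.odds_le
    have h3 := h.l_le
    gcongr
  have hm' : (m : ℝ) ≤ T := by rw [← h.card_eq]; exact_mod_cast hm
  have hd' : (d : ℝ) ≤ N := by exact_mod_cast hd
  calc _ ≤ Real.exp (Real.log C) * Real.exp (Real.log C)
        * (Real.exp (2 * Real.log C + (H + (1 + δ / 2) * ℓ)) ^ m
          * Real.exp (2 * Real.log C - (H + ℓ)) ^ d) := by gcongr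
    _ = Real.exp (Real.log C + Real.log C + (m * (2 * Real.log C + (H + (1 + δ / 2) * ℓ))
          + d * (2 * Real.log C - (H + ℓ)))) := by
        rw [← Real.exp_nat_mul, ← Real.exp_nat_mul, ← Real.exp_add, ← Real.exp_add, ← Real.exp_add]
    _ ≤ _ := by
        apply Real.exp_le_exp.2
        have f1 : m * Real.log C ≤ T * Real.log C := by gcongr
        have f2 : d * Real.log C ≤ N * Real.log C := by gcongr
        rw [moderateConst]
        linarith

end

/-! ### The four classes along a sequence of problems -/

section

variable {D : RegressionSeq} {δ ν κ K σ : ℝ} {T : ℕ}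

lemma one_sub_le_probRatioSumLE {n : ℕ} {M : Finset (Finset (Fin (D.p n)))} {B₀ B r : ℝ}
    (hB : B₀ ≤ B) (hr : 0 ≤ r)
    (h : trueLaw (D.X n) (D.β n) σ {y | B₀ < ratioSum D σ n M y} ≤ ENNReal.ofReal r) :
    1 - r ≤ probRatioSumLE D σ n M B :=
  one_sub_le_measureReal _ (fun _ hy => (not_lt.1 hy).trans hB) hr h

/-- An empty class of models contributes nothing. -/
lemma probRatioSumLE_eq_one {n : ℕ} {M : Finset (Finset (Fin (D.p n)))} {B : ℝ} (hM : M = ∅)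
    (hB : 0 ≤ B) : probRatioSumLE D σ n M B = 1 := by
  have : {y : Fin n → ℝ | ratioSum D σ n M y ≤ B} = Set.univ := by
    simp [ratioSum, hM, hB]
  rw [probRatioSumLE, this, probReal_univ]

/-- Constants are absorbed by a loss in the rate of an exponential. -/
lemma eventually_mul_exp_lt {u : ℕ → ℝ} (hu : Tendsto u atTop atTop) (A : ℝ) {c c' : ℝ}
    (hc : c' < c) : ∀ᶠ n in atTop, A * Real.exp (-(c * u n)) < Real.exp (-c' * u n) := by
  have h1 : Tendsto (fun n => Real.exp ((c - c') * u n)) atTop atTop :=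
    Real.tendsto_exp_atTop.comp (hu.const_mul_atTop (sub_pos.2 hc))
  filter_upwards [h1.eventually_gt_atTop A] with n hn
  calc A * Real.exp (-(c * u n)) < Real.exp ((c - c') * u n) * Real.exp (-(c * u n)) := by gcongr
    _ = Real.exp (-c' * u n) := by rw [← Real.exp_add]; congr 1; ring

namespace Conditions

lemma tendsto_log (hD : Conditions D δ ν κ K σ T) :
    Tendsto (fun n => Real.log (D.p n)) atTop atTop :=
  Real.tendsto_log_atTop.comp (tendsto_natCast_atTop_atTop.comp hD.dim_tendsto)

lemma tendsto_scaleLog (hD : Conditions D δ ν κ K σ T) (hδ : 0 < δ) :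
    Tendsto (fun n => scaleLog n (D.p n) δ) atTop atTop :=
  tendsto_atTop_mono (fun _ => log_le_scaleLog)
    (hD.tendsto_log.const_mul_atTop (by linarith : 0 < 1 + δ))

lemma eventually_scaleLog_le (hD : Conditions D δ ν κ K σ T) (hδ : 0 < δ) {c : ℝ} (hc : 0 < c) :
    ∀ᶠ n : ℕ in atTop, scaleLog n (D.p n) δ ≤ c * n := by
  have h1 : (fun n : ℕ => Real.log n) =o[atTop] (fun n : ℕ => (n : ℝ)) :=
    Real.isLittleO_log_id_atTop.comp_tendsto tendsto_natCast_atTop_atTop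
  filter_upwards [h1.bound hc, hD.dim_log.bound (by positivity : 0 < c / (1 + δ))] with n h2 h3
  rw [Real.norm_eq_abs, Real.norm_natCast] at h2 h3
  have h4 := le_abs_self (Real.log n)
  have h5 : (1 + δ) * Real.log (D.p n) ≤ (1 + δ) * (c / (1 + δ) * n) :=
    mul_le_mul_of_nonneg_left ((le_abs_self _).trans h3) (by linarith)
  have h6 : (1 + δ) * (c / (1 + δ) * n) = c * n := by field_simp
  have h7 : 0 ≤ c * n := by positivity
  exact max_le (by linarith) (by linarith)

/-- The exceptional event is that the norm of the noise is not typical. -/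
lemma class1_eventually (hD : Conditions D δ ν κ K σ T) (hδ : 0 < δ) (hν : 0 < ν) (hK : 1 ≤ K)
    (hσ : 0 < σ) {r a c' w' : ℝ} (hr0 : 0 < r) (hr : r = (1 + δ) / (2 + ν) - 1 / 2) (ha0 : 0 < a)
    (ha1 : a ≤ 1) (har : a ≤ r / 6) (hc' : c' ≤ (a - Real.log (1 + a)) / 2) (hw' : w' ≤ r / 2) :
    ∀ᶠ n : ℕ in atTop, 1 - 2 * Real.exp (-c' * n)
      ≤ probRatioSumLE D σ n (class1 (D.X n) (D.t n) ν) (Real.exp (-w' * n)) := by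
  obtain ⟨C, hC, hreg⟩ := eventually_regular hδ hν hK hσ hD
  have hT0 : (0 : ℝ) < 4 * T + δ * T + 2 := by positivity
  have hbig : ∀ᶠ n : ℕ in atTop, largeConst σ C a T ≤ r / 16 * n :=
    (tendsto_natCast_atTop_atTop.const_mul_atTop (by positivity)).eventually_ge_atTop _
  filter_upwards [hreg, hD.tendsto_log.eventually_ge_atTop (8 * Real.log C / (r * (2 + ν))),
    hD.tendsto_log.eventually_gt_atTop 0,
    (Real.tendsto_exp_atTop.comp (hD.tendsto_scaleLog hδ)).eventually_ge_atTop C,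
    hD.eventually_scaleLog_le hδ (by positivity : 0 < r / 16 / (4 * T + δ * T + 2)),
    hbig] with n ⟨A, g, l, h⟩ h1 h2 h3 h4 h5
  have h6 : (4 * T + δ * T + 2) * scaleLog n (D.p n) δ ≤ r / 16 * n := by
    calc _ ≤ (4 * T + δ * T + 2) * (r / 16 / (4 * T + δ * T + 2) * n) := by gcongr
      _ = _ := by field_simp
  have h7 : 8 * Real.log C ≤ r * (2 + ν) * Real.log (D.p n) := by
    rw [div_le_iff₀ (by positivity)] at h1
    linarith
  have h8 : trueLaw (D.X n) (D.β n) σ {y | Real.exp (-(r / 2) * n)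
        < ratioSum D σ n (class1 (D.X n) (D.t n) ν) y}
      ≤ ENNReal.ofReal (Real.exp (-((a - Real.log (1 + a)) / 2) * n)) := by
    refine le_trans (measure_mono fun y hy => ?_) (prob_lt_norm_sq_le (D.X n) (D.β n) hσ ha0)
    by_contra hy'
    exact absurd hy (not_lt.2 (h.sum_class1_le hσ hδ hν hK hC hr ha0 ha1 har h7 h2 h3
      (by linarith) (not_lt.1 hy')))
  have h9 : Real.exp (-(r / 2) * n) ≤ Real.exp (-w' * n) := by gcongr
  refine le_trans ?_ (one_sub_le_probRatioSumLE h9 (Real.exp_pos _).le h8)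
  have h10 : Real.exp (-((a - Real.log (1 + a)) / 2) * n) ≤ Real.exp (-c' * n) := by gcongr
  linarith [Real.exp_pos (-c' * n)]

lemma eventually_sqrt_two_mul_le (hD : Conditions D δ ν κ K σ T) (hδ : 0 < δ) (C : ℝ) :
    ∀ᶠ n : ℕ in atTop, Real.sqrt 2 * C ≤ Real.exp (δ / 2 * Real.log (D.p n)) :=
  (Real.tendsto_exp_atTop.comp
    (hD.tendsto_log.const_mul_atTop (by positivity : 0 < δ / 2))).eventually_ge_atTop _

lemma class2_eventually (hD : Conditions D δ ν κ K σ T) (hδ : 0 < δ) (hν : 0 < ν) (hK : 1 ≤ K)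
    (hσ : 0 < σ) {c' : ℝ} (hc' : c' < δ / 4) :
    ∀ᶠ n : ℕ in atTop, 1 - Real.exp (-c' * Real.log (D.p n))
      < probRatioSumLE D σ n (class2 (D.X n) (D.t n) ν) (vRate n (D.p n) δ) := by
  obtain ⟨C, hC, hreg⟩ := eventually_regular hδ hν hK hσ hD
  filter_upwards [hreg, hD.eventually_sqrt_two_mul_le hδ C,
    eventually_mul_exp_lt hD.tendsto_log (halfConst σ C T 1) hc'] with n ⟨A, g, l, h⟩ h1 h2
  refine lt_of_lt_of_le ?_ (one_sub_le_probRatioSumLE le_rfl ?_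
    (h.prob_lt_sum_class2_le hσ hδ hC h1))
  · linarith
  · unfold halfConst; positivity

lemma class3_eventually (hD : Conditions D δ ν κ K σ T) (hδ : 0 < δ) (hν : 0 < ν) (hK : 1 ≤ K)
    (hσ : 0 < σ) (hT : T = 0 ∨ 1 ≤ (K - 1) * T) {c' : ℝ}
    (hc' : c' * K < (K - 1) * δ / 4 - 1 - max κ 0 / 4) :
    ∀ᶠ n : ℕ in atTop, 1 - Real.exp (-c' * K * T * Real.log (D.p n))
      < probRatioSumLE D σ n (class3 (D.X n) (D.t n) ν K)
        (vRate n (D.p n) δ ^ ((K - 1) * T / 2 + 1)) := by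
  obtain ⟨C, hC, hreg⟩ := eventually_regular hδ hν hK hσ hD
  -- no model misses a covariate of the empty model
  rcases Nat.eq_zero_or_pos T with hT0 | hT0
  · filter_upwards [hreg] with n ⟨A, g, l, h⟩
    have ht : D.t n = ∅ := Finset.card_eq_zero.1 (h.card_eq.trans hT0)
    rw [probRatioSumLE_eq_one]
    · linarith [Real.exp_pos (-c' * K * T * Real.log (D.p n))]
    · simp [class3, ht]
    · refine Real.rpow_nonneg ?_ _
      unfold vRate; positivity
  have hT1 : 1 ≤ (K - 1) * T := hT.resolve_left hT0.ne'
  have hT' : (0 : ℝ) < T := by exact_mod_cast hT0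
  set d₀ := ⌊(K - 1) * (T : ℝ)⌋₊ + 1 with hd₀
  filter_upwards [hreg, hD.eventually_sqrt_two_mul_le hδ C,
    eventually_mul_exp_lt hD.tendsto_log (halfConst σ C T d₀ * (Real.sqrt 2 * C) ^ T)
      (mul_lt_mul_of_pos_right hc' hT')] with n ⟨A, g, l, h⟩ h1 h2
  refine lt_of_lt_of_le ?_ (one_sub_le_probRatioSumLE le_rfl ?_
    (h.prob_lt_sum_class3_le hσ hδ hK hC hT1 h1 hd₀))
  · rw [show -c' * K * T = -(c' * K * T) by ring]
    linarith
  · unfold halfConst; positivity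

lemma class4_eventually (hD : Conditions D δ ν κ K σ T) (hδ : 0 < δ) (hν : 0 < ν)
    (hK : 1 + 8 / δ < K) (hσ : 0 < σ) {c' w' w'' : ℝ}
    (hc' : c' < slack δ ^ 2 / 8 / (2 * σ ^ 2)) (hw0 : 0 ≤ w') (hw' : w' < slack δ / (2 * σ ^ 2))
    (hw'' : 0 ≤ w'') :
    ∀ᶠ n : ℕ in atTop,
      1 - Real.exp (-c' * (separation (D.X n) (D.β n) (D.t n) K).toReal)
        < probRatioSumLE D σ n (class4 (D.X n) (D.t n) K)
          (Real.exp (-w' * ((separation (D.X n) (D.β n) (D.t n) K).toReal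
            - w'' * gammaBound n (D.p n) T σ δ))) := by
  have hK1 : 1 ≤ K := le_trans (by have : 0 < 8 / δ := by positivity
                                   linarith) hK.le
  obtain ⟨C, hC, hreg⟩ := eventually_regular hδ hν hK1 hσ hD
  -- no model misses a covariate of the empty model
  rcases Nat.eq_zero_or_pos T with hT0 | hT0
  · filter_upwards [hreg] with n ⟨A, g, l, h⟩
    have ht : D.t n = ∅ := Finset.card_eq_zero.1 (h.card_eq.trans hT0)
    rw [probRatioSumLE_eq_one (by simp [class4, ht]) (Real.exp_pos _).le]
    linarith [Real.exp_pos (-c' * (separation (D.X n) (D.β n) (D.t n) K).toReal)]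
  have hT' : (0 : ℝ) < T := by exact_mod_cast hT0
  have hγ : ∀ᶠ n : ℕ in atTop, 5 * σ ^ 2 * T * scaleLog n (D.p n) δ ≤ gammaBound n (D.p n) T σ δ := by
    filter_upwards [hreg] with n ⟨A, g, l, h⟩
    exact scaleLog_le_gammaBound h.n_pos h.p_pos hδ
  have hγΔ : ∀ᶠ n : ℕ in atTop,
      gammaBound n (D.p n) T σ δ ≤ (separation (D.X n) (D.β n) (D.t n) K).toReal := by
    filter_upwards [hreg] with n ⟨A, g, l, h⟩
    have h1 := h.sep.le
    have h2 := separation_ne_top (X := D.X n) (β := D.β n) (zero_le_one.trans hK1)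
      (h.card_eq.trans_ne hT0.ne')
    exact (ENNReal.ofReal_le_iff_le_toReal h2).1 h1
  have hγtop : Tendsto (fun n => 5 * σ ^ 2 * T * scaleLog n (D.p n) δ) atTop atTop :=
    (hD.tendsto_scaleLog hδ).const_mul_atTop (by positivity)
  -- as `Δ → ∞`, the constant factors are absorbed by the exponential rates
  have hΔ : Tendsto (fun n => (separation (D.X n) (D.β n) (D.t n) K).toReal) atTop atTop :=
    tendsto_atTop_mono' _ (by filter_upwards [hγ, hγΔ] with n h1 h2 using h1.trans h2) hγtop
  set N := ⌊K * (T : ℝ)⌋₊ with hN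
  filter_upwards [hreg, hγ, hγtop.eventually_ge_atTop 0,
    eventually_mul_exp_lt hΔ (2 ^ T * (N + 1) * (3 * Real.exp (fiberConst σ (slack δ)
      (moderateConst C T N) (C ^ 2 / slack δ) N))) hc',
    eventually_mul_exp_lt hΔ (2 ^ T * (N + 1) * 2) hw'] with n ⟨A, g, l, h⟩ h1 h2 h3 h4
  set Δ := (separation (D.X n) (D.β n) (D.t n) K).toReal with hΔn
  have hres := h.prob_lt_sum_class4_le hσ hδ hK hC hT0.ne' hN hΔn
  refine lt_of_lt_of_le ?_ (one_sub_le_probRatioSumLE ?_ (by positivity) hres)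
  · have h5 : slack δ ^ 2 / 8 * (Δ / (2 * σ ^ 2)) = slack δ ^ 2 / 8 / (2 * σ ^ 2) * Δ := by ring
    rw [sub_eq_add_neg (fiberConst _ _ _ _ _), Real.exp_add, h5]
    linarith
  · have h5 : slack δ * (Δ / (2 * σ ^ 2)) = slack δ / (2 * σ ^ 2) * Δ := by ring
    rw [h5, ← mul_assoc]
    refine h4.le.trans (Real.exp_le_exp.2 ?_)
    have : 0 ≤ w' * (w'' * gammaBound n (D.p n) T σ δ) := by
      have := h2.trans h1
      positivity
    linarith

end Conditions

end

end SpikeSlab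

theorem lemma2 (δ ν κ K σ : ℝ) (T : ℕ)
    (hδ : 0 < δ) (hν : 0 < ν) (hνδ : ν < δ) (hK : 1 + 8 / δ < K)
    (hκ : κ < (K - 1) * δ / 2) (hσ : 0 < σ) :
    ∃ c' w' w'' : ℝ, 0 < c' ∧ 0 < w' ∧ 0 < w'' ∧ w'' < 1 ∧
      ∀ D : SpikeSlab.RegressionSeq, SpikeSlab.Conditions D δ ν κ K σ T →
        ∃ C : ℝ, 0 < C ∧
          (∀ᶠ n : ℕ in Filter.atTop,
            SpikeSlab.probRatioSumLE D σ n (SpikeSlab.class1 (D.X n) (D.t n) ν)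
                (C * Real.exp (-w' * n))
              ≥ 1 - 2 * Real.exp (-c' * n)) ∧
          (∀ᶠ n : ℕ in Filter.atTop,
            SpikeSlab.probRatioSumLE D σ n (SpikeSlab.class2 (D.X n) (D.t n) ν)
                (C * SpikeSlab.vRate n (D.p n) δ)
              > 1 - Real.exp (-c' * Real.log (D.p n))) ∧
          ((T = 0 ∨ 1 ≤ (K - 1) * T) →
            ∀ᶠ n : ℕ in Filter.atTop,
              SpikeSlab.probRatioSumLE D σ n (SpikeSlab.class3 (D.X n) (D.t n) ν K)
                  (C * SpikeSlab.vRate n (D.p n) δ ^ ((K - 1) * T / 2 + 1))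
                > 1 - Real.exp (-c' * K * T * Real.log (D.p n))) ∧
          (∀ᶠ n : ℕ in Filter.atTop,
            SpikeSlab.probRatioSumLE D σ n (SpikeSlab.class4 (D.X n) (D.t n) K)
                (C * Real.exp (-w' *
                  ((SpikeSlab.separation (D.X n) (D.β n) (D.t n) K).toReal
                    - w'' * SpikeSlab.gammaBound n (D.p n) T σ δ)))
              > 1 - Real.exp (-c' *
                  (SpikeSlab.separation (D.X n) (D.β n) (D.t n) K).toReal)) := by
  have hη := SpikeSlab.slack_pos hδ
  have h8 : 8 < (K - 1) * δ := by
    have h1 : 8 / δ < K - 1 := by linarith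
    rwa [div_lt_iff₀ hδ] at h1
  have hK1 : 1 < K := by nlinarith only [h8, hδ]
  have hK0 : 0 < K := by linarith
  -- the surplus of the penalty of a model of large rank over its likelihood gain, per observation
  set r := (1 + δ) / (2 + ν) - 1 / 2 with hr
  have hr0 : 0 < r := by
    rw [hr, sub_pos, div_lt_div_iff₀ two_pos (by linarith)]
    linarith
  set a := min 1 (r / 6) with ha
  have ha0 : 0 < a := by positivity
  have hlog : 0 < (a - Real.log (1 + a)) / 2 := by
    have := Real.log_lt_sub_one_of_pos (by linarith : 0 < 1 + a) (by linarith)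
    linarith
  -- the rate for the large models which miss an active covariate, per active covariate
  set ζ := (K - 1) * δ / 4 - 1 - max κ 0 / 4 with hζ
  have hζ0 : 0 < ζ := by
    have : max κ 0 < (K - 1) * δ / 2 := max_lt hκ (by linarith)
    rw [hζ]; linarith
  set η := SpikeSlab.slack δ with hηdef
  -- one rate for each of the four classes, halved where a constant factor has to be absorbed
  set c' := min (min ((a - Real.log (1 + a)) / 2) (δ / 8))
    (min (ζ / (2 * K)) (η ^ 2 / 16 / (2 * σ ^ 2))) with hc'
  set w' := min (r / 2) (η / 2 / (2 * σ ^ 2)) with hw'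
  have hc0 : 0 < c' := by positivity
  have hw0 : 0 < w' := by positivity
  have hc1 : c' ≤ (a - Real.log (1 + a)) / 2 := (min_le_left _ _).trans (min_le_left _ _)
  have hc2 : c' ≤ δ / 8 := (min_le_left _ _).trans (min_le_right _ _)
  have hc3 : c' ≤ ζ / (2 * K) := (min_le_right _ _).trans (min_le_left _ _)
  have hc4 : c' ≤ η ^ 2 / 16 / (2 * σ ^ 2) := (min_le_right _ _).trans (min_le_right _ _)
  have hc3' : c' * K < ζ := by
    rw [le_div_iff₀ (by positivity)] at hc3
    linarith
  refine ⟨c', w', 1 / 2, hc0, hw0, by norm_num, by norm_num, fun D hD =>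
    ⟨1, one_pos, ?_, ?_, fun hT => ?_, ?_⟩⟩
  · simpa only [one_mul] using hD.class1_eventually hδ hν hK1.le hσ hr0 hr ha0 (min_le_left _ _)
      (min_le_right _ _) hc1 (min_le_left _ _)
  · simpa only [one_mul] using hD.class2_eventually hδ hν hK1.le hσ (by linarith)
  · simpa only [one_mul] using hD.class3_eventually hδ hν hK1.le hσ hT hc3'
  · simp only [one_mul]
    refine hD.class4_eventually hδ hν hK hσ (hc4.trans_lt ?_) hw0.le
      ((min_le_right _ _).trans_lt ?_) (by norm_num)
    · gcongr; norm_num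
    · gcongr; exact half_lt_self hη
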